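/- Fix an integer $b\ge 1$ and $0<\alpha<1$. **Infinite Poisson model.** For $0\le\beta<1$ let $X_i$, $i\in\mathbb Z$, be i.i.d. $\mathrm{Po}(b\beta)$, the numbers of keys with hash address $i$ in a hash table on $\mathbb Z$ with buckets of size $b$. Let $Q_i=\max_{j\le i}\sum_{k=j+1}^i (X_k-b)$ be the overflow from bucket $i$ and $H_i=X_i+Q_{i-1}$ the number of keys that try bucket $i$; bucket $i$ is full iff $H_i\ge b$. Let $U_\beta$ be the least $k\ge 0$ with $H_k<b$ (the cost of an unsuccessful search started in bucket $0$, equivalently the displacement of a new key with hash address $0$), and $\psi_U(q;\beta)=\mathbb E\,q^{U_\beta}$. The FCFS displacement $D_\alpha$ of a random key has, by definition, the distribution $$\mathbb P(D_\alpha=k)=\frac1\alpha\int_0^\alpha \mathbb P(U_\beta=k)\,d\beta,\qquad k=0,1,2,\dots$$ **Exact model.** A cyclic table with $m\ge1$ buckets of size $b$, into which $n$ keys ($1\le n\le bm$) with independent uniform hash addresses in $\mathbb Z/m$ are inserted one after the other, each key being placed, for good, in the first non-full bucket in cyclic order from its hash address (first come, first served). The displacement of a key is the number of steps from its hash address to its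 bucket, and $D_{m,n}$ is the displacement of a uniformly random one of the $n$ keys. **Notation.** Let $T(z)=\sum_{k\ge1}k^{k-1}z^k/k!$, $\omega=e^{2\pi i/b}$, and $$\zeta_\ell(q;\beta)=T\bigl(\omega^\ell\beta e^{-\beta}q^{1/b}\bigr)/\beta\quad(0\le\ell\le b-1),\qquad T_0(b\beta)=\frac{b(1-\beta)}{\prod_{\ell=1}^{b-1}(1-\zeta_\ell(1;\beta))},$$ with the principal branch of $q^{1/b}$ (and $1^{1/b}=1$), and let $R=(e^{\alpha-1}/\alpha)^b>1$, so that these numbers are defined for $|q|\le R$ and $0<\beta\le\alpha$. **Theorem.** (1) $D_\alpha$ has a probability distribution on $\{0,1,2,\dots\}$ and, for every complex $q$ with $|q|\le R$, the expectation $\psi_{FC}(q;\alpha)=\mathbb E\,q^{D_\alpha}$ and the expectations $\psi_U(q;\beta)$, $0<\beta\le\alpha$, converge absolutely, and $$\psi_{FC}(q;\alpha)=\frac1\alpha\int_0^\alpha\psi_U(q;\beta)\,d\beta ;$$ if moreover $q\ne1$, then $$\psi_{FC}(q;\alpha)=\frac1\alpha\int_0^\alpha\frac{T_0(b\beta)}{1-q}\prod_{\ell=0}^{b-1}\bigl(1-\zeta_\ell(q;\beta)\bigr)\,d\beta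 =\frac1\alpha\int_0^\alpha\frac{b(1-\beta)\prod_{\ell=0}^{b-1}\bigl(1-\zeta_\ell(q;\beta)\bigr)}{(1-q)\prod_{\ell=1}^{b-1}\bigl(1-\zeta_\ell(1;\beta)\bigr)}\,d\beta .$$ The integrals converge absolutely. (2) All moments of $D_\alpha$ are finite. There is a $\delta>0$, depending only on $b$ and $\alpha$, such that $\mathbb E\,q^{D_\alpha}$ converges absolutely for $|q|\le1+\delta$ and, whenever $m,n\to\infty$ with $n/(bm)\to\alpha$: $D_{m,n}$ converges in distribution to $D_\alpha$; $\mathbb E\,D_{m,n}^r\to\mathbb E\,D_\alpha^r$ for every integer $r\ge0$; and $\mathbb E\,q^{D_{m,n}}\to\psi_{FC}(q;\alpha)$ uniformly for complex $q$ with $|q|\le1+\delta$. -/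

import Mathlib

open MeasureTheory ProbabilityTheory Filter Topology
open scoped NNReal ENNReal

namespace LinearProbing

noncomputable section

/-- The probability generating function `E (q ^ X)` of a random variable `X` with values in `ℕ`. -/
def pgf {Ω : Type*} [MeasurableSpace Ω] (μ : Measure Ω) (X : Ω → ℕ) (q : ℂ) : ℂ :=
  ∫ ω, q ^ X ω ∂μ

/-! ### The numbers `ζ_ℓ(q; α)` -/

/-- The tree function `T(z) = ∑_{n ≥ 1} n ^ (n - 1) z ^ n / n!` (summed over `n + 1`, `n ≥ 0`). -/
def treeFun (z : ℂ) : ℂ :=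
  ∑' n : ℕ, ((n : ℂ) + 1) ^ n / ((n + 1).factorial : ℂ) * z ^ (n + 1)

/-- The primitive `b`-th root of unity `ω = exp (2 π i / b)`. -/
def rootOfUnity (b : ℕ) : ℂ := Complex.exp (2 * Real.pi * Complex.I / b)

/-- `ζ_ℓ(q; α) = T(ω ^ ℓ α e ^ (-α) q ^ (1 / b)) / α`, with the principal branch of `q ^ (1 / b)`. -/
def zeta (b ℓ : ℕ) (q : ℂ) (α : ℝ) : ℂ :=
  treeFun (rootOfUnity b ^ ℓ * α * Real.exp (-α) * q ^ (1 / (b : ℂ))) / α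

/-- The radius `R = (e ^ (α - 1) / α) ^ b`, such that the series `T` defining the `ζ_ℓ(q; α)`
converge for `|q| ≤ R`. -/
def radius (b : ℕ) (α : ℝ) : ℝ := (Real.exp (α - 1) / α) ^ b

/-- `T_0(b α) = b (1 - α) / ∏_{ℓ = 1}^{b - 1} (1 - ζ_ℓ(1; α))`, as a function of `b` and `α`. -/
def tZero (b : ℕ) (α : ℝ) : ℂ :=
  (b : ℂ) * (1 - α) / ∏ ℓ ∈ Finset.Icc 1 (b - 1), (1 - zeta b ℓ 1 α)

/-! ### Hashing on `ℤ` and the infinite Poisson model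

`x i` is the number of keys with hash address `i`. -/

/-- The overflow `Q_i = max_{j ≤ i} ∑_{k = j + 1}^{i} (x_k - b)` from bucket `i` (with `j = i - L`). -/
def overflow (b : ℕ) (x : ℤ → ℕ) (i : ℤ) : ℤ :=
  ⨆ L : ℕ, ∑ k ∈ Finset.Ioc (i - L) i, ((x k : ℤ) - b)

/-- The profile: the number `H_i = x_i + Q_{i - 1}` of keys that try bucket `i`. -/
def profile (b : ℕ) (x : ℤ → ℕ) (i : ℤ) : ℤ := x i + overflow b x (i - 1)

/-- `U_i`: the number of full buckets met in an unsuccessful search that starts in bucket `i`, which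
is the displacement of a new key with hash address `i`. Bucket `j` is full iff `H_j ≥ b`. -/
def unsuccessful (b : ℕ) (x : ℤ → ℕ) (i : ℤ) : ℕ :=
  sInf {k : ℕ | profile b x (i + k) < b}

/-- The infinite Poisson model with load factor `α`: the `x_i`, `i ∈ ℤ`, are i.i.d. `Po(b α)`. -/
def poissonTable (b : ℕ) (α : ℝ) : Measure (ℤ → ℕ) :=
  Measure.infinitePi fun _ : ℤ => poissonMeasure (Real.toNNReal (b * α))

/-- The random variable `U_α` of the infinite Poisson model (it is `U_0`, by translation
invariance). -/
def unsuccessfulZero (b : ℕ) (x : ℤ → ℕ) : ℕ := unsuccessful b x 0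

/-- The law of the FCFS displacement `D_α` of a random key in the infinite Poisson model:
a key that arrives when the load factor is `β` has displacement distributed as `U_β`, and `β` is
uniform on `[0, α]`, so `P(D_α = k) = α⁻¹ ∫_0^α P(U_β = k) dβ`. -/
def fcfsLaw (b : ℕ) (α : ℝ) : Measure ℕ :=
  Measure.sum fun k : ℕ =>
    ENNReal.ofReal (1 / α * ∫ β in (0 : ℝ)..α, (poissonTable b β).real {x | unsuccessfulZero b x = k})
      • Measure.dirac k

/-! ### The exact model: linear probing with the FCFS rule in the cyclic table `ℤ / m` -/

/-- The number of steps from `a` to the first non-full bucket, in cyclic order from `a`, when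
bucket `i` holds `load i` keys. -/
def probe (b : ℕ) {m : ℕ} (load : ZMod m → ℕ) (a : ZMod m) : ℕ :=
  sInf {k : ℕ | load (a + k) < b}

/-- `occupancy b h t i` is the number of keys stored in bucket `i` after the first `t` of the `n`
keys, with hash addresses `h 0, h 1, …`, have been inserted one after the other. -/
def occupancy (b : ℕ) {m n : ℕ} (h : Fin n → ZMod m) : ℕ → ZMod m → ℕ
  | 0 => 0
  | t + 1 =>
    if ht : t < n then
      occupancy b h t + Pi.single (h ⟨t, ht⟩ + (probe b (occupancy b h t) (h ⟨t, ht⟩) : ZMod m)) 1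
    else occupancy b h t

/-- The FCFS displacement of key `j`: keys do not move once they are stored. -/
def displacement (b : ℕ) {m n : ℕ} (h : Fin n → ZMod m) (j : Fin n) : ℕ :=
  probe b (occupancy b h j) (h j)

/-- The probability space of the exact model with `m` buckets and `n` keys: independent uniform hash
addresses of the `n` keys, and an independent uniformly random choice of one of the keys. -/
def exactMeasure (m n : ℕ) : Measure ((Fin n → ZMod m) × Fin n) := uniformOn Set.univ

/-- The FCFS displacement `D_{m,n}` of a random key in the exact model. -/
def exactDisplacement (b m n : ℕ) (p : (Fin n → ZMod m) × Fin n) : ℕ := displacement b p.1 p.2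

instance exactMeasure_isProbabilityMeasure (m n : ℕ) [NeZero m] [NeZero n] :
    IsProbabilityMeasure (exactMeasure m n) :=
  isProbabilityMeasure_uniformOn Set.finite_univ Set.univ_nonempty

end

end LinearProbing

open LinearProbing

/-! Both models reduce to one combinatorial event. Bucket `i` is full exactly when some window of `L
≥ 1` buckets ending at `i` contains at least `b L` hash addresses (`le_profile_iff` on ℤ,
`occupancy_eq_iff` for the periodic extension of the cyclic table). A search from bucket `0` costs
at least `k` iff buckets `0, …, k - 1` are full, almost surely in the infinite model. Concatenating
windows (`exists_long_window`) turns a run of `k` full buckets into one window of length at least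
`k`, so Chernoff bounds for windows give geometric tails in `k`; in the cyclic table they are
uniform in `m` as long as the load stays below a constant less than 1.

Generating function. Let `ψ_k(z)` be the generating function of the overflow `Q_{k-1}` on the event
that buckets `0, …, k - 1` are full. Adding the keys of bucket `k` gives a recursion from `ψ_k` to
`ψ_{k+1}` (`runGF_mul_exp`) whose unknowns are the probabilities of a run of length `k` followed by
`H_k = j`, `j < b`. Stationarity of the overflow closes it at `k = 0`. By `T e^{-T} = z`, the kernel
`z^b - q e^{bβ(z-1)}` vanishes at the `ζ_ℓ(q)`, which for `0 < |q| ≤ 1` are `b` distinct points of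
the closed unit disc: enough to determine a polynomial of degree `b` with known leading coefficient.
For `q = 1` this gives `P(U = 0) = T_0(bβ)`, for `0 < |q| < 1` it gives `(1 - q) ψ_U(q) = T_0(bβ) ∏
(1 - ζ_ℓ(q))`. To reach `|q| ≤ R`, boundary included, compare power series in `s = q^{1/b}`: the
right side converges absolutely for `|s|^b ≤ R`, its coefficients are the increments of `k ↦ P(U =
k)`, and summability with weights `R^k` passes from the increments to the probabilities. The closed
form at `q = R` bounds `E R^{U_β}` uniformly in `β`, so the series may be integrated over `β` term
by term.

Exact model. Later keys never displace earlier ones, so after a rotation `P(D_{m,n} ≥ k)` is the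
average over `t < n` of the probability of a run of `k` full buckets in a table with `t` keys. When
`t/(bm) → β` this probability converges to its Poisson counterpart (`tendsto_cyclicRunProb`):
windows of length at most `N` see finitely many buckets, whose multinomial counts become independent
Poisson, and longer windows are uniformly negligible. The average over `t` becomes the integral over
`β`. Geometric tails then give `∑ |P(D_{m,n} = k) - P(D = k)| s^k → 0` for some `s > 1`
(`exists_tendsto_lawDist`), which contains all the asserted modes of convergence. -/

namespace LinearProbing

noncomputable section

/-! ### The tree function -/

/-- The coefficient `(n + 1) ^ n / (n + 1)!` of `z ^ (n + 1)` in the tree function. -/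
def treeCoeff (n : ℕ) : ℝ := ((n : ℝ) + 1) ^ n / ((n + 1).factorial : ℝ)

lemma treeCoeff_nonneg (n : ℕ) : 0 ≤ treeCoeff n := by unfold treeCoeff; positivity

lemma treeCoeff_le (n : ℕ) : treeCoeff n ≤ Real.exp 1 ^ (n + 1) := by
  have h := Real.pow_div_factorial_le_exp (x := (n : ℝ) + 1) (by positivity) (n + 1)
  rw [← Real.exp_nat_mul, mul_one]
  push_cast
  refine le_trans ?_ h
  unfold treeCoeff
  gcongr
  · linarith [(Nat.cast_nonneg n : (0 : ℝ) ≤ n)]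
  · omega

lemma treeFun_eq (z : ℂ) : treeFun z = ∑' n : ℕ, (treeCoeff n : ℂ) * z ^ (n + 1) := by
  simp [treeFun, treeCoeff]

/-- The tree function on the real line. -/
def treeReal (x : ℝ) : ℝ := ∑' n : ℕ, treeCoeff n * x ^ (n + 1)

lemma treeFun_ofReal (x : ℝ) : treeFun x = (treeReal x : ℂ) := by
  rw [treeFun_eq, treeReal, Complex.ofReal_tsum]
  simp

lemma summable_treeCoeff_of_lt {x : ℝ} (hx0 : 0 ≤ x) (hx : x < Real.exp (-1)) :
    Summable fun n : ℕ => treeCoeff n * x ^ (n + 1) := by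
  have h1 : Real.exp 1 * x < 1 := by
    calc Real.exp 1 * x < Real.exp 1 * Real.exp (-1) := by gcongr
      _ = 1 := by rw [← Real.exp_add]; simp
  refine Summable.of_nonneg_of_le (fun n => mul_nonneg (treeCoeff_nonneg n) (by positivity))
    (fun n => ?_) (((summable_geometric_of_lt_one (by positivity) h1)).mul_left (Real.exp 1 * x))
  calc treeCoeff n * x ^ (n + 1) ≤ Real.exp 1 ^ (n + 1) * x ^ (n + 1) := by
        gcongr; exact treeCoeff_le n
    _ = Real.exp 1 * x * (Real.exp 1 * x) ^ n := by ring

/-- These are the coefficients of `T(w e^{-w})`. Up to the factor `1/(N+1)!` the sum is the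
`(N+1)`-st finite difference of `x ↦ x^N` at `0`, which vanishes; for `N ≥ 1` the missing term `x =
0` is zero. -/
lemma sum_antidiagonal_tree (N : ℕ) :
    ∑ p ∈ Finset.HasAntidiagonal.antidiagonal N,
      ((treeCoeff p.1 : ℝ) : ℂ) * ((-((p.1 : ℂ) + 1)) ^ p.2 / (p.2.factorial : ℂ))
      = if N = 0 then 1 else 0 := by
  rcases Nat.eq_zero_or_pos N with rfl | hN
  · simp [treeCoeff]
  rw [if_neg hN.ne']
  have h := congrFun (fwdDiff_iter_pow_eq_zero_of_lt (R := ℂ) (Nat.lt_succ_self N)) 0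
  rw [fwdDiff_iter_eq_sum_shift, Finset.sum_range_succ'] at h
  simp only [Nat.succ_eq_add_one, zero_add, nsmul_eq_mul, mul_one, zsmul_eq_mul, Nat.cast_zero,
    zero_pow hN.ne', mul_zero, add_zero, Pi.zero_apply] at h
  rw [Finset.Nat.sum_antidiagonal_eq_sum_range_succ_mk]
  have h2 : ((N + 1).factorial : ℂ)⁻¹ * ∑ k ∈ Finset.range (N + 1),
      (((-1 : ℤ) ^ (N + 1 - (k + 1)) * ((N + 1).choose (k + 1) : ℤ) : ℤ) : ℂ)
        * ((k + 1 : ℕ) : ℂ) ^ N = 0 := by rw [h, mul_zero]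
  rw [← h2, Finset.mul_sum]
  refine Finset.sum_congr rfl fun k hk => ?_
  have hk' : k ≤ N := by simpa [Nat.lt_succ_iff] using hk
  have hc : (((N + 1).choose (k + 1) : ℕ) : ℂ)
      = (N + 1).factorial / ((k + 1).factorial * (N - k).factorial) := by
    rw [Nat.cast_choose ℂ (by omega)]
    congr 4; omega
  obtain ⟨j, rfl⟩ := Nat.exists_eq_add_of_le hk'
  simp only [treeCoeff]
  push_cast
  rw [hc]
  have e2 : k + j - k = j := by omega
  rw [e2]
  have f1 : ((k + j + 1).factorial : ℂ) ≠ 0 := by exact_mod_cast Nat.factorial_ne_zero _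
  have f2 : ((k + 1).factorial : ℂ) ≠ 0 := by exact_mod_cast Nat.factorial_ne_zero _
  have f3 : (j.factorial : ℂ) ≠ 0 := by exact_mod_cast Nat.factorial_ne_zero _
  rw [neg_pow]
  field_simp
  ring

/-- Expand each power of `e^{-w}` and regroup the double series by the total power of `w`. The
radius `1/8` only has to ensure `|w| e^{|w|} < 1/e`, hence absolute convergence. -/
lemma treeFun_mul_exp_neg {w : ℂ} (hw : ‖w‖ < 1 / 8) : treeFun (w * Complex.exp (-w)) = w := by
  set f : ℕ × ℕ → ℂ := fun p =>
    (treeCoeff p.1 : ℂ) * w ^ (p.1 + 1) * ((-((p.1 : ℂ) + 1) * w) ^ p.2 / (p.2.factorial : ℂ))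
    with hf
  have hexp : ∀ n : ℕ, HasSum (fun j => f (n, j))
      ((treeCoeff n : ℂ) * (w * Complex.exp (-w)) ^ (n + 1)) := by
    intro n
    have h := (NormedSpace.expSeries_div_hasSum_exp (-((n : ℂ) + 1) * w)).mul_left
      ((treeCoeff n : ℂ) * w ^ (n + 1))
    rw [← Complex.exp_eq_exp_ℂ] at h
    convert! h using 1
    rw [mul_pow, ← Complex.exp_nat_mul]
    push_cast
    ring_nf
  have hexpn : ∀ n : ℕ, HasSum (fun j => ‖f (n, j)‖)
      (treeCoeff n * (‖w‖ * Real.exp ‖w‖) ^ (n + 1)) := by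
    intro n
    have h := (NormedSpace.expSeries_div_hasSum_exp (((n : ℝ) + 1) * ‖w‖)).mul_left
      (treeCoeff n * ‖w‖ ^ (n + 1))
    rw [← Real.exp_eq_exp_ℝ] at h
    convert! h using 1
    · funext j
      have : ‖-1 + -(n : ℂ)‖ = (n : ℝ) + 1 := by
        have := Complex.norm_natCast (n + 1)
        rw [← norm_neg] at this
        push_cast at this
        rw [← this]; ring_nf
      simp [hf, this, abs_of_nonneg (treeCoeff_nonneg n)]
    · rw [mul_pow, ← Real.exp_nat_mul]
      push_cast
      ring_nf
  have hlt : ‖w‖ * Real.exp ‖w‖ < Real.exp (-1) := by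
    have h1 : Real.exp ‖w‖ ≤ Real.exp 1 := by gcongr; linarith
    have h2 : Real.exp 1 < 2.7182818286 := Real.exp_one_lt_d9
    have h3 : Real.exp (-1) = (Real.exp 1)⁻¹ := Real.exp_neg 1
    have h4 : (1 : ℝ) / 8 * 2.7182818286 < (2.7182818286 : ℝ)⁻¹ := by norm_num
    have h5 : (2.7182818286 : ℝ)⁻¹ < (Real.exp 1)⁻¹ := by gcongr
    rw [h3]
    calc ‖w‖ * Real.exp ‖w‖ ≤ 1 / 8 * 2.7182818286 := by gcongr; linarith
      _ < _ := h4.trans h5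
  have hsum : Summable f := by
    refine Summable.of_norm ?_
    rw [summable_prod_of_nonneg (fun _ => norm_nonneg _)]
    refine ⟨fun n => (hexpn n).summable, ?_⟩
    simp_rw [fun n => (hexpn n).tsum_eq]
    exact summable_treeCoeff_of_lt (by positivity) hlt
  have h1 : treeFun (w * Complex.exp (-w)) = ∑' p, f p := by
    rw [hsum.tsum_prod' (fun n => (hexp n).summable), treeFun_eq]
    exact tsum_congr fun n => ((hexp n).tsum_eq).symm
  rw [h1, ← Finset.HasAntidiagonal.sigmaAntidiagonalEquivProd.tsum_eq f,
    Summable.tsum_sigma' (f := fun c => f (Finset.HasAntidiagonal.sigmaAntidiagonalEquivProd c))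
      (fun n => (hasSum_fintype _).summable)
      (Finset.HasAntidiagonal.sigmaAntidiagonalEquivProd.summable_iff.mpr hsum)]
  have h2 : ∀ N : ℕ, ∑' c : Finset.HasAntidiagonal.antidiagonal N,
      f (Finset.HasAntidiagonal.sigmaAntidiagonalEquivProd ⟨N, c⟩)
      = if N = 0 then w else 0 := by
    intro N
    rw [tsum_fintype]
    simp only [Finset.HasAntidiagonal.sigmaAntidiagonalEquivProd_apply]
    rw [Finset.sum_coe_sort (Finset.HasAntidiagonal.antidiagonal N) f]
    have h3 : ∀ p ∈ Finset.HasAntidiagonal.antidiagonal N, f p = w ^ (N + 1) *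
        (((treeCoeff p.1 : ℝ) : ℂ) * ((-((p.1 : ℂ) + 1)) ^ p.2 / (p.2.factorial : ℂ))) := by
      intro p hp
      rw [Finset.HasAntidiagonal.mem_antidiagonal] at hp
      rw [← hp]
      simp only [hf, mul_pow (-((p.1 : ℂ) + 1)) w]
      ring
    rw [Finset.sum_congr rfl h3, ← Finset.mul_sum, sum_antidiagonal_tree]
    split_ifs with h0
    · simp [h0]
    · simp
  simp_rw [h2]
  simp

lemma differentiableOn_treeFun :
    DifferentiableOn ℂ treeFun (Metric.ball 0 (Real.exp (-1))) := by
  intro z hz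
  have hz' : ‖z‖ < Real.exp (-1) := by simpa using hz
  obtain ⟨r, hr1, hr2⟩ := exists_between hz'
  have hd : DifferentiableOn ℂ (fun z => ∑' n : ℕ, (treeCoeff n : ℂ) * z ^ (n + 1))
      (Metric.ball 0 r) := by
    refine Complex.differentiableOn_tsum_of_summable_norm
      (summable_treeCoeff_of_lt ((norm_nonneg z).trans hr1.le) hr2)
      (fun n => by fun_prop) Metric.isOpen_ball fun n w hw => ?_
    have hw' : ‖w‖ < r := by simpa using hw
    rw [norm_mul, norm_pow, Complex.norm_real, Real.norm_of_nonneg (treeCoeff_nonneg n)]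
    have := treeCoeff_nonneg n
    gcongr
  have h2 := (hd.differentiableAt (Metric.isOpen_ball.mem_nhds (by simpa using hr1)))
  rw [show treeFun = fun z => ∑' n : ℕ, (treeCoeff n : ℂ) * z ^ (n + 1) from
    funext treeFun_eq]
  exact h2.differentiableWithinAt

/-- The map `w ↦ w e^{-w}` has derivative `1` at `0`, so it covers a neighbourhood of `0`, where the
identity follows from `treeFun_mul_exp_neg`. The identity theorem extends it to the whole disc. -/
lemma treeFun_mul_exp_neg_treeFun {z : ℂ} (hz : ‖z‖ < Real.exp (-1)) :
    treeFun z * Complex.exp (-treeFun z) = z := by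
  have hd : DifferentiableOn ℂ (fun z => treeFun z * Complex.exp (-treeFun z))
      (Metric.ball 0 (Real.exp (-1))) :=
    differentiableOn_treeFun.mul differentiableOn_treeFun.neg.cexp
  have ha := hd.analyticOnNhd Metric.isOpen_ball
  have ha2 : AnalyticOnNhd ℂ (fun z : ℂ => z) (Metric.ball 0 (Real.exp (-1))) :=
    fun z _ => analyticAt_id
  refine ha.eqOn_of_preconnected_of_eventuallyEq ha2 (convex_ball _ _).isPreconnected
    (z₀ := 0) (by simpa using Real.exp_pos _) ?_ (by simpa using hz)
  have hs : HasStrictDerivAt (fun w : ℂ => w * Complex.exp (-w)) 1 0 := by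
    have := (hasStrictDerivAt_id (0 : ℂ)).mul ((hasStrictDerivAt_id (0 : ℂ)).neg.cexp)
    convert! this using 1
    simp
  have hm := hs.map_nhds_eq one_ne_zero
  simp only [zero_mul] at hm
  rw [Filter.EventuallyEq, ← hm, Filter.eventually_map]
  filter_upwards [Metric.ball_mem_nhds (0 : ℂ) (show (0 : ℝ) < 1 / 8 by norm_num)] with w hw
  rw [treeFun_mul_exp_neg (by simpa using hw)]

lemma treeReal_mul_exp_neg {x : ℝ} (hx0 : 0 ≤ x) (hx : x < Real.exp (-1)) :
    treeReal x * Real.exp (-treeReal x) = x := by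
  have h := treeFun_mul_exp_neg_treeFun (z := x)
    (by rwa [Complex.norm_real, Real.norm_of_nonneg hx0])
  rw [treeFun_ofReal] at h
  exact_mod_cast h

lemma treeReal_nonneg {x : ℝ} (hx0 : 0 ≤ x) : 0 ≤ treeReal x :=
  tsum_nonneg fun n => mul_nonneg (treeCoeff_nonneg n) (by positivity)

lemma continuousOn_treeReal : ContinuousOn treeReal (Set.Ico 0 (Real.exp (-1))) := by
  have h : ContinuousOn (fun x : ℝ => (treeFun (x : ℂ)).re) (Set.Ico 0 (Real.exp (-1))) := by
    refine Complex.continuous_re.comp_continuousOn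
      (differentiableOn_treeFun.continuousOn.comp Complex.continuous_ofReal.continuousOn ?_)
    intro x hx
    simp [abs_of_nonneg hx.1, hx.2]
  exact h.congr fun x _ => by simp [treeFun_ofReal]

/-- By the intermediate value theorem a value at least `1` would force `T(y) = 1` for some `y ≤ x`,
and the functional equation would give `y = 1/e > x`. -/
lemma treeReal_lt_one {x : ℝ} (hx0 : 0 ≤ x) (hx : x < Real.exp (-1)) : treeReal x < 1 := by
  by_contra! hge
  have hc : ContinuousOn treeReal (Set.Icc 0 x) :=
    continuousOn_treeReal.mono fun y hy => ⟨hy.1, hy.2.trans_lt hx⟩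
  have h0 : treeReal 0 = 0 := by simp [treeReal]
  obtain ⟨y, hy, hy1⟩ := intermediate_value_Icc hx0 hc (show (1 : ℝ) ∈ _ by simp [h0, hge])
  have := treeReal_mul_exp_neg hy.1 (hy.2.trans_lt hx)
  rw [hy1, one_mul] at this
  linarith [hy.2]

lemma strictMonoOn_mul_exp_neg : StrictMonoOn (fun x : ℝ => x * Real.exp (-x)) (Set.Icc 0 1) := by
  refine strictMonoOn_of_deriv_pos (convex_Icc 0 1) (by fun_prop) fun x hx => ?_
  rw [interior_Icc] at hx
  have hd : HasDerivAt (fun x : ℝ => x * Real.exp (-x))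
      (1 * Real.exp (-x) + x * (Real.exp (-x) * -1)) x :=
    (hasDerivAt_id x).mul (hasDerivAt_neg x).exp
  rw [hd.deriv]
  have := Real.exp_pos (-x)
  nlinarith [hx.2]

lemma mul_exp_neg_lt {β : ℝ} (hβ : β < 1) : β * Real.exp (-β) < Real.exp (-1) := by
  have h := Real.add_one_lt_exp (x := β - 1) (by linarith)
  calc β * Real.exp (-β) < Real.exp (β - 1) * Real.exp (-β) := by
        gcongr; linarith
    _ = Real.exp (-1) := by rw [← Real.exp_add]; ring_nf

lemma treeReal_mul_exp_neg_self {β : ℝ} (hβ0 : 0 ≤ β) (hβ1 : β < 1) :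
    treeReal (β * Real.exp (-β)) = β := by
  have h0 : 0 ≤ β * Real.exp (-β) := by positivity
  have h1 := mul_exp_neg_lt hβ1
  exact strictMonoOn_mul_exp_neg.injOn ⟨treeReal_nonneg h0, (treeReal_lt_one h0 h1).le⟩
    ⟨hβ0, hβ1.le⟩ (treeReal_mul_exp_neg h0 h1)

/-- Let `x ↑ 1/e` in the finite sum. This makes the series converge absolutely on the closed disc,
as needed at `|q| = R`, `β = α`. -/
lemma sum_range_treeCoeff_le_one (N : ℕ) :
    ∑ n ∈ Finset.range N, treeCoeff n * Real.exp (-1) ^ (n + 1) ≤ 1 := by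
  have hc : Continuous fun x : ℝ => ∑ n ∈ Finset.range N, treeCoeff n * x ^ (n + 1) := by fun_prop
  refine le_of_tendsto (f := fun x : ℝ => ∑ n ∈ Finset.range N, treeCoeff n * x ^ (n + 1))
    (x := 𝓝[<] (Real.exp (-1))) (hc.continuousAt.tendsto.mono_left nhdsWithin_le_nhds) ?_
  filter_upwards [Ioo_mem_nhdsLT (Real.exp_pos (-1))] with x hx
  refine le_trans ?_ (treeReal_lt_one hx.1.le hx.2).le
  exact (summable_treeCoeff_of_lt hx.1.le hx.2).sum_le_tsum _
    fun n _ => mul_nonneg (treeCoeff_nonneg n) (pow_nonneg hx.1.le _)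

lemma summable_treeCoeff_exp :
    Summable fun n : ℕ => treeCoeff n * Real.exp (-1) ^ (n + 1) :=
  summable_of_sum_range_le (fun n => mul_nonneg (treeCoeff_nonneg n) (by positivity))
    sum_range_treeCoeff_le_one

lemma summable_treeCoeff {x : ℝ} (hx0 : 0 ≤ x) (hx : x ≤ Real.exp (-1)) :
    Summable fun n : ℕ => treeCoeff n * x ^ (n + 1) :=
  Summable.of_nonneg_of_le (fun n => mul_nonneg (treeCoeff_nonneg n) (by positivity))
    (fun n => by have := treeCoeff_nonneg n; gcongr) summable_treeCoeff_exp

/-- A linear bound, so that `ζ = T/β` stays bounded as `β → 0`. -/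
lemma treeReal_le {x : ℝ} (hx0 : 0 ≤ x) (hx : x ≤ Real.exp (-1)) :
    treeReal x ≤ Real.exp 1 * x := by
  have hs := summable_treeCoeff_exp.mul_left (Real.exp 1 * x)
  have h1 : treeReal x ≤ ∑' n : ℕ, Real.exp 1 * x * (treeCoeff n * Real.exp (-1) ^ (n + 1)) := by
    refine (summable_treeCoeff hx0 hx).tsum_le_tsum (fun n => ?_) hs
    have he : Real.exp 1 * Real.exp (-1) = 1 := by rw [← Real.exp_add]; simp
    have := treeCoeff_nonneg n
    calc treeCoeff n * x ^ (n + 1) = x * treeCoeff n * x ^ n := by ring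
      _ ≤ x * treeCoeff n * Real.exp (-1) ^ n := by gcongr
      _ = x * treeCoeff n * Real.exp (-1) ^ n * (Real.exp 1 * Real.exp (-1)) := by rw [he, mul_one]
      _ = _ := by ring
  refine h1.trans ?_
  rw [tsum_mul_left]
  have : ∑' n : ℕ, treeCoeff n * Real.exp (-1) ^ (n + 1) ≤ 1 :=
    summable_treeCoeff_exp.tsum_le_of_sum_range_le sum_range_treeCoeff_le_one
  nlinarith [mul_nonneg (Real.exp_pos 1).le hx0]

lemma summable_norm_treeFun {z : ℂ} (hz : ‖z‖ ≤ Real.exp (-1)) :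
    Summable fun n : ℕ => ‖(treeCoeff n : ℂ) * z ^ (n + 1)‖ := by
  refine (summable_treeCoeff (norm_nonneg z) hz).congr fun n => ?_
  rw [norm_mul, norm_pow, Complex.norm_real, Real.norm_of_nonneg (treeCoeff_nonneg n)]

lemma norm_treeFun_le {z : ℂ} (hz : ‖z‖ ≤ Real.exp (-1)) : ‖treeFun z‖ ≤ treeReal ‖z‖ := by
  rw [treeFun_eq]
  refine (norm_tsum_le_tsum_norm (summable_norm_treeFun hz)).trans_eq ?_
  refine tsum_congr fun n => ?_
  rw [norm_mul, norm_pow, Complex.norm_real, Real.norm_of_nonneg (treeCoeff_nonneg n)]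

lemma treeReal_mono {x y : ℝ} (hx0 : 0 ≤ x) (hxy : x ≤ y) (hy : y ≤ Real.exp (-1)) :
    treeReal x ≤ treeReal y :=
  (summable_treeCoeff hx0 (hxy.trans hy)).tsum_le_tsum
    (fun n => by have := treeCoeff_nonneg n; gcongr) (summable_treeCoeff (hx0.trans hxy) hy)

lemma treeFun_injOn : Set.InjOn treeFun (Metric.ball 0 (Real.exp (-1))) := by
  intro z hz w hw h
  rw [← treeFun_mul_exp_neg_treeFun (z := z) (by simpa using hz), h,
    treeFun_mul_exp_neg_treeFun (by simpa using hw)]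

/-! ### Full buckets -/

lemma Ioc_sub_succ (i : ℤ) (L : ℕ) :
    Finset.Ioc (i - (L + 1 : ℕ)) i = insert i (Finset.Ioc (i - 1 - L) (i - 1)) := by
  ext k
  simp only [Finset.mem_Ioc, Finset.mem_insert]
  push_cast
  omega

lemma sum_Ioc_sub_succ {M : Type*} [AddCommMonoid M] (f : ℤ → M) (i : ℤ) (L : ℕ) :
    ∑ k ∈ Finset.Ioc (i - (L + 1 : ℕ)) i, f k
      = f i + ∑ k ∈ Finset.Ioc (i - 1 - L) (i - 1), f k := by
  rw [Ioc_sub_succ, Finset.sum_insert (by simp)]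

lemma sum_Ioc_sub_add {M : Type*} [AddCommMonoid M] (f : ℤ → M) (i : ℤ) (L L' : ℕ) :
    ∑ k ∈ Finset.Ioc (i - (L + L' : ℕ)) i, f k
      = ∑ k ∈ Finset.Ioc (i - L) i, f k + ∑ k ∈ Finset.Ioc (i - L - L') (i - L), f k := by
  rw [add_comm, ← Finset.sum_union]
  · congr 1
    ext k
    simp only [Finset.mem_Ioc, Finset.mem_union]
    push_cast
    omega
  · rw [Finset.disjoint_left]
    intro k
    simp only [Finset.mem_Ioc]
    omega

lemma sum_Ioc_sub_const (b : ℕ) (x : ℤ → ℕ) (i : ℤ) (L : ℕ) :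
    ∑ k ∈ Finset.Ioc (i - L) i, ((x k : ℤ) - b)
      = ((∑ k ∈ Finset.Ioc (i - L) i, x k : ℕ) : ℤ) - b * L := by
  rw [Finset.sum_sub_distrib]
  push_cast
  simp [mul_comm]

/-- `Full b x i`: for some `L ≥ 1`, the last `L` buckets up to bucket `i` have together at least
`b * L` hash addresses. This means that bucket `i` is full. -/
def Full (b : ℕ) (x : ℤ → ℕ) (i : ℤ) : Prop :=
  ∃ L : ℕ, 1 ≤ L ∧ b * L ≤ ∑ k ∈ Finset.Ioc (i - L) i, x k

/-- The partial sums that define the overflow from bucket `i` are bounded. -/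
def BddOverflow (b : ℕ) (x : ℤ → ℕ) (i : ℤ) : Prop :=
  BddAbove (Set.range fun L : ℕ => ∑ k ∈ Finset.Ioc (i - L) i, ((x k : ℤ) - b))

lemma overflow_nonneg {b : ℕ} {x : ℤ → ℕ} {i : ℤ} (h : BddOverflow b x i) :
    0 ≤ overflow b x i := by
  have : _ ≤ overflow b x i := le_ciSup h 0
  simpa using this

/-- The Lindley recursion: a window ending at `i` is empty or extends one ending at `i - 1`.
Boundedness is essential, since an unbounded `⨆` in `ℤ` takes a default value. -/
lemma overflow_eq {b : ℕ} {x : ℤ → ℕ} {i : ℤ} (h : BddOverflow b x i)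
    (h' : BddOverflow b x (i - 1)) : overflow b x i = max 0 (profile b x i - b) := by
  apply le_antisymm
  · refine ciSup_le fun L => ?_
    cases L with
    | zero => simp
    | succ L =>
      rw [sum_Ioc_sub_succ]
      have : _ ≤ overflow b x (i - 1) := le_ciSup h' L
      refine le_max_of_le_right ?_
      unfold profile
      linarith
  · refine max_le (overflow_nonneg h) ?_
    have : overflow b x (i - 1) ≤ overflow b x i - (x i - b) := by
      refine ciSup_le fun L => ?_
      have h2 : _ ≤ overflow b x i := le_ciSup h (L + 1)
      simp only [sum_Ioc_sub_succ] at h2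
      linarith
    unfold profile
    linarith

/-- A bounded supremum in `ℤ` is attained, so `H_i ≥ b` exhibits an optimal window ending at `i -
1`; adding bucket `i` gives the required one. -/
lemma le_profile_iff {b : ℕ} {x : ℤ → ℕ} {i : ℤ} (h' : BddOverflow b x (i - 1)) :
    (b : ℤ) ≤ profile b x i ↔ Full b x i := by
  constructor
  · intro h
    obtain ⟨L, hL⟩ := Int.csSup_mem (Set.range_nonempty _) h'
    refine ⟨L + 1, by omega, ?_⟩
    have h1 : overflow b x (i - 1) = ∑ k ∈ Finset.Ioc (i - 1 - L) (i - 1), ((x k : ℤ) - b) :=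
      hL.symm
    have h2 : (0 : ℤ) ≤ ∑ k ∈ Finset.Ioc (i - (L + 1 : ℕ)) i, ((x k : ℤ) - b) := by
      rw [sum_Ioc_sub_succ, ← h1]
      unfold profile at h
      linarith
    rw [sum_Ioc_sub_const] at h2
    exact_mod_cast sub_nonneg.mp h2
  · rintro ⟨L, hL1, hL⟩
    obtain ⟨L, rfl⟩ := Nat.exists_eq_add_of_le' hL1
    have h2 : (0 : ℤ) ≤ ∑ k ∈ Finset.Ioc (i - (L + 1 : ℕ)) i, ((x k : ℤ) - b) := by
      rw [sum_Ioc_sub_const]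
      exact sub_nonneg.mpr (by exact_mod_cast hL)
    rw [sum_Ioc_sub_succ] at h2
    have h3 : _ ≤ overflow b x (i - 1) := le_ciSup h' L
    unfold profile
    linarith

/-- If each of the buckets `0, …, k - 1` ends a window of length at most `M` that is full on
average, then bucket `k - 1` ends such a window of length between `k` and `k + M`. -/
lemma exists_long_window {b : ℕ} {x : ℤ → ℕ} {M k : ℕ}
    (h : ∀ l < k, ∃ L : ℕ, 1 ≤ L ∧ L ≤ M ∧
      b * L ≤ ∑ j ∈ Finset.Ioc ((l : ℤ) - L) l, x j) :
    ∃ L : ℕ, k ≤ L ∧ L ≤ k + M ∧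
      b * L ≤ ∑ j ∈ Finset.Ioc ((k : ℤ) - 1 - L) ((k : ℤ) - 1), x j := by
  suffices H : ∀ j ≤ k, ∃ L : ℕ, j ≤ L ∧ L ≤ j + M ∧
      b * L ≤ ∑ j ∈ Finset.Ioc ((k : ℤ) - 1 - L) ((k : ℤ) - 1), x j from H k le_rfl
  intro j
  induction j with
  | zero => exact fun _ => ⟨0, by simp⟩
  | succ j ih =>
    intro hj
    obtain ⟨L, h1, h2, h3⟩ := ih (by omega)
    -- A window longer than `j` already suffices. At length exactly `j`, attach the window ending at
    -- the next bucket to the left, `k - 1 - j`.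
    rcases h1.lt_or_eq with h1 | rfl
    · exact ⟨L, by omega, by omega, h3⟩
    obtain ⟨L', h1', h2', h3'⟩ := h (k - 1 - j) (by omega)
    refine ⟨j + L', by omega, by omega, ?_⟩
    have : ((k - 1 - j : ℕ) : ℤ) = (k : ℤ) - 1 - j := by omega
    rw [this] at h3'
    rw [sum_Ioc_sub_add, mul_add]
    exact add_le_add h3 h3'

/-! ### The cyclic table -/

/-- The load `load i` of the buckets of a cyclic table, when `c i` keys have hash address `i`:
`f i` of the keys have been moved from bucket `i` to bucket `i + 1`, which happens only if bucket
`i` is full. -/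
structure IsFlow (b : ℕ) {m : ℕ} (c load f : ZMod m → ℕ) : Prop where
  balance : ∀ i, load i + f i = c i + f (i - 1)
  load_le : ∀ i, load i ≤ b
  load_eq : ∀ i, f i ≠ 0 → load i = b

namespace IsFlow

variable {b m : ℕ} {c load f : ZMod m → ℕ}

lemma sum_load [NeZero m] (h : IsFlow b c load f) : ∑ i, load i = ∑ i, c i := by
  have h1 : ∑ i, (load i + f i) = ∑ i, (c i + f (i - 1)) :=
    Finset.sum_congr rfl fun i _ => h.balance i
  rw [Finset.sum_add_distrib, Finset.sum_add_distrib,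
    Fintype.sum_equiv (Equiv.subRight (1 : ZMod m)) (fun i => f (i - 1)) f fun i => rfl] at h1
  exact Nat.add_right_cancel h1

lemma exists_lt [NeZero m] (h : IsFlow b c load f) (hc : ∑ i, c i < b * m) :
    ∃ i, load i < b := by
  by_contra! hge
  rw [← h.sum_load] at hc
  have := Finset.card_nsmul_le_sum Finset.univ load b fun i _ => hge i
  rw [Finset.card_univ, ZMod.card, smul_eq_mul, mul_comm] at this
  exact absurd hc (not_lt.mpr this)

/-- Conservation of keys: they enter the window only over its left end and leave it only over its
right end. -/
lemma sum_window (h : IsFlow b c load f) (i : ℤ) (L : ℕ) :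
    ∑ k ∈ Finset.Ioc (i - L) i, load (k : ZMod m) + f (i : ZMod m)
      = ∑ k ∈ Finset.Ioc (i - L) i, c (k : ZMod m) + f ((i - L : ℤ) : ZMod m) := by
  induction L generalizing i with
  | zero => simp
  | succ L ih =>
    rw [sum_Ioc_sub_succ, sum_Ioc_sub_succ]
    have h1 := ih (i - 1)
    have h2 := h.balance (i : ZMod m)
    push_cast at h1 ⊢
    rw [show (i : ZMod m) - (L + 1) = i - 1 - L by ring]
    omega

/-- Go left from `i` to the nearest non-full bucket. Nothing overflows from it, so the full buckets
in between received all their keys from their own addresses. -/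
lemma exists_window_of_full [NeZero m] (h : IsFlow b c load f) (hc : ∑ i, c i < b * m) {i : ℤ}
    (hi : load (i : ZMod m) = b) :
    ∃ L : ℕ, 1 ≤ L ∧ L ≤ m ∧ b * L ≤ ∑ k ∈ Finset.Ioc (i - L) i, c (k : ZMod m) := by
  obtain ⟨a, ha⟩ := h.exists_lt hc
  have hex : ∃ L : ℕ, load ((i - L : ℤ) : ZMod m) < b :=
    ⟨((i : ZMod m) - a).val, by push_cast; rwa [ZMod.natCast_zmod_val, sub_sub_cancel]⟩
  classical
  have hle : Nat.find hex ≤ m :=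
    (Nat.find_min' hex (m := ((i : ZMod m) - a).val)
      (by push_cast; rwa [ZMod.natCast_zmod_val, sub_sub_cancel])).trans (ZMod.val_lt _).le
  have hlt := Nat.find_spec hex
  have hmin : ∀ l < Nat.find hex, load ((i - l : ℤ) : ZMod m) = b := fun l hl =>
    le_antisymm (h.load_le _) (not_lt.mp (Nat.find_min hex hl))
  set L := Nat.find hex
  refine ⟨L, ?_, hle, ?_⟩
  · by_contra hL
    have : L = 0 := by omega
    rw [this] at hlt
    simp [hi] at hlt
  · have h0 : f ((i - L : ℤ) : ZMod m) = 0 := by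
      by_contra hf
      exact hlt.ne (h.load_eq _ hf)
    have h1 := h.sum_window i L
    have h2 : ∑ k ∈ Finset.Ioc (i - L) i, load (k : ZMod m) = b * L := by
      rw [Finset.sum_congr rfl (g := fun _ => b)]
      · simp [mul_comm]
      · intro k hk
        rw [Finset.mem_Ioc] at hk
        have := hmin (i - k).toNat (by omega)
        rwa [show i - ((i - k).toNat : ℤ) = k by omega] at this
    omega

/-- If bucket `i` were not full, nothing would flow out, and `b L` or more keys would have to fit
into a total load below `b L`. -/
lemma full_of_window (h : IsFlow b c load f) {i : ℤ} (hi : Full b (fun k => c (k : ZMod m)) i) :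
    load (i : ZMod m) = b := by
  obtain ⟨L, hL1, hL⟩ := hi
  by_contra hne
  have hf : f (i : ZMod m) = 0 := by
    by_contra hf
    exact hne (h.load_eq _ hf)
  have h1 := h.sum_window i L
  have hlt : load (i : ZMod m) < b := lt_of_le_of_ne (h.load_le _) hne
  obtain ⟨L, rfl⟩ := Nat.exists_eq_add_of_le' hL1
  have h2 := sum_Ioc_sub_succ (fun k => load (k : ZMod m)) i L
  have h3 : ∑ k ∈ Finset.Ioc (i - 1 - L) (i - 1), load (k : ZMod m) ≤ b * L := by
    refine (Finset.sum_le_card_nsmul _ _ b fun k _ => h.load_le _).trans_eq ?_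
    simp [mul_comm]
  beta_reduce at hL
  rw [mul_add] at hL
  omega

/-- The new key passes `probe b load a` full buckets; the flow out of each of them grows by one. -/
lemma insert (h : IsFlow b c load f) (hlt : ∃ i, load i < b) [NeZero m] (a : ZMod m) :
    ∃ f', IsFlow b (c + Pi.single a 1)
      (load + Pi.single (a + (probe b load a : ZMod m)) 1) f' := by
  obtain ⟨i₀, hi₀⟩ := hlt
  have hne : {k : ℕ | load (a + k) < b}.Nonempty :=
    ⟨(i₀ - a).val, by simpa [ZMod.natCast_zmod_val] using hi₀⟩
  have hspec : load (a + (probe b load a : ZMod m)) < b := Nat.sInf_mem hne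
  have hmin : ∀ l < probe b load a, load (a + l) = b := fun l hl =>
    le_antisymm (h.load_le _) (not_lt.mp fun hlt => Nat.notMem_of_lt_sInf hl hlt)
  generalize probe b load a = k at *
  refine ⟨f + ∑ l ∈ Finset.range k, Pi.single (a + (l : ZMod m)) 1, ?_, ?_, ?_⟩
  · intro i
    have h1 := h.balance i
    have h2 : ∀ l : ℕ, (Pi.single (a + (l : ZMod m)) 1 : ZMod m → ℕ) (i - 1)
        = (Pi.single (a + ((l + 1 : ℕ) : ZMod m)) 1 : ZMod m → ℕ) i := by
      intro l
      simp only [Pi.single_apply]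
      congr 1
      push_cast
      rw [← add_assoc, sub_eq_iff_eq_add]
    have h3 := Finset.sum_range_succ
      (fun l : ℕ => (Pi.single (a + (l : ZMod m)) 1 : ZMod m → ℕ) i) k
    rw [Finset.sum_range_succ'] at h3
    simp only [Nat.cast_zero, add_zero] at h3
    simp only [Pi.add_apply, Finset.sum_apply, h2]
    omega
  · intro i
    have := h.load_le i
    by_cases hi : i = a + k
    · subst hi
      simpa using hspec
    · simpa [Pi.single_apply, hi] using this
  · intro i hi
    have hib : load i = b := by
      by_cases hf : f i = 0
      · simp only [Pi.add_apply, hf, zero_add, Finset.sum_apply] at hi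
        obtain ⟨l, hl, hl2⟩ := Finset.exists_ne_zero_of_sum_ne_zero hi
        have : i = a + l := by
          by_contra hne
          simp [hne] at hl2
        rw [this]
        exact hmin l (Finset.mem_range.mp hl)
      · exact h.load_eq i hf
    have hne : i ≠ a + k := by
      rintro rfl
      omega
    simp [hib, hne]

end IsFlow

/-- The number of keys with hash address `a`. -/
def addressCount {m n : ℕ} (h : Fin n → ZMod m) (a : ZMod m) : ℕ :=
  (Finset.univ.filter fun j => h j = a).card

lemma sum_addressCount {m n : ℕ} [NeZero m] (h : Fin n → ZMod m) :
    ∑ a, addressCount h a = n := by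
  have := Finset.card_eq_sum_card_fiberwise (f := h) (s := Finset.univ) (t := Finset.univ)
    (by simp)
  simpa [addressCount] using this.symm

lemma occupancy_congr {b m n n' : ℕ} (h : Fin n → ZMod m) (h' : Fin n' → ZMod m) (t : ℕ)
    (ht : t ≤ n) (ht' : t ≤ n')
    (H : ∀ i (hi : i < t), h ⟨i, hi.trans_le ht⟩ = h' ⟨i, hi.trans_le ht'⟩) :
    occupancy b h t = occupancy b h' t := by
  induction t with
  | zero => rfl
  | succ t ih =>
    have e := ih (by omega) (by omega) fun i hi => H i (by omega)
    rw [occupancy, occupancy, dif_pos (by omega : t < n), dif_pos (by omega : t < n'), e,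
      H t (by omega)]

lemma exists_isFlow_occupancy {b m n : ℕ} [NeZero m] (h : Fin n → ZMod m) (hn : n ≤ b * m) :
    ∃ f, IsFlow b (addressCount h) (occupancy b h n) f := by
  induction n with
  | zero =>
    refine ⟨0, fun i => ?_, fun i => ?_, fun i hi => ?_⟩
    · simp [occupancy, addressCount]
    · simp [occupancy]
    · simp at hi
  | succ n ih =>
    obtain ⟨f, hf⟩ := ih (Fin.init h) (by omega)
    have e : occupancy b h n = occupancy b (Fin.init h) n :=
      occupancy_congr _ _ n (by omega) le_rfl fun i hi => rfl
    rw [← e] at hf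
    have hc : addressCount h = addressCount (Fin.init h) + Pi.single (h (Fin.last n)) 1 := by
      funext a
      simp only [addressCount, Pi.add_apply, Finset.card_filter]
      simp only [Fin.sum_univ_castSucc, Pi.single_apply, Fin.init, eq_comm (a := a)]
      rfl
    rw [hc, occupancy, dif_pos (Nat.lt_succ_self n)]
    exact hf.insert (hf.exists_lt (by rw [sum_addressCount]; omega)) _

/-- The periodic extension to `ℤ` of the numbers of keys with a given hash address. -/
def periodicCount {m n : ℕ} (h : Fin n → ZMod m) (k : ℤ) : ℕ := addressCount h (k : ZMod m)

lemma occupancy_eq_iff {b m n : ℕ} [NeZero m] (h : Fin n → ZMod m) (hn : n < b * m) (i : ℤ) :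
    occupancy b h n (i : ZMod m) < b ↔ ¬ Full b (periodicCount h) i := by
  obtain ⟨f, hf⟩ := exists_isFlow_occupancy h hn.le
  rw [(hf.load_le _).lt_iff_ne, not_iff_not]
  refine ⟨fun hi => ?_, hf.full_of_window⟩
  obtain ⟨L, h1, -, h2⟩ := hf.exists_window_of_full (by rwa [sum_addressCount]) hi
  exact ⟨L, h1, h2⟩

lemma Full.exists_le {b m n : ℕ} [NeZero m] {h : Fin n → ZMod m} (hn : n < b * m) {i : ℤ}
    (hi : Full b (periodicCount h) i) :
    ∃ L : ℕ, 1 ≤ L ∧ L ≤ m ∧ b * L ≤ ∑ k ∈ Finset.Ioc (i - L) i, periodicCount h k := by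
  obtain ⟨f, hf⟩ := exists_isFlow_occupancy h hn.le
  exact hf.exists_window_of_full (by rwa [sum_addressCount]) (hf.full_of_window hi)

lemma le_probe_occupancy_iff {b m n : ℕ} [NeZero m] (h : Fin n → ZMod m) (hn : n < b * m) (k : ℕ) :
    k ≤ probe b (occupancy b h n) 0 ↔ ∀ l < k, Full b (periodicCount h) (l : ℤ) := by
  have hiff : ∀ l : ℕ, occupancy b h n (0 + (l : ZMod m)) < b ↔ ¬ Full b (periodicCount h) l := by
    intro l
    rw [zero_add, ← occupancy_eq_iff h hn l, Int.cast_natCast]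
  -- Since `n < b * m` there is a non-full bucket, so `probe` is a true minimum and not the default
  -- value `sInf ∅ = 0`.
  have hne : {k : ℕ | occupancy b h n (0 + (k : ZMod m)) < b}.Nonempty := by
    obtain ⟨f, hf⟩ := exists_isFlow_occupancy h hn.le
    obtain ⟨a, ha⟩ := hf.exists_lt (by rwa [sum_addressCount])
    exact ⟨a.val, by simpa [ZMod.natCast_zmod_val] using ha⟩
  constructor
  · intro hk l hl
    have := Nat.notMem_of_lt_sInf (hl.trans_le hk)
    simpa only [Set.mem_ofPred_eq, hiff, not_not] using this
  · intro H
    refine le_csInf hne fun l hl => ?_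
    by_contra hlt
    exact (hiff l).mp hl (H l (not_le.mp hlt))

lemma probe_occupancy_lt {b m n : ℕ} [NeZero m] (h : Fin n → ZMod m) (hn : n < b * m) :
    probe b (occupancy b h n) 0 < m := by
  obtain ⟨f, hf⟩ := exists_isFlow_occupancy h hn.le
  obtain ⟨a, ha⟩ := hf.exists_lt (by rwa [sum_addressCount])
  exact (Nat.sInf_le (s := {k : ℕ | occupancy b h n (0 + (k : ZMod m)) < b}) (m := a.val)
    (by simpa [ZMod.natCast_zmod_val] using ha)).trans_lt (ZMod.val_lt a)

/-! Translation invariance of the cyclic table. -/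

lemma probe_translate {b m : ℕ} (load : ZMod m → ℕ) (a d : ZMod m) :
    probe b (fun i => load (i - d)) (a + d) = probe b load a := by
  unfold probe
  congr 1
  ext k
  simp only [Set.mem_ofPred_eq]
  rw [show a + d + (k : ZMod m) - d = a + k by ring]

lemma occupancy_translate {b m n : ℕ} (h : Fin n → ZMod m) (d : ZMod m) (t : ℕ) (i : ZMod m) :
    occupancy b (fun j => h j + d) t i = occupancy b h t (i - d) := by
  induction t generalizing i with
  | zero => simp [occupancy]
  | succ t ih =>
    have e : occupancy b (fun j => h j + d) t = fun i => occupancy b h t (i - d) := funext ih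
    rw [occupancy, occupancy]
    split_ifs with ht
    · rw [e, probe_translate]
      simp only [Pi.add_apply, Pi.single_apply]
      congr 2
      rw [sub_eq_iff_eq_add]
      exact propext (by rw [add_right_comm])
    · exact ih i

/-! ### The exponent in the Chernoff bounds -/

/-- One exponent for both models. The chord slope `(e^{2s} - 1)/2` replaces `e^s - 1` because a
window of the cyclic table may count a key twice. It is at most `s + 2s²`, and `s = (1 - a)/4`
leaves a positive remainder. -/
lemma exists_chernoff_exponent {a : ℝ} (ha0 : 0 ≤ a) (ha1 : a < 1) :
    ∃ s : ℝ, 0 < s ∧ 0 < s - a * ((Real.exp (2 * s) - 1) / 2) := by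
  refine ⟨(1 - a) / 4, by linarith, ?_⟩
  have h := abs_le.mp (Real.abs_exp_sub_one_sub_id_le (x := 2 * ((1 - a) / 4))
    (by rw [abs_of_nonneg] <;> linarith))
  have h2 : (Real.exp (2 * ((1 - a) / 4)) - 1) / 2 ≤ (1 - a) / 4 + 2 * ((1 - a) / 4) ^ 2 := by
    linarith [h.2]
  nlinarith [mul_le_mul_of_nonneg_left h2 ha0, mul_pos (sub_pos.mpr ha1) (sub_pos.mpr ha1)]

/-! ### Measurability -/

section measurability

variable {m : MeasurableSpace (ℤ → ℕ)} {k : ℤ}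

/-- The σ-algebra is left arbitrary so that the same argument also gives measurability with respect
to the coordinates before a given bucket, as independence requires. -/
lemma measurable_overflow' (b : ℕ) (hm : ∀ i ≤ k, Measurable[m] fun x : ℤ → ℕ => x i) :
    Measurable[m] fun x : ℤ → ℕ => overflow b x k := by
  refine Measurable.iSup fun L => Finset.measurable_fun_sum _ fun i hi => ?_
  exact (measurable_of_countable fun n : ℕ => (n : ℤ) - b).comp (hm i (Finset.mem_Ioc.mp hi).2)

lemma measurableSet_window' (b L : ℕ) (hm : ∀ i ≤ k, Measurable[m] fun x : ℤ → ℕ => x i) :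
    MeasurableSet[m] {x : ℤ → ℕ | b * L ≤ ∑ j ∈ Finset.Ioc (k - L) k, x j} :=
  (Finset.measurable_fun_sum _ fun i hi => hm i (Finset.mem_Ioc.mp hi).2)
    (measurableSet_Ici (a := b * L))

lemma measurableSet_full' (b : ℕ) (hm : ∀ i ≤ k, Measurable[m] fun x : ℤ → ℕ => x i) :
    MeasurableSet[m] {x : ℤ → ℕ | Full b x k} := by
  have : {x : ℤ → ℕ | Full b x k}
      = ⋃ L : ℕ, ⋃ _ : 1 ≤ L, {x : ℤ → ℕ | b * L ≤ ∑ j ∈ Finset.Ioc (k - L) k, x j} := by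
    ext x
    simp [Full]
  rw [this]
  exact MeasurableSet.iUnion fun L => MeasurableSet.iUnion fun _ => measurableSet_window' b L hm

lemma measurableSet_fullRun' (b : ℕ) (n : ℕ)
    (hm : ∀ i < (n : ℤ), Measurable[m] fun x : ℤ → ℕ => x i) :
    MeasurableSet[m] {x : ℤ → ℕ | ∀ l < n, Full b x l} := by
  have : {x : ℤ → ℕ | ∀ l < n, Full b x l}
      = ⋂ l : ℕ, ⋂ _ : l < n, {x : ℤ → ℕ | Full b x l} := by
    ext x
    simp
  rw [this]
  exact MeasurableSet.iInter fun l => MeasurableSet.iInter fun hl =>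
    measurableSet_full' b fun i hi => hm i (by omega)

end measurability

lemma measurable_overflow (b : ℕ) (i : ℤ) : Measurable fun x => overflow b x i :=
  measurable_overflow' b fun i _ => measurable_pi_apply i

lemma measurable_profile (b : ℕ) (i : ℤ) : Measurable fun x => profile b x i :=
  ((measurable_of_countable fun n : ℕ => (n : ℤ)).comp (measurable_pi_apply i)).add
    (measurable_overflow b (i - 1))

/-- The event that the buckets `0, …, k - 1` are full. -/
def fullRun (b k : ℕ) : Set (ℤ → ℕ) := {x | ∀ l < k, Full b x l}

lemma measurableSet_fullRun (b k : ℕ) : MeasurableSet (fullRun b k) :=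
  measurableSet_fullRun' b k fun i _ => measurable_pi_apply i

lemma measurable_unsuccessfulZero (b : ℕ) : Measurable (unsuccessfulZero b) := by
  have hs : ∀ k : ℕ, MeasurableSet {x : ℤ → ℕ | profile b x (0 + k) < b} := fun k =>
    measurable_profile b _ measurableSet_Iio
  refine measurable_of_Ici fun k => ?_
  -- The alternative `k = 0` accounts for `sInf ∅ = 0` when there is no non-full bucket.
  have : unsuccessfulZero b ⁻¹' Set.Ici k
      = (⋂ l : ℕ, ⋂ _ : l < k, {x : ℤ → ℕ | profile b x (0 + l) < b}ᶜ) ∩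
        ((⋃ l : ℕ, {x : ℤ → ℕ | profile b x (0 + l) < b}) ∪ {_x | k = 0}) := by
    ext x
    simp only [Set.mem_preimage, Set.mem_Ici, Set.mem_inter_iff, Set.mem_iInter, Set.mem_compl_iff,
      Set.mem_union, Set.mem_iUnion, unsuccessfulZero, unsuccessful]
    constructor
    · refine fun h => ⟨fun l hl hx => ?_, ?_⟩
      · exact Nat.notMem_of_lt_sInf (hl.trans_le h) hx
      · rcases Nat.eq_zero_or_pos k with h0 | h0
        · exact Or.inr h0
        · exact Or.inl (Nat.nonempty_of_pos_sInf (h0.trans_le h))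
    · rintro ⟨h1, h2 | h2⟩
      · refine le_csInf h2 fun l hl => ?_
        by_contra hlt
        exact h1 l (not_le.mp hlt) hl
      · have h2 : k = 0 := h2
        rw [h2]
        exact Nat.zero_le _
  rw [this]
  exact (MeasurableSet.iInter fun l => MeasurableSet.iInter fun _ => (hs l).compl).inter
    ((MeasurableSet.iUnion hs).union (MeasurableSet.const _))

/-! ### The Poisson model -/

section poisson

variable {b : ℕ} {β : ℝ}

instance (b : ℕ) (β : ℝ) : IsProbabilityMeasure (poissonTable b β) := by
  unfold poissonTable
  infer_instance

lemma measurePreserving_eval_poissonTable (b : ℕ) (β : ℝ) (i : ℤ) :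
    MeasurePreserving (fun x : ℤ → ℕ => x i) (poissonTable b β)
      (poissonMeasure (Real.toNNReal (b * β))) :=
  measurePreserving_eval_infinitePi _ i

lemma integral_pow_poissonTable (hβ : 0 ≤ β) (z : ℂ) (i : ℤ) :
    ∫ x, z ^ x i ∂poissonTable b β = Complex.exp (b * β * (z - 1)) := by
  have h0 : ∫ x, z ^ x i ∂poissonTable b β
      = ∫ n, z ^ n ∂poissonMeasure (Real.toNNReal (b * β)) := by
    rw [← (measurePreserving_eval_poissonTable b β i).map_eq,
      integral_map (measurable_pi_apply i).aemeasurable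
        Measurable.of_discrete.aestronglyMeasurable]
  rw [h0]
  rw [integral_poissonMeasure]
  have hr : ((Real.toNNReal (b * β) : ℝ≥0) : ℝ) = b * β := Real.coe_toNNReal _ (by positivity)
  rw [hr]
  have h := ((NormedSpace.expSeries_div_hasSum_exp ((b : ℂ) * β * z)).mul_left
    (Complex.exp (-(b * β)))).tsum_eq
  rw [← Complex.exp_eq_exp_ℂ, ← Complex.exp_add] at h
  rw [show (b : ℂ) * β * (z - 1) = -(b * β) + b * β * z by ring, ← h]
  refine tsum_congr fun n => ?_
  rw [Complex.real_smul]
  push_cast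
  ring

lemma integrable_exp_poissonTable (hβ : 0 ≤ β) (s : ℝ) (i : ℤ) :
    Integrable (fun x : ℤ → ℕ => Real.exp (s * (x i : ℝ))) (poissonTable b β) := by
  refine (measurePreserving_eval_poissonTable b β i).integrable_comp_of_integrable
    (g := fun n : ℕ => Real.exp (s * (n : ℝ))) ?_
  rw [integrable_poissonMeasure_iff]
  have hr : ((Real.toNNReal (b * β) : ℝ≥0) : ℝ) = b * β := Real.coe_toNNReal _ (by positivity)
  rw [hr]
  refine ((Real.summable_pow_div_factorial (b * β * Real.exp s)).mul_left
    (Real.exp (-(b * β)))).congr fun n => ?_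
  rw [Real.norm_of_nonneg (Real.exp_pos _).le, mul_comm s, Real.exp_nat_mul]
  ring

lemma mgf_eval_poissonTable (hβ : 0 ≤ β) (s : ℝ) (i : ℤ) :
    mgf (fun x : ℤ → ℕ => (x i : ℝ)) (poissonTable b β) s
      = Real.exp (b * β * (Real.exp s - 1)) := by
  have h := integral_pow_poissonTable (b := b) hβ (Real.exp s : ℂ) i
  have h2 : ∀ x : ℤ → ℕ, (Complex.exp s) ^ x i = ((Real.exp (s * (x i : ℝ)) : ℝ) : ℂ) := by
    intro x
    rw [mul_comm, Real.exp_nat_mul]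
    push_cast
    rfl
  rw [Complex.ofReal_exp] at h
  simp_rw [h2] at h
  rw [integral_complex_ofReal] at h
  unfold mgf
  exact_mod_cast h

/-- Chernoff's bound for a sum of independent Poisson variables. The true exponent `β (e^s - 1)` is
weakened to match `exists_chernoff_exponent`. -/
lemma measure_window_le (hβ : 0 ≤ β) {s : ℝ} (hs : 0 ≤ s) (i : ℤ) (L : ℕ) :
    (poissonTable b β).real {x | b * L ≤ ∑ k ∈ Finset.Ioc (i - L) i, x k}
      ≤ Real.exp (-(b * (s - β * ((Real.exp (2 * s) - 1) / 2)))) ^ L := by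
  have hind : iIndepFun (fun (i : ℤ) (x : ℤ → ℕ) => (x i : ℝ)) (poissonTable b β) :=
    iIndepFun_infinitePi (X := fun _ (n : ℕ) => (n : ℝ)) fun _ => measurable_of_countable _
  have hmeas : ∀ i : ℤ, Measurable fun x : ℤ → ℕ => (x i : ℝ) := fun i =>
    (measurable_of_countable fun n : ℕ => (n : ℝ)).comp (measurable_pi_apply i)
  have hmgf := hind.mgf_sum hmeas (Finset.Ioc (i - L) i) (t := s)
  simp_rw [mgf_eval_poissonTable hβ] at hmgf
  rw [Finset.prod_const, Int.card_Ioc, sub_sub_cancel, Int.toNat_natCast] at hmgf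
  have hint := hind.integrable_exp_mul_sum hmeas (s := Finset.Ioc (i - L) i) (t := s)
    fun i _ => integrable_exp_poissonTable hβ s i
  have h := measure_ge_le_exp_mul_mgf ((b : ℝ) * L) hs hint
  rw [hmgf] at h
  have hset : {x : ℤ → ℕ | (b : ℝ) * L ≤ (∑ i ∈ Finset.Ioc (i - L) i, fun x : ℤ → ℕ => (x i : ℝ)) x}
      = {x | b * L ≤ ∑ k ∈ Finset.Ioc (i - L) i, x k} := by
    ext x
    simp only [Set.mem_ofPred_eq, Finset.sum_apply]
    exact_mod_cast Iff.rfl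
  rw [hset] at h
  refine h.trans ?_
  rw [← Real.exp_nat_mul, ← Real.exp_nat_mul, ← Real.exp_add]
  refine Real.exp_le_exp.mpr ?_
  have h1 : Real.exp s - 1 ≤ (Real.exp (2 * s) - 1) / 2 := by
    rw [two_mul, Real.exp_add]
    nlinarith [sq_nonneg (Real.exp s - 1)]
  have h2 : (b : ℝ) * L * (β * (Real.exp s - 1)) ≤ b * L * (β * ((Real.exp (2 * s) - 1) / 2)) := by
    gcongr
  linarith

/-- The windows that end at `i` are eventually less than full, with a geometric bound for their
probabilities. -/
lemma exists_measure_window_le (hb : 1 ≤ b) (hβ : 0 ≤ β) (hβ1 : β < 1) :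
    ∃ ρ : ℝ, 0 < ρ ∧ ρ < 1 ∧ ∀ (i : ℤ) (L : ℕ),
      poissonTable b β {x | b * L ≤ ∑ k ∈ Finset.Ioc (i - L) i, x k}
        ≤ ENNReal.ofReal (ρ ^ L) := by
  obtain ⟨s, hs, hc⟩ := exists_chernoff_exponent hβ hβ1
  refine ⟨Real.exp (-(b * (s - β * ((Real.exp (2 * s) - 1) / 2)))), Real.exp_pos _, ?_,
    fun i L => ?_⟩
  rotate_left
  · rw [← ofReal_measureReal]
    exact ENNReal.ofReal_le_ofReal (measure_window_le hβ hs.le i L)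
  · rw [Real.exp_lt_one_iff]
    have : (0 : ℝ) < b := by exact_mod_cast hb
    nlinarith [mul_pos this hc]

/-- Borel–Cantelli: almost surely all but finitely many windows ending at `i` have a negative sum.
-/
lemma ae_bddOverflow (hb : 1 ≤ b) (hβ : 0 ≤ β) (hβ1 : β < 1) :
    ∀ᵐ x ∂poissonTable b β, ∀ i, BddOverflow b x i := by
  obtain ⟨ρ, hρ0, hρ1, h⟩ := exists_measure_window_le hb hβ hβ1
  rw [ae_all_iff]
  intro i
  have hsum : ∑' L : ℕ, poissonTable b β {x | b * L ≤ ∑ k ∈ Finset.Ioc (i - L) i, x k} ≠ ∞ := by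
    refine ne_top_of_le_ne_top ?_ (ENNReal.tsum_le_tsum fun L => h i L)
    rw [← ENNReal.ofReal_tsum_of_nonneg (fun L => by positivity)
      (summable_geometric_of_lt_one hρ0.le hρ1)]
    exact ENNReal.ofReal_ne_top
  filter_upwards [ae_eventually_notMem hsum] with x hx
  refine Filter.IsBoundedUnder.bddAbove_range ⟨0, ?_⟩
  rw [Filter.eventually_map]
  filter_upwards [hx] with L hL
  rw [sum_Ioc_sub_const]
  rw [not_le] at hL
  have : ((∑ k ∈ Finset.Ioc (i - L) i, x k : ℕ) : ℤ) < b * L := by exact_mod_cast hL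
  omega

/-- A run of `k` full buckets forces a full window of length at least `k` ending at `k - 1`; sum the
geometric bound over all such lengths. -/
lemma measure_fullRun_le {ρ : ℝ} (hρ0 : 0 < ρ) (hρ1 : ρ < 1)
    (h : ∀ (i : ℤ) (L : ℕ), poissonTable b β {x | b * L ≤ ∑ k ∈ Finset.Ioc (i - L) i, x k}
        ≤ ENNReal.ofReal (ρ ^ L)) (k : ℕ) :
    poissonTable b β (fullRun b k) ≤ ENNReal.ofReal (ρ ^ k * (1 - ρ)⁻¹) := by
  have hsub : fullRun b k ⊆ ⋃ L : ℕ, {x | b * (k + L : ℕ) ≤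
      ∑ j ∈ Finset.Ioc ((k : ℤ) - 1 - (k + L : ℕ)) ((k : ℤ) - 1), x j} := by
    intro x hx
    have hx' : ∀ l : ℕ, ∃ L : ℕ, l < k → 1 ≤ L ∧ b * L ≤ ∑ j ∈ Finset.Ioc ((l : ℤ) - L) l, x j := by
      intro l
      by_cases hl : l < k
      · obtain ⟨L, hL⟩ := hx l hl
        exact ⟨L, fun _ => hL⟩
      · exact ⟨0, fun h => absurd h hl⟩
    choose F hF using hx'
    obtain ⟨L, h1, -, h2⟩ := exists_long_window (M := ∑ l ∈ Finset.range k, F l) fun l hl =>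
      ⟨F l, (hF l hl).1, Finset.single_le_sum (fun _ _ => Nat.zero_le _)
        (Finset.mem_range.mpr hl), (hF l hl).2⟩
    obtain ⟨L, rfl⟩ := Nat.exists_eq_add_of_le h1
    exact Set.mem_iUnion.mpr ⟨L, h2⟩
  refine (measure_mono hsub).trans ((measure_iUnion_le _).trans ?_)
  refine (ENNReal.tsum_le_tsum fun L => h _ _).trans ?_
  rw [← ENNReal.ofReal_tsum_of_nonneg (fun L => by positivity)]
  · refine ENNReal.ofReal_le_ofReal (le_of_eq ?_)
    simp_rw [pow_add]
    rw [tsum_mul_left, tsum_geometric_of_lt_one hρ0.le hρ1]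
  · simp_rw [pow_add]
    exact (summable_geometric_of_lt_one hρ0.le hρ1).mul_left _

lemma ae_exists_not_full (hb : 1 ≤ b) (hβ : 0 ≤ β) (hβ1 : β < 1) :
    ∀ᵐ x ∂poissonTable b β, ∃ l : ℕ, ¬ Full b x l := by
  obtain ⟨ρ, hρ0, hρ1, h⟩ := exists_measure_window_le hb hβ hβ1
  rw [ae_iff]
  have hlim : Tendsto (fun k : ℕ => ENNReal.ofReal (ρ ^ k * (1 - ρ)⁻¹)) atTop (𝓝 0) := by
    rw [← ENNReal.ofReal_zero]
    refine ENNReal.tendsto_ofReal ?_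
    simpa using (tendsto_pow_atTop_nhds_zero_of_lt_one hρ0.le hρ1).mul_const (1 - ρ)⁻¹
  refine le_antisymm (ge_of_tendsto' hlim fun k => ?_) zero_le
  refine (measure_mono ?_).trans (measure_fullRun_le hρ0 hρ1 h k)
  intro x hx l _
  simp only [not_exists, not_not, Set.mem_ofPred_eq] at hx
  exact hx l

lemma le_unsuccessfulZero_iff {x : ℤ → ℕ} (h : ∀ i, BddOverflow b x i)
    (h' : ∃ l : ℕ, ¬ Full b x l) (k : ℕ) : k ≤ unsuccessfulZero b x ↔ x ∈ fullRun b k := by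
  have hiff : ∀ l : ℕ, profile b x (0 + l) < b ↔ ¬ Full b x l := by
    intro l
    rw [zero_add, ← le_profile_iff (h _), not_le]
  constructor
  · intro hk l hl
    have := Nat.notMem_of_lt_sInf (hl.trans_le hk)
    simpa only [Set.mem_ofPred_eq, hiff, not_not] using this
  · intro H
    obtain ⟨l₀, h₀⟩ := h'
    refine le_csInf ⟨l₀, (hiff l₀).mpr h₀⟩ fun l hl => ?_
    by_contra hlt
    exact (hiff l).mp hl (H l (not_le.mp hlt))

end poisson

/-! ### Random variables with countably many values -/

section countable

variable {Ω ι E : Type*} [MeasurableSpace Ω] [MeasurableSpace ι] [Countable ι]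
  [MeasurableSingletonClass ι] (μ : Measure Ω) [IsFiniteMeasure μ] {X : Ω → ι}
  [NormedAddCommGroup E]

lemma integrable_comp_iff (hX : Measurable X) {f : ι → E} :
    Integrable (fun ω => f (X ω)) μ ↔ Summable fun k => μ.real {ω | X ω = k} * ‖f k‖ := by
  have h1 : Integrable (fun ω => f (X ω)) μ ↔ Integrable f (μ.map X) :=
    (integrable_map_measure (StronglyMeasurable.of_discrete).aestronglyMeasurable
      hX.aemeasurable).symm
  rw [h1, ← Measure.sum_smul_dirac (μ.map X),
    integrable_sum_dirac_iff fun i => measure_ne_top _ _]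
  refine summable_congr fun k => ?_
  rw [Measure.map_apply hX (measurableSet_singleton k)]
  rfl

lemma hasSum_integral_comp [NormedSpace ℝ E] [CompleteSpace E] (hX : Measurable X) {f : ι → E}
    (hf : Integrable (fun ω => f (X ω)) μ) :
    HasSum (fun k => μ.real {ω | X ω = k} • f k) (∫ ω, f (X ω) ∂μ) := by
  have h1 : Integrable f (μ.map X) :=
    (integrable_map_measure (StronglyMeasurable.of_discrete).aestronglyMeasurable
      hX.aemeasurable).mpr hf
  have h2 : ∫ ω, f (X ω) ∂μ = ∫ k, f k ∂μ.map X :=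
    (integral_map hX.aemeasurable (StronglyMeasurable.of_discrete).aestronglyMeasurable).symm
  have h3 : ∀ k, μ.real {ω | X ω = k} = ((μ.map X) {k}).toReal := fun k => by
    rw [Measure.map_apply hX (measurableSet_singleton k)]
    rfl
  rw [h2]
  simp_rw [h3]
  rw [← Measure.sum_smul_dirac (μ.map X)] at h1
  have h4 := hasSum_integral_sum_dirac (fun i => measure_ne_top (μ.map X) {i})
    ((integrable_sum_dirac_iff fun i => measure_ne_top _ _).mp h1)
  rwa [Measure.sum_smul_dirac] at h4

end countable

/-! ### Generating functions in the Poisson model -/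

section generating

variable {b : ℕ} {β : ℝ}

/-- The probability generating function of the overflow from bucket `k - 1`, restricted to the event
that the buckets `0, …, k - 1` are full. -/
def runGF (b : ℕ) (β : ℝ) (k : ℕ) (z : ℂ) : ℂ :=
  ∫ x, (fullRun b k).indicator (fun x => z ^ (overflow b x (k - 1)).toNat) x ∂poissonTable b β

/-- The probability that the buckets `0, …, k - 1` are full and that `j` keys try bucket `k`. -/
def stopProb (b : ℕ) (β : ℝ) (k j : ℕ) : ℝ :=
  (poissonTable b β).real (fullRun b k ∩ {x | profile b x k = j})

lemma stopProb_nonneg (k j : ℕ) : 0 ≤ stopProb b β k j := measureReal_nonneg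

lemma norm_indicator_pow_le {Ω : Type*} (s : Set Ω) (f : Ω → ℕ) {z : ℂ} (hz : ‖z‖ ≤ 1) (ω : Ω) :
    ‖s.indicator (fun ω => z ^ f ω) ω‖ ≤ 1 := by
  refine (norm_indicator_le_norm_self _ _).trans ?_
  rw [norm_pow]
  exact pow_le_one₀ (norm_nonneg _) hz

lemma integrable_indicator_pow {Ω : Type*} [MeasurableSpace Ω] (μ : Measure Ω) [IsFiniteMeasure μ]
    {s : Set Ω} (hs : MeasurableSet s) {f : Ω → ℕ} (hf : Measurable f) {z : ℂ} (hz : ‖z‖ ≤ 1) :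
    Integrable (s.indicator fun ω => z ^ f ω) μ :=
  Integrable.of_bound
    (((measurable_of_countable fun n : ℕ => z ^ n).comp hf).indicator hs).aestronglyMeasurable 1
    (ae_of_all _ (norm_indicator_pow_le s f hz))

lemma measurable_toNat_overflow (i : ℤ) : Measurable fun x => (overflow b x i).toNat :=
  (measurable_of_countable Int.toNat).comp (measurable_overflow b i)

lemma norm_runGF_le (k : ℕ) {z : ℂ} (hz : ‖z‖ ≤ 1) : ‖runGF b β k z‖ ≤ 1 := by
  refine (norm_integral_le_of_norm_le_const (C := 1)
    (ae_of_all _ (norm_indicator_pow_le _ _ hz))).trans ?_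
  simp

lemma indepFun_past {f : (ℤ → ℕ) → ℂ} (k : ℤ)
    (hf : Measurable[⨆ i ∈ Set.Iio k, MeasurableSpace.comap (fun x : ℤ → ℕ => x i) ⊤] f) :
    IndepFun f (fun x : ℤ → ℕ => x k) (poissonTable b β) := by
  have hind : iIndepFun (fun (i : ℤ) (x : ℤ → ℕ) => x i) (poissonTable b β) :=
    iIndepFun_infinitePi (X := fun _ (n : ℕ) => n) fun _ => measurable_id
  have h := indep_iSup_of_disjoint (fun i => (measurable_pi_apply i).comap_le) hind.iIndep
    (S := Set.Iio k) (T := {k}) (by simp)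
  rw [IndepFun_iff_Indep]
  refine indep_of_indep_of_le_left (indep_of_indep_of_le_right h ?_) hf.comap_le
  exact le_iSup₂_of_le k rfl le_rfl

lemma measurable_past_coord {k i : ℤ} (hi : i < k) :
    Measurable[⨆ i ∈ Set.Iio k, MeasurableSpace.comap (fun x : ℤ → ℕ => x i) ⊤]
      fun x : ℤ → ℕ => x i := by
  refine Measurable.of_comap_le ?_
  exact le_iSup₂_of_le (f := fun (i : ℤ) (_ : i ∈ Set.Iio k) =>
    MeasurableSpace.comap (fun x : ℤ → ℕ => x i) ⊤) i hi le_rfl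

/-- The run `0, …, k - 1` and the overflow `Q_{k-1}` depend only on `x_i`, `i < k`, hence are
independent of `x_k`. -/
lemma integral_run_mul (hβ : 0 ≤ β) (k : ℕ) (z : ℂ) :
    ∫ x, (fullRun b k).indicator (fun x => z ^ (overflow b x (k - 1)).toNat) x * z ^ x k
      ∂poissonTable b β = runGF b β k z * Complex.exp (b * β * (z - 1)) := by
  rw [runGF, ← integral_pow_poissonTable hβ z k]
  have hpast : Measurable[⨆ i ∈ Set.Iio (k : ℤ), MeasurableSpace.comap (fun x : ℤ → ℕ => x i) ⊤]
      ((fullRun b k).indicator fun x => z ^ (overflow b x (k - 1)).toNat) := by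
    refine Measurable.indicator ?_ (measurableSet_fullRun' b k fun i hi =>
      measurable_past_coord hi)
    exact (measurable_of_countable fun n : ℤ => z ^ n.toNat).comp
      (measurable_overflow' b fun i hi => measurable_past_coord (by omega))
  have hind := (indepFun_past (b := b) (β := β) k hpast).comp measurable_id
    (measurable_of_countable fun n : ℕ => z ^ n)
  refine hind.integral_fun_mul_eq_mul_integral ?_ ?_
  · exact (((measurable_of_countable fun n : ℕ => z ^ n).comp
      (measurable_toNat_overflow _)).indicator (measurableSet_fullRun b k)).aestronglyMeasurable
  · exact ((measurable_of_countable fun n : ℕ => z ^ n).comp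
      (measurable_pi_apply _)).aestronglyMeasurable

lemma measurableSet_stop (k j : ℕ) :
    MeasurableSet (fullRun b k ∩ {x : ℤ → ℕ | profile b x k = j}) :=
  (measurableSet_fullRun b k).inter (measurable_profile b k (measurableSet_singleton (j : ℤ)))

lemma integral_stop (k j : ℕ) (c : ℂ) :
    ∫ x, (fullRun b k ∩ {x | profile b x k = j}).indicator (fun _ => c) x ∂poissonTable b β
      = stopProb b β k j * c := by
  rw [integral_indicator_const c (measurableSet_stop k j), stopProb, Complex.real_smul]

lemma fullRun_succ (k : ℕ) : fullRun b (k + 1) = fullRun b k ∩ {x | Full b x k} := by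
  ext x
  simp only [fullRun, Set.mem_ofPred_eq, Set.mem_inter_iff, Nat.lt_succ_iff_lt_or_eq]
  constructor
  · exact fun h => ⟨fun l hl => h l (Or.inl hl), h k (Or.inr rfl)⟩
  · rintro ⟨h1, h2⟩ l (hl | rfl)
    · exact h1 l hl
    · exact h2

/-- On a run of length `k` the left side is `z ^ H_k`. Either `H_k = j < b` and the run stops, or
bucket `k` is full and `z ^ H_k = z ^ b * z ^ Q_k`. -/
lemma run_step {x : ℤ → ℕ} (hx : ∀ i, BddOverflow b x i) (k : ℕ) (z : ℂ) :
    (fullRun b k).indicator (fun x => z ^ (overflow b x (k - 1)).toNat) x * z ^ x k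
      = ∑ j ∈ Finset.range b,
          (fullRun b k ∩ {x | profile b x k = j}).indicator (fun _ => z ^ j) x
        + z ^ b * (fullRun b (k + 1)).indicator
            (fun x => z ^ (overflow b x ((k + 1 : ℕ) - 1)).toNat) x := by
  have h0 : 0 ≤ overflow b x (k - 1) := overflow_nonneg (hx _)
  have hprof : profile b x k = ((x k + (overflow b x (k - 1)).toNat : ℕ) : ℤ) := by
    rw [profile]; push_cast; rw [Int.toNat_of_nonneg h0]
  have hov := overflow_eq (hx k) (hx (k - 1))
  by_cases hk : x ∈ fullRun b k
  swap
  · simp [hk, fullRun_succ]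
  have hpow : z ^ (overflow b x (k - 1)).toNat * z ^ x k = z ^ (profile b x k).toNat := by
    rw [hprof, Int.toNat_natCast, ← pow_add, add_comm]
  rw [Set.indicator_of_mem hk, hpow]
  rw [show (((k + 1 : ℕ) : ℤ) - 1) = k by push_cast; ring]
  by_cases hf : (b : ℤ) ≤ profile b x k
  · have hmem : x ∈ fullRun b (k + 1) := by
      rw [fullRun_succ]
      exact ⟨hk, (le_profile_iff (hx _)).mp hf⟩
    rw [Set.indicator_of_mem hmem, Finset.sum_eq_zero, zero_add, ← pow_add]
    · congr 1
      rw [hov]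
      omega
    · intro j hj
      refine Set.indicator_of_notMem ?_ _
      rintro ⟨-, h⟩
      rw [Set.mem_ofPred_eq] at h
      rw [Finset.mem_range] at hj
      omega
  · have hmem : x ∉ fullRun b (k + 1) := by
      rw [fullRun_succ]
      exact fun h => hf ((le_profile_iff (hx _)).mpr h.2)
    rw [Set.indicator_of_notMem hmem, mul_zero, add_zero,
      Finset.sum_eq_single_of_mem (profile b x k).toNat]
    · rw [Set.indicator_of_mem]
      exact ⟨hk, by rw [Set.mem_ofPred_eq, hprof, Int.toNat_natCast]⟩
    · rw [Finset.mem_range]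
      omega
    · intro j _ hj
      refine Set.indicator_of_notMem ?_ _
      rintro ⟨-, h⟩
      rw [Set.mem_ofPred_eq] at h
      omega

lemma runGF_mul_exp (hb : 1 ≤ b) (hβ : 0 ≤ β) (hβ1 : β < 1) (k : ℕ) {z : ℂ} (hz : ‖z‖ ≤ 1) :
    runGF b β k z * Complex.exp (b * β * (z - 1))
      = ∑ j ∈ Finset.range b, stopProb b β k j * z ^ j + z ^ b * runGF b β (k + 1) z := by
  rw [← integral_run_mul hβ, integral_congr_ae ((ae_bddOverflow hb hβ hβ1).mono fun x hx =>
    run_step hx k z), integral_add, integral_finsetSum, integral_const_mul]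
  · simp_rw [integral_stop]
    rfl
  · exact fun j _ => (integrable_const _).indicator (measurableSet_stop k j)
  · exact integrable_finsetSum _ fun j _ => (integrable_const _).indicator (measurableSet_stop k j)
  · exact (integrable_indicator_pow _ (measurableSet_fullRun b _)
      (measurable_toNat_overflow _) hz).const_mul _

lemma overflow_shift (x : ℤ → ℕ) (i : ℤ) :
    overflow b (fun j => x (j + 1)) i = overflow b x (i + 1) := by
  unfold overflow
  congr 1
  funext L
  refine Finset.sum_bij' (fun k _ => k + 1) (fun k _ => k - 1) ?_ ?_ ?_ ?_ ?_
  all_goals simp only [Finset.mem_Ioc]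
  all_goals intros
  all_goals first | omega | simp

lemma integral_overflow_shift (z : ℂ) :
    ∫ x, z ^ (overflow b x 0).toNat ∂poissonTable b β
      = ∫ x, z ^ (overflow b x (-1)).toNat ∂poissonTable b β := by
  have hmap : (poissonTable b β).map (fun x i => x (i + 1)) = poissonTable b β :=
    Measure.map_infinitePi_infinitePi_of_inj (P := fun _ : ℤ =>
      poissonMeasure (Real.toNNReal (b * β))) (f := fun i : ℤ => i + 1) (add_left_injective 1)
  conv_rhs => rw [← hmap]
  rw [integral_map]
  · refine integral_congr_ae (ae_of_all _ fun x => ?_)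
    simp only [overflow_shift]
    norm_num
  · exact (measurable_pi_lambda _ fun i => measurable_pi_apply _).aemeasurable
  · exact ((measurable_of_countable fun n : ℕ => z ^ n).comp
      (measurable_toNat_overflow _)).aestronglyMeasurable

lemma runGF_zero (z : ℂ) :
    runGF b β 0 z = ∫ x, z ^ (overflow b x (-1)).toNat ∂poissonTable b β := by
  simp [runGF, fullRun]

/-- `Q_0` is distributed as `Q_{-1}`, and it vanishes when bucket `0` is not full, which removes
exactly the probability of that event. This closes the recursion at `k = 0`. -/
lemma runGF_one (hb : 1 ≤ b) (hβ : 0 ≤ β) (hβ1 : β < 1) {z : ℂ} (hz : ‖z‖ ≤ 1) :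
    runGF b β 1 z = runGF b β 0 z - ∑ j ∈ Finset.range b, (stopProb b β 0 j : ℂ) := by
  have hpt : ∀ᵐ x ∂poissonTable b β,
      (fullRun b 1).indicator (fun x => z ^ (overflow b x ((1 : ℕ) - 1)).toNat) x
      = z ^ (overflow b x 0).toNat - ∑ j ∈ Finset.range b,
          (fullRun b 0 ∩ {x | profile b x (0 : ℕ) = j}).indicator (fun _ => (1 : ℂ)) x := by
    filter_upwards [ae_bddOverflow hb hβ hβ1] with x hx
    have h0 : 0 ≤ overflow b x (0 - 1) := overflow_nonneg (hx _)
    have hov := overflow_eq (hx 0) (hx (0 - 1))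
    have h0mem : x ∈ fullRun b 0 := fun l hl => absurd hl (Nat.not_lt_zero l)
    have hprof : 0 ≤ profile b x 0 := by rw [profile]; positivity
    have hiff : x ∈ fullRun b 1 ↔ (b : ℤ) ≤ profile b x 0 := by
      rw [fullRun_succ, le_profile_iff (hx _)]
      exact ⟨fun h => h.2, fun h => ⟨h0mem, h⟩⟩
    simp only [Nat.cast_one, sub_self, Nat.cast_zero]
    by_cases hf : (b : ℤ) ≤ profile b x 0
    · rw [Set.indicator_of_mem (hiff.mpr hf), Finset.sum_eq_zero, sub_zero]
      intro j hj
      refine Set.indicator_of_notMem ?_ _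
      rintro ⟨-, h⟩
      rw [Set.mem_ofPred_eq] at h
      rw [Finset.mem_range] at hj
      omega
    · rw [Set.indicator_of_notMem (fun h => hf (hiff.mp h)),
        Finset.sum_eq_single_of_mem (profile b x 0).toNat]
      · rw [Set.indicator_of_mem, hov, max_eq_left (by omega)]
        · simp
        · exact ⟨h0mem, by rw [Set.mem_ofPred_eq]; omega⟩
      · rw [Finset.mem_range]
        omega
      · intro j _ hj
        refine Set.indicator_of_notMem ?_ _
        rintro ⟨-, h⟩
        rw [Set.mem_ofPred_eq] at h
        omega
  have hint := integrable_indicator_pow (poissonTable b β) MeasurableSet.univ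
    (measurable_toNat_overflow (b := b) 0) hz
  rw [Set.indicator_univ] at hint
  rw [runGF, integral_congr_ae hpt, integral_sub hint, integral_finsetSum, runGF_zero,
    integral_overflow_shift]
  · simp_rw [integral_stop, mul_one]
  · exact fun j _ => (integrable_const _).indicator (measurableSet_stop 0 j)
  · exact integrable_finsetSum _ fun j _ => (integrable_const _).indicator (measurableSet_stop 0 j)

lemma continuousOn_runGF (k : ℕ) : ContinuousOn (runGF b β k) (Metric.closedBall 0 1) := by
  refine continuousOn_of_dominated (bound := fun _ => 1) (fun z _ => ?_) (fun z hz => ?_)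
    (integrable_const _) (ae_of_all _ fun x => ?_)
  · exact (((measurable_of_countable fun n : ℕ => z ^ n).comp
      (measurable_toNat_overflow _)).indicator (measurableSet_fullRun b k)).aestronglyMeasurable
  · exact ae_of_all _ (norm_indicator_pow_le _ _ (by simpa using hz))
  · by_cases hx : x ∈ fullRun b k
    · simp only [Set.indicator_of_mem hx]
      fun_prop
    · simp only [Set.indicator_of_notMem hx]
      fun_prop

lemma runGF_zero_one : runGF b β 0 1 = 1 := by
  simp [runGF_zero]

lemma measure_unsuccessfulZero_eq (hb : 1 ≤ b) (hβ : 0 ≤ β) (hβ1 : β < 1) (k : ℕ) :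
    (poissonTable b β).real {x | unsuccessfulZero b x = k}
      = ∑ j ∈ Finset.range b, stopProb b β k j := by
  have h1 : (poissonTable b β).real {x | unsuccessfulZero b x = k}
      = (poissonTable b β).real
        (⋃ j ∈ Finset.range b, (fullRun b k ∩ {x | profile b x k = j})) := by
    refine measureReal_congr ?_
    filter_upwards [ae_bddOverflow hb hβ hβ1, ae_exists_not_full hb hβ hβ1] with x hx hx'
    refine propext ?_
    change unsuccessfulZero b x = k ↔
      x ∈ ⋃ j ∈ Finset.range b, (fullRun b k ∩ {x | profile b x k = j})
    have e1 := le_unsuccessfulZero_iff hx hx' k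
    have e2 := le_unsuccessfulZero_iff hx hx' (k + 1)
    rw [fullRun_succ, Set.mem_inter_iff, Set.mem_ofPred_eq, ← le_profile_iff (hx _)] at e2
    have hprof : 0 ≤ profile b x k := by
      rw [profile]
      have := overflow_nonneg (hx (k - 1))
      positivity
    simp only [Set.mem_iUnion, Set.mem_inter_iff, Set.mem_ofPred_eq, Finset.mem_range,
      exists_prop]
    constructor
    · intro h
      refine ⟨(profile b x k).toNat, ?_, e1.mp h.ge, by omega⟩
      by_contra hlt
      have := e2.mpr ⟨e1.mp h.ge, by omega⟩
      omega
    · rintro ⟨j, hj, h2, h3⟩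
      have h4 := e1.mpr h2
      by_contra hne
      have := (e2.mp (by omega)).2
      omega
  rw [h1, measureReal_biUnion_finset]
  · rfl
  · intro j _ j' _ hjj'
    refine Set.disjoint_left.mpr ?_
    rintro x ⟨-, h⟩ ⟨-, h'⟩
    rw [Set.mem_ofPred_eq] at h h'
    rw [h] at h'
    exact hjj' (by exact_mod_cast h')
  · exact fun j _ => measurableSet_stop k j

lemma hasSum_measure_unsuccessfulZero :
    HasSum (fun k : ℕ => (poissonTable b β).real {x | unsuccessfulZero b x = k}) 1 := by
  have h := hasSum_integral_comp (poissonTable b β) (measurable_unsuccessfulZero b)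
    (f := fun _ => (1 : ℝ)) (integrable_const _)
  simpa using h

end generating

/-! ### The roots `ζ_ℓ` -/

/-- `zeta b ℓ q β` as a function of `s = q ^ (1 / b)`. -/
def zetaRoot (b ℓ : ℕ) (s : ℂ) (β : ℝ) : ℂ :=
  treeFun (rootOfUnity b ^ ℓ * β * Real.exp (-β) * s) / β

lemma zeta_eq_zetaRoot (b ℓ : ℕ) (q : ℂ) (β : ℝ) :
    zeta b ℓ q β = zetaRoot b ℓ (q ^ (1 / (b : ℂ))) β := rfl

lemma isPrimitiveRoot_rootOfUnity {b : ℕ} (hb : 1 ≤ b) : IsPrimitiveRoot (rootOfUnity b) b :=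
  Complex.isPrimitiveRoot_exp b (by omega)

section roots

variable {b : ℕ} {β : ℝ}

lemma norm_zetaRoot_arg (hb : 1 ≤ b) (hβ : 0 < β) (ℓ : ℕ) (s : ℂ) :
    ‖rootOfUnity b ^ ℓ * β * Real.exp (-β) * s‖ = β * Real.exp (-β) * ‖s‖ := by
  have h1 : ‖rootOfUnity b‖ = 1 := (isPrimitiveRoot_rootOfUnity hb).norm'_eq_one (by omega)
  rw [norm_mul, norm_mul, norm_mul, norm_pow, h1, one_pow, one_mul, Complex.norm_real,
    Complex.norm_real, Real.norm_of_nonneg hβ.le, Real.norm_of_nonneg (Real.exp_pos _).le]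

lemma norm_zetaRoot_arg_lt (hb : 1 ≤ b) (hβ : 0 < β) (hβ1 : β < 1) (ℓ : ℕ) {s : ℂ} (hs : ‖s‖ ≤ 1) :
    ‖rootOfUnity b ^ ℓ * β * Real.exp (-β) * s‖ < Real.exp (-1) := by
  rw [norm_zetaRoot_arg hb hβ]
  refine lt_of_le_of_lt ?_ (mul_exp_neg_lt hβ1)
  exact mul_le_of_le_one_right (by positivity) hs

/-- `T e^{-T} = z` says `ζ = ω^ℓ s e^{β(ζ - 1)}`; the `b`-th power removes the root of unity. So all
the `ζ_ℓ` are zeros of the same kernel. -/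
lemma zetaRoot_pow (hb : 1 ≤ b) (hβ : 0 < β) (hβ1 : β < 1) (ℓ : ℕ) {s : ℂ} (hs : ‖s‖ ≤ 1) :
    zetaRoot b ℓ s β ^ b = s ^ b * Complex.exp (b * β * (zetaRoot b ℓ s β - 1)) := by
  have h := treeFun_mul_exp_neg_treeFun (norm_zetaRoot_arg_lt hb hβ hβ1 ℓ hs)
  have hβ' : (β : ℂ) ≠ 0 := by exact_mod_cast hβ.ne'
  have hz : treeFun (rootOfUnity b ^ ℓ * β * Real.exp (-β) * s) = β * zetaRoot b ℓ s β := by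
    rw [zetaRoot, mul_div_cancel₀ _ hβ']
  rw [hz] at h
  generalize zetaRoot b ℓ s β = z at h
  have h2 : z = rootOfUnity b ^ ℓ * s * Complex.exp (β * (z - 1)) := by
    have he : Complex.exp (β * (z - 1)) = Complex.exp (-β) * Complex.exp (β * z) := by
      rw [← Complex.exp_add]; ring_nf
    have h3 : Complex.exp (-(β * z)) * Complex.exp (β * z) = 1 := by
      rw [← Complex.exp_add]; simp
    rw [he]
    apply mul_left_cancel₀ hβ'
    calc (β : ℂ) * z = (β * z * Complex.exp (-(β * z))) * Complex.exp (β * z) := by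
          rw [mul_assoc, h3, mul_one]
      _ = _ := by
          rw [h]
          push_cast
          ring
  have hω : (rootOfUnity b ^ ℓ) ^ b = 1 := by
    rw [← pow_mul, mul_comm, pow_mul, (isPrimitiveRoot_rootOfUnity hb).pow_eq_one, one_pow]
  conv_lhs => rw [h2]
  rw [mul_pow, mul_pow, hω, one_mul, ← Complex.exp_nat_mul]
  ring_nf

/-- `|T(z)| ≤ T(|z|)` and `T(β e^{-β}) = β`. Hence the roots lie where `runGF_mul_exp` may be
evaluated. -/
lemma norm_zetaRoot_le (hb : 1 ≤ b) (hβ : 0 < β) (hβ1 : β < 1) (ℓ : ℕ) {s : ℂ} (hs : ‖s‖ ≤ 1) :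
    ‖zetaRoot b ℓ s β‖ ≤ 1 := by
  rw [zetaRoot, norm_div, Complex.norm_real, Real.norm_of_nonneg hβ.le, div_le_one hβ]
  refine (norm_treeFun_le (norm_zetaRoot_arg_lt hb hβ hβ1 ℓ hs).le).trans ?_
  rw [norm_zetaRoot_arg hb hβ]
  refine (treeReal_mono (by positivity) (mul_le_of_le_one_right (by positivity) hs)
    (mul_exp_neg_lt hβ1).le).trans_eq ?_
  exact treeReal_mul_exp_neg_self hβ.le hβ1

lemma zetaRoot_injOn (hb : 1 ≤ b) (hβ : 0 < β) (hβ1 : β < 1) {s : ℂ} (hs : ‖s‖ ≤ 1) (hs0 : s ≠ 0) :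
    Set.InjOn (fun ℓ => zetaRoot b ℓ s β) (Finset.range b) := by
  intro ℓ hℓ ℓ' hℓ' h
  have hβ' : (β : ℂ) ≠ 0 := by exact_mod_cast hβ.ne'
  have h1 := (div_left_inj' hβ').mp h
  have h2 := treeFun_injOn (by simpa using norm_zetaRoot_arg_lt hb hβ hβ1 ℓ hs)
    (by simpa using norm_zetaRoot_arg_lt hb hβ hβ1 ℓ' hs) h1
  have he : (Real.exp (-β) : ℂ) ≠ 0 := by exact_mod_cast (Real.exp_pos _).ne'
  have h3 := mul_right_cancel₀ hβ' (mul_right_cancel₀ he (mul_right_cancel₀ hs0 h2))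
  exact (isPrimitiveRoot_rootOfUnity hb).pow_inj (by simpa using hℓ) (by simpa using hℓ') h3

lemma zetaRoot_zero_one (hβ : 0 < β) (hβ1 : β < 1) : zetaRoot b 0 1 β = 1 := by
  have hβ' : (β : ℂ) ≠ 0 := by exact_mod_cast hβ.ne'
  have h := treeFun_ofReal (β * Real.exp (-β))
  rw [treeReal_mul_exp_neg_self hβ.le hβ1] at h
  rw [zetaRoot, pow_zero, one_mul, mul_one, ← Complex.ofReal_mul, h, div_self hβ']

lemma zeta_one (ℓ : ℕ) : zeta b ℓ 1 β = zetaRoot b ℓ 1 β := by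
  rw [zeta_eq_zetaRoot, Complex.one_cpow]

lemma zetaRoot_one_ne_one (hb : 1 ≤ b) (hβ : 0 < β) (hβ1 : β < 1) {ℓ : ℕ}
    (hℓ : ℓ ∈ Finset.Icc 1 (b - 1)) : zetaRoot b ℓ 1 β ≠ 1 := by
  rw [Finset.mem_Icc] at hℓ
  intro h
  have h' : zetaRoot b ℓ 1 β = zetaRoot b 0 1 β := h.trans (zetaRoot_zero_one hβ hβ1).symm
  have := zetaRoot_injOn hb hβ hβ1 (s := 1) (by simp) one_ne_zero
    (Finset.mem_coe.mpr (Finset.mem_range.mpr (by omega : ℓ < b)))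
    (Finset.mem_coe.mpr (Finset.mem_range.mpr (by omega : 0 < b))) h'
  omega

lemma prod_range_eq_mul_Icc (hb : 1 ≤ b) (f : ℕ → ℂ) :
    ∏ ℓ ∈ Finset.range b, f ℓ = f 0 * ∏ ℓ ∈ Finset.Icc 1 (b - 1), f ℓ := by
  have : Finset.range b = insert 0 (Finset.Icc 1 (b - 1)) := by
    ext k
    simp only [Finset.mem_range, Finset.mem_insert, Finset.mem_Icc]
    omega
  rw [this, Finset.prod_insert (by simp)]

end roots

open Polynomial in
/-- A polynomial of degree `b` is determined by its leading coefficient and `b` distinct roots. -/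
lemma eval_add_eq_prod_of_roots {b : ℕ} {v : ℕ → ℂ} (hv : Set.InjOn v (Finset.range b))
    (a : ℕ → ℂ) (c : ℂ) {F : ℂ[X]} (hF : F.Monic) (hdeg : F.natDegree = b)
    (h : ∀ ℓ < b, ∑ j ∈ Finset.range b, a j * v ℓ ^ j + c * F.eval (v ℓ) = 0) (z : ℂ) :
    ∑ j ∈ Finset.range b, a j * z ^ j + c * F.eval z
      = c * ∏ ℓ ∈ Finset.range b, (z - v ℓ) := by
  set G : ℂ[X] := ∏ ℓ ∈ Finset.range b, (X - C (v ℓ)) with hG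
  have hGm : G.Monic := monic_prod_X_sub_C _ _
  have hGd : G.natDegree = b := by rw [hG, natDegree_finsetProd_X_sub_C_eq_card]; simp
  set A : ℂ[X] := ∑ j ∈ Finset.range b, C (a j) * X ^ j with hA
  have hAd : A.degree < (b : WithBot ℕ) := by
    rw [← mem_degreeLT]
    refine Submodule.sum_mem _ fun j hj => ?_
    rw [mem_degreeLT]
    exact (degree_C_mul_X_pow_le _ _).trans_lt (by exact_mod_cast Finset.mem_range.mp hj)
  have hFG : (F - G).degree < (b : WithBot ℕ) := by
    have hFd : F.degree = b := by rw [degree_eq_natDegree hF.ne_zero, hdeg]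
    have hGd' : G.degree = b := by rw [degree_eq_natDegree hGm.ne_zero, hGd]
    rw [← hFd]
    exact degree_sub_lt_left (hFd.trans hGd'.symm) hF.ne_zero (by rw [hF, hGm])
  -- The leading terms of the monic polynomials `F` and `G` cancel, so this has degree less than `b`
  -- and vanishes at `b` distinct points.
  have hzero : A + C c * (F - G) = 0 := by
    refine eq_zero_of_degree_lt_of_eval_index_eq_zero _ hv ?_ ?_
    · rw [Finset.card_range, ← mem_degreeLT]
      refine Submodule.add_mem _ (mem_degreeLT.mpr hAd) ?_
      rw [← smul_eq_C_mul]
      exact Submodule.smul_mem _ _ (mem_degreeLT.mpr hFG)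
    · intro ℓ hℓ
      have hGe : G.eval (v ℓ) = 0 := by
        rw [hG, eval_prod]
        exact Finset.prod_eq_zero hℓ (by simp)
      have := h ℓ (Finset.mem_range.mp hℓ)
      simp only [eval_add, eval_mul, eval_C, eval_sub, hGe, sub_zero, hA, eval_finsetSum,
        eval_pow, eval_X]
      exact this
  have h2 := congrArg (eval z) hzero
  simp only [eval_add, eval_mul, eval_C, eval_sub, hA, hG, eval_finsetSum, eval_pow, eval_X,
    eval_prod, eval_zero] at h2
  linear_combination h2

/-! ### The kernel method: closed form of the generating function inside the unit disc -/

section kernel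

variable {b : ℕ} {β : ℝ}

/-- `P(U_β = k)`. -/
def unsuccessfulProb (b : ℕ) (β : ℝ) (k : ℕ) : ℝ :=
  (poissonTable b β).real {x | unsuccessfulZero b x = k}

lemma unsuccessfulProb_nonneg (k : ℕ) : 0 ≤ unsuccessfulProb b β k := measureReal_nonneg

lemma unsuccessfulProb_eq (hb : 1 ≤ b) (hβ : 0 ≤ β) (hβ1 : β < 1) (k : ℕ) :
    (unsuccessfulProb b β k : ℂ) = ∑ j ∈ Finset.range b, (stopProb b β k j : ℂ) := by
  rw [unsuccessfulProb, measure_unsuccessfulZero_eq hb hβ hβ1]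
  push_cast
  rfl

/-- Recursion at `k = 0` combined with stationarity. A zero of the kernel in the closed disc must be
a zero of the polynomial on the right. -/
lemma overflowGF_equation (hb : 1 ≤ b) (hβ : 0 ≤ β) (hβ1 : β < 1) {z : ℂ} (hz : ‖z‖ ≤ 1) :
    runGF b β 0 z * (z ^ b - Complex.exp (b * β * (z - 1)))
      = unsuccessfulProb b β 0 * z ^ b - ∑ j ∈ Finset.range b, stopProb b β 0 j * z ^ j := by
  have h1 := runGF_mul_exp hb hβ hβ1 0 hz
  have h2 := runGF_one hb hβ hβ1 hz
  rw [zero_add, h2, ← unsuccessfulProb_eq hb hβ hβ1] at h1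
  linear_combination -h1

lemma stationary_factorization (hb : 1 ≤ b) (hβ : 0 < β) (hβ1 : β < 1) (z : ℂ) :
    unsuccessfulProb b β 0 * z ^ b - ∑ j ∈ Finset.range b, stopProb b β 0 j * z ^ j
      = unsuccessfulProb b β 0 * ∏ ℓ ∈ Finset.range b, (z - zetaRoot b ℓ 1 β) := by
  have h := eval_add_eq_prod_of_roots
    (zetaRoot_injOn hb hβ hβ1 (s := 1) (by simp) one_ne_zero)
    (fun j => -(stopProb b β 0 j : ℂ)) (unsuccessfulProb b β 0 : ℂ)
    (F := Polynomial.X ^ b) (Polynomial.monic_X_pow b) (Polynomial.natDegree_X_pow b) ?_ z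
  · rw [← h]
    simp only [neg_mul, Finset.sum_neg_distrib, Polynomial.eval_pow, Polynomial.eval_X]
    ring
  · intro ℓ _
    have h1 := overflowGF_equation hb hβ.le hβ1
      (norm_zetaRoot_le hb hβ hβ1 ℓ (s := 1) (by simp))
    have h2 := zetaRoot_pow hb hβ hβ1 ℓ (s := 1) (by simp)
    rw [one_pow, one_mul] at h2
    rw [← h2, sub_self, mul_zero] at h1
    simp only [neg_mul, Finset.sum_neg_distrib, Polynomial.eval_pow, Polynomial.eval_X]
    linear_combination -h1

/-- Normalisation: divide the factorised equation by `z - 1` and let `z ↑ 1` along the reals. The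
overflow generating function tends to `1` and the kernel quotient to the derivative `b (1 - β)`. -/
lemma unsuccessfulProb_zero_mul (hb : 1 ≤ b) (hβ : 0 < β) (hβ1 : β < 1) :
    (unsuccessfulProb b β 0 : ℂ) * ∏ ℓ ∈ Finset.Icc 1 (b - 1), (1 - zetaRoot b ℓ 1 β)
      = b * (1 - β) := by
  have hd : HasDerivAt (fun z : ℂ => z ^ b - Complex.exp (b * β * (z - 1))) (b * (1 - β)) 1 := by
    have h1 := (hasDerivAt_pow b (1 : ℂ)).sub
      ((((hasDerivAt_id (1 : ℂ)).sub_const 1).const_mul ((b : ℂ) * β)).cexp)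
    convert! h1 using 1
    simp
    ring
  have hto : Tendsto (fun x : ℝ => (x : ℂ)) (𝓝[<] 1) (𝓝[≠] 1) := by
    refine tendsto_nhdsWithin_iff.mpr ⟨?_, ?_⟩
    · have : Tendsto (fun x : ℝ => (x : ℂ)) (𝓝 1) (𝓝 ((1 : ℝ) : ℂ)) :=
        Complex.continuous_ofReal.continuousAt
      rw [Complex.ofReal_one] at this
      exact this.mono_left nhdsWithin_le_nhds
    · filter_upwards [self_mem_nhdsWithin] with x hx
      have : x ≠ 1 := ne_of_lt hx
      exact Complex.ofReal_ne_one.mpr this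
  have hmem : ∀ᶠ x : ℝ in 𝓝[<] 1, ‖(x : ℂ)‖ ≤ 1 := by
    filter_upwards [Ioo_mem_nhdsLT (zero_lt_one' ℝ)] with x hx
    rw [Complex.norm_real, Real.norm_of_nonneg hx.1.le]
    exact hx.2.le
  have hψ : Tendsto (fun x : ℝ => runGF b β 0 x) (𝓝[<] 1) (𝓝 1) := by
    have h1 : ContinuousWithinAt (runGF b β 0) (Metric.closedBall 0 1) 1 :=
      continuousOn_runGF 0 1 (by simp)
    rw [ContinuousWithinAt, runGF_zero_one] at h1
    refine h1.comp (tendsto_nhdsWithin_iff.mpr ⟨hto.mono_right nhdsWithin_le_nhds, ?_⟩)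
    filter_upwards [hmem] with x hx
    simpa using hx
  have h1 := hψ.mul (hd.tendsto_slope.comp hto)
  have hc : Continuous fun z : ℂ => (unsuccessfulProb b β 0 : ℂ) *
      ∏ ℓ ∈ Finset.Icc 1 (b - 1), (z - zetaRoot b ℓ 1 β) := by fun_prop
  have h2 := (hc.tendsto 1).comp (hto.mono_right nhdsWithin_le_nhds)
  rw [one_mul] at h1
  refine tendsto_nhds_unique (h2.congr' ?_) h1
  filter_upwards [hmem, self_mem_nhdsWithin] with x hx hx1
  have hx1' : (x : ℂ) - 1 ≠ 0 := by
    rw [sub_ne_zero]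
    have : x ≠ 1 := ne_of_lt hx1
    exact_mod_cast this
  have e1 := overflowGF_equation hb hβ.le hβ1 hx
  rw [stationary_factorization hb hβ hβ1, prod_range_eq_mul_Icc hb, zetaRoot_zero_one hβ hβ1] at e1
  simp only [Function.comp_apply, slope, vsub_eq_sub, smul_eq_mul, one_pow, sub_self, mul_zero,
    Complex.exp_zero, sub_zero]
  rw [mul_left_comm, e1]
  field_simp

lemma unsuccessfulProb_zero_eq (hb : 1 ≤ b) (hβ : 0 < β) (hβ1 : β < 1) :
    (unsuccessfulProb b β 0 : ℂ) = tZero b β := by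
  rw [tZero, eq_div_iff]
  · simp_rw [zeta_one]
    exact unsuccessfulProb_zero_mul hb hβ hβ1
  · refine Finset.prod_ne_zero_iff.mpr fun ℓ hℓ => ?_
    rw [zeta_one, sub_ne_zero]
    exact (zetaRoot_one_ne_one hb hβ hβ1 hℓ).symm

lemma summable_pow_mul_stopProb {t : ℂ} (ht : ‖t‖ < 1) (j : ℕ) :
    Summable fun k => t ^ k * (stopProb b β k j : ℂ) := by
  refine Summable.of_norm_bounded (summable_geometric_of_lt_one (norm_nonneg t) ht) fun k => ?_
  rw [norm_mul, norm_pow, Complex.norm_real, Real.norm_of_nonneg (stopProb_nonneg k j)]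
  exact mul_le_of_le_one_right (by positivity) measureReal_le_one

/-- The kernel method: at a root `z` of `z ^ b = t * exp (b * β * (z - 1))`. -/
lemma stopGF_at_root (hb : 1 ≤ b) (hβ : 0 ≤ β) (hβ1 : β < 1) {t z : ℂ} (ht : ‖t‖ < 1)
    (hz : ‖z‖ ≤ 1) (hroot : z ^ b = t * Complex.exp (b * β * (z - 1))) :
    t * ∑ j ∈ Finset.range b, (∑' k, t ^ k * (stopProb b β k j : ℂ)) * z ^ j
      = z ^ b * runGF b β 0 z := by
  have h1 : HasSum (fun k => t * ∑ j ∈ Finset.range b, t ^ k * (stopProb b β k j : ℂ) * z ^ j)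
      (t * ∑ j ∈ Finset.range b, (∑' k, t ^ k * (stopProb b β k j : ℂ)) * z ^ j) :=
    (hasSum_sum fun j _ => ((summable_pow_mul_stopProb ht j).hasSum.mul_right _)).mul_left t
  refine tendsto_nhds_unique h1.tendsto_sum_nat ?_
  -- Weighted by `t ^ (k + 1)`, the recursion telescopes at a root, because `t * exp (b * β * (z -
  -- 1))` becomes `z ^ b`.
  set g : ℕ → ℂ := fun k => t ^ k * (z ^ b * runGF b β k z) with hg
  have hterm : ∀ k, t * ∑ j ∈ Finset.range b, t ^ k * (stopProb b β k j : ℂ) * z ^ j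
      = g k - g (k + 1) := by
    intro k
    have h2 := runGF_mul_exp hb hβ hβ1 k hz
    have h3 : ∑ j ∈ Finset.range b, t ^ k * (stopProb b β k j : ℂ) * z ^ j
        = t ^ k * ∑ j ∈ Finset.range b, (stopProb b β k j : ℂ) * z ^ j := by
      rw [Finset.mul_sum]
      exact Finset.sum_congr rfl fun j _ => by ring
    rw [h3, hg]
    simp only
    linear_combination (-t ^ (k + 1)) * h2 - t ^ k * runGF b β k z * hroot
  simp_rw [hterm, Finset.sum_range_sub']
  have hlim : Tendsto g atTop (𝓝 0) := by
    refine squeeze_zero_norm (fun k => ?_)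
      (tendsto_pow_atTop_nhds_zero_of_lt_one (norm_nonneg t) ht)
    rw [hg, norm_mul, norm_pow, norm_mul, norm_pow]
    refine mul_le_of_le_one_right (by positivity) ?_
    exact mul_le_one₀ (pow_le_one₀ (norm_nonneg _) hz) (norm_nonneg _) (norm_runGF_le k hz)
  have := (tendsto_const_nhds (x := g 0)).sub hlim
  simpa [hg] using this

/-- With `t = s^b` and `S_j = ∑ t^k * stopProb b β k j`, the polynomial `(1 - t) ∑ S_j z^j + P(U =
0) ∏ (z - ζ_ℓ(1))` vanishes at the `ζ_ℓ` for `s`, so it equals `P(U = 0)` times the product over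
these roots. At `z = 1` the product over the `ζ_ℓ(1)` drops out, as `ζ_0(1) = 1`. -/
lemma unsuccessfulGF_eq_of_norm_lt (hb : 1 ≤ b) (hβ : 0 < β) (hβ1 : β < 1) {s : ℂ} (hs : ‖s‖ < 1)
    (hs0 : s ≠ 0) :
    (1 - s ^ b) * ∑' k, (s ^ b) ^ k * (unsuccessfulProb b β k : ℂ)
      = unsuccessfulProb b β 0 * ∏ ℓ ∈ Finset.range b, (1 - zetaRoot b ℓ s β) := by
  have ht : ‖s ^ b‖ < 1 := by
    rw [norm_pow]
    exact pow_lt_one₀ (norm_nonneg s) hs (by omega)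
  have ht0 : s ^ b ≠ 0 := pow_ne_zero b hs0
  have h := eval_add_eq_prod_of_roots
    (zetaRoot_injOn hb hβ hβ1 hs.le hs0)
    (fun j => (1 - s ^ b) * ∑' k, (s ^ b) ^ k * (stopProb b β k j : ℂ))
    (unsuccessfulProb b β 0 : ℂ)
    (F := ∏ ℓ ∈ Finset.range b, (Polynomial.X - Polynomial.C (zetaRoot b ℓ 1 β)))
    (Polynomial.monic_prod_X_sub_C _ _)
    (by rw [Polynomial.natDegree_finsetProd_X_sub_C_eq_card]; simp) ?_ 1
  · rw [← h]
    have hzero : ∏ ℓ ∈ Finset.range b, (1 - zetaRoot b ℓ 1 β) = 0 := by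
      refine Finset.prod_eq_zero (Finset.mem_range.mpr (by omega : 0 < b)) ?_
      rw [zetaRoot_zero_one hβ hβ1, sub_self]
    simp only [one_pow, mul_one, Polynomial.eval_prod, Polynomial.eval_sub, Polynomial.eval_X,
      Polynomial.eval_C, hzero, mul_zero, add_zero]
    rw [← Finset.mul_sum, ← Summable.tsum_finsetSum fun j _ => summable_pow_mul_stopProb ht j]
    simp_rw [← Finset.mul_sum, ← unsuccessfulProb_eq hb hβ.le hβ1]
  · intro ℓ _
    have hroot := zetaRoot_pow hb hβ hβ1 ℓ hs.le
    have hnorm := norm_zetaRoot_le hb hβ hβ1 ℓ hs.le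
    have h1 := stopGF_at_root hb hβ.le hβ1 ht hnorm hroot
    have h2 := overflowGF_equation hb hβ.le hβ1 hnorm
    rw [stationary_factorization hb hβ hβ1] at h2
    simp only [mul_assoc, ← Finset.mul_sum, Polynomial.eval_prod, Polynomial.eval_sub,
      Polynomial.eval_X, Polynomial.eval_C]
    apply mul_left_cancel₀ ht0
    generalize ∑ j ∈ Finset.range b, (∑' k, (s ^ b) ^ k * (stopProb b β k j : ℂ)) *
      zetaRoot b ℓ s β ^ j = P at *
    linear_combination (1 - s ^ b) * h1 - s ^ b * h2 + runGF b β 0 (zetaRoot b ℓ s β) * hroot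

end kernel

/-! ### Power series that converge absolutely on a closed disc -/

/-- `f` is the sum of a power series that converges absolutely on the closed disc of radius `ρ`. -/
def HasAbsSeries (ρ : ℝ) (f : ℂ → ℂ) (c : ℕ → ℂ) : Prop :=
  (Summable fun n => ‖c n‖ * ρ ^ n) ∧ ∀ s : ℂ, ‖s‖ ≤ ρ → HasSum (fun n => c n * s ^ n) (f s)

namespace HasAbsSeries

variable {ρ : ℝ} {f g : ℂ → ℂ} {c d : ℕ → ℂ}

lemma summable_norm (h : HasAbsSeries ρ f c) {s : ℂ} (hs : ‖s‖ ≤ ρ) :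
    Summable fun n => ‖c n * s ^ n‖ := by
  refine Summable.of_nonneg_of_le (fun _ => norm_nonneg _) (fun n => ?_) h.1
  rw [norm_mul, norm_pow]
  gcongr

lemma const (a : ℂ) : HasAbsSeries ρ (fun _ => a) (fun n => if n = 0 then a else 0) := by
  refine ⟨(hasSum_single 0 fun n hn => by simp [hn]).summable, fun s _ => ?_⟩
  convert! hasSum_single (f := fun n : ℕ => (if n = 0 then a else 0) * s ^ n) 0
    (fun n hn => by simp [hn]) using 1
  simp

lemma sub (hρ : 0 ≤ ρ) (hf : HasAbsSeries ρ f c) (hg : HasAbsSeries ρ g d) :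
    HasAbsSeries ρ (fun s => f s - g s) (fun n => c n - d n) := by
  refine ⟨?_, fun s hs => ?_⟩
  · refine Summable.of_nonneg_of_le (fun n => by positivity) (fun n => ?_) (hf.1.add hg.1)
    rw [← add_mul]
    gcongr
    exact norm_sub_le _ _
  · simp_rw [sub_mul]
    exact (hf.2 s hs).sub (hg.2 s hs)

lemma mul (hρ : 0 ≤ ρ) (hf : HasAbsSeries ρ f c) (hg : HasAbsSeries ρ g d) :
    ∃ e, HasAbsSeries ρ (fun s => f s * g s) e := by
  have hterm : ∀ (s : ℂ) (n : ℕ),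
      (∑ p ∈ Finset.HasAntidiagonal.antidiagonal n, c p.1 * d p.2) * s ^ n
      = ∑ p ∈ Finset.HasAntidiagonal.antidiagonal n, (c p.1 * s ^ p.1) * (d p.2 * s ^ p.2) := by
    intro s n
    rw [Finset.sum_mul]
    refine Finset.sum_congr rfl fun p hp => ?_
    rw [← Finset.HasAntidiagonal.mem_antidiagonal.mp hp]
    ring
  refine ⟨fun n => ∑ p ∈ Finset.HasAntidiagonal.antidiagonal n, c p.1 * d p.2, ?_, fun s hs => ?_⟩
  · have hρ' : ‖(ρ : ℂ)‖ ≤ ρ := by rw [Complex.norm_real, Real.norm_of_nonneg hρ]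
    refine (summable_norm_sum_mul_antidiagonal_of_summable_norm (hf.summable_norm hρ')
      (hg.summable_norm hρ')).congr fun n => ?_
    rw [← hterm, norm_mul, norm_pow, Complex.norm_real, Real.norm_of_nonneg hρ]
  · simp_rw [hterm]
    have h1 := summable_norm_sum_mul_antidiagonal_of_summable_norm (hf.summable_norm hs)
      (hg.summable_norm hs)
    have h2 := tsum_mul_tsum_eq_tsum_sum_antidiagonal_of_summable_norm (hf.summable_norm hs)
      (hg.summable_norm hs)
    rw [(hf.2 s hs).tsum_eq, (hg.2 s hs).tsum_eq] at h2
    rw [h2]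
    exact h1.of_norm.hasSum

lemma finsetProd (hρ : 0 ≤ ρ) {ι : Type*} (S : Finset ι) (F : ι → ℂ → ℂ)
    (h : ∀ i ∈ S, ∃ c, HasAbsSeries ρ (F i) c) :
    ∃ c, HasAbsSeries ρ (fun s => ∏ i ∈ S, F i s) c := by
  classical
  induction S using Finset.induction_on with
  | empty => exact ⟨_, by simpa using const 1⟩
  | insert i S hi ih =>
    obtain ⟨c, hc⟩ := h i (Finset.mem_insert_self i S)
    obtain ⟨d, hd⟩ := ih fun j hj => h j (Finset.mem_insert_of_mem hj)
    obtain ⟨e, he⟩ := hc.mul hρ hd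
    exact ⟨e, by simpa [Finset.prod_insert hi] using he⟩

end HasAbsSeries

/-- The coefficients of a power series are determined by its sum near `0`. -/
lemma eq_of_hasSum_pow {c d : ℕ → ℂ} {f : ℂ → ℂ}
    (hc : ∀ᶠ s in 𝓝 (0 : ℂ), HasSum (fun n => c n * s ^ n) (f s))
    (hd : ∀ᶠ s in 𝓝 (0 : ℂ), HasSum (fun n => d n * s ^ n) (f s)) : c = d := by
  have key : ∀ e : ℕ → ℂ, (∀ᶠ s in 𝓝 (0 : ℂ), HasSum (fun n => e n * s ^ n) (f s)) →
      HasFPowerSeriesAt f (FormalMultilinearSeries.ofScalars ℂ e) 0 := by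
    intro e he
    rw [hasFPowerSeriesAt_iff]
    filter_upwards [he] with s hs
    simpa [mul_comm] using hs
  have h := (key c hc).eq_formalMultilinearSeries (key d hd)
  funext n
  have := congrArg (fun p => p.coeff n) h
  simpa using this

/-! ### Extension of the closed form beyond the unit disc -/

section extension

variable {b : ℕ} {β ρ : ℝ}

lemma exists_hasAbsSeries_zetaRoot (hb : 1 ≤ b) (hβ : 0 < β) (hρ0 : 0 ≤ ρ)
    (hρ : β * Real.exp (-β) * ρ ≤ Real.exp (-1)) (ℓ : ℕ) :
    ∃ c, HasAbsSeries ρ (fun s => zetaRoot b ℓ s β) c := by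
  set a : ℂ := rootOfUnity b ^ ℓ * β * Real.exp (-β) with ha
  have han : ‖a‖ = β * Real.exp (-β) := by
    have := norm_zetaRoot_arg hb hβ ℓ 1
    simpa [ha] using this
  set c : ℕ → ℂ := fun n => Nat.casesOn n 0 fun n => treeCoeff n * a ^ (n + 1) / β with hc
  refine ⟨c, ?_, fun s hs => ?_⟩
  · rw [← summable_nat_add_iff 1]
    refine ((summable_treeCoeff (by positivity) hρ).div_const β).congr fun n => ?_
    simp only [hc, norm_div, norm_mul, norm_pow, han, Complex.norm_real,
      Real.norm_of_nonneg (treeCoeff_nonneg n), Real.norm_of_nonneg hβ.le]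
    rw [mul_pow (β * Real.exp (-β)) ρ]
    ring
  · have hn : ‖a * s‖ ≤ Real.exp (-1) := by
      rw [norm_mul, han]
      refine le_trans ?_ hρ
      gcongr
    have h1 := ((summable_norm_treeFun hn).of_norm.hasSum).div_const (β : ℂ)
    rw [← treeFun_eq] at h1
    have h2 : HasSum (fun n => c (n + 1) * s ^ (n + 1)) (zetaRoot b ℓ s β) := by
      convert! h1 using 1
      funext n
      simp only [hc]
      ring
    have h3 := (hasSum_nat_add_iff (f := fun n => c n * s ^ n) 1).mp h2
    simpa [hc] using h3

/-- The increments of `k ↦ P(U_β = k)`. -/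
def probIncrement (b : ℕ) (β : ℝ) (k : ℕ) : ℝ :=
  Nat.casesOn k (unsuccessfulProb b β 0)
    fun k => unsuccessfulProb b β (k + 1) - unsuccessfulProb b β k

lemma hasSum_probIncrement {t a : ℂ}
    (h : HasSum (fun k => t ^ k * (unsuccessfulProb b β k : ℂ)) a) :
    HasSum (fun k => (probIncrement b β k : ℂ) * t ^ k) ((1 - t) * a) := by
  have h1 : HasSum (fun k => (probIncrement b β (k + 1) : ℂ) * t ^ (k + 1))
      (a - unsuccessfulProb b β 0 - t * a) := by
    have h2 := (hasSum_nat_add_iff' (f := fun k => t ^ k * (unsuccessfulProb b β k : ℂ)) 1).mpr h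
    have h3 := h2.sub (h.mul_left t)
    convert! h3 using 1
    · funext k
      simp only [probIncrement]
      push_cast
      ring
    · simp
  have h2 := (hasSum_nat_add_iff (f := fun k => (probIncrement b β k : ℂ) * t ^ k) 1).mp h1
  convert! h2 using 1
  simp [probIncrement]
  ring

lemma summable_pow_mul_unsuccessfulProb {t : ℂ} (ht : ‖t‖ ≤ 1) :
    Summable fun k => t ^ k * (unsuccessfulProb b β k : ℂ) := by
  refine Summable.of_norm_bounded (hasSum_measure_unsuccessfulZero (b := b) (β := β)).summable
    fun k => ?_
  rw [norm_mul, norm_pow, Complex.norm_real, Real.norm_of_nonneg (unsuccessfulProb_nonneg k)]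
  exact mul_le_of_le_one_left measureReal_nonneg (pow_le_one₀ (norm_nonneg t) ht)

/-- A nonnegative sequence that tends to `0`, and whose increments `v` satisfy
`∑ |v k| R ^ k < ∞` for some `R > 1`, satisfies `∑ u k R ^ k < ∞`. -/
lemma summable_mul_pow_of_increments {u : ℕ → ℝ} (hu0 : ∀ k, 0 ≤ u k)
    (hu : Tendsto u atTop (𝓝 0)) {R : ℝ} (hR : 1 < R)
    (hv : Summable fun k => |u (k + 1) - u k| * R ^ (k + 1)) : Summable fun k => u k * R ^ k := by
  set C := ∑' k, |u (k + 1) - u k| * R ^ (k + 1) with hC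
  have hR0 : 0 < R := by linarith
  have hpart : ∀ S : Finset ℕ, ∑ k ∈ S, |u (k + 1) - u k| * R ^ (k + 1) ≤ C := fun S =>
    hv.sum_le_tsum S fun k _ => by positivity
  -- Write `u N` as minus the sum of all later increments; their weights are at least `R ^ N`.
  have hbound : ∀ N, u N * R ^ N ≤ C := by
    intro N
    have h1 : ∀ M ≥ N, (u N - u M) * R ^ N ≤ C := by
      intro M hM
      refine le_trans ?_ (hpart (Finset.Ico N M))
      rw [← neg_sub (u M), ← Finset.sum_Ico_sub u hM, ← Finset.sum_neg_distrib, Finset.sum_mul]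
      refine Finset.sum_le_sum fun k hk => ?_
      have hk' := (Finset.mem_Ico.mp hk).1
      have h2 : -(u (k + 1) - u k) ≤ |u (k + 1) - u k| := neg_le_abs _
      have h3 : R ^ N ≤ R ^ (k + 1) := pow_le_pow_right₀ hR.le (by omega)
      exact mul_le_mul h2 h3 (by positivity) (abs_nonneg _)
    have h2 : Tendsto (fun M => (u N - u M) * R ^ N) atTop (𝓝 ((u N - 0) * R ^ N)) :=
      (tendsto_const_nhds.sub hu).mul_const _
    rw [sub_zero] at h2
    exact le_of_tendsto h2 (eventually_atTop.mpr ⟨N, h1⟩)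
  refine summable_of_sum_range_le (c := (C + C) / (R - 1))
    (fun k => mul_nonneg (hu0 k) (by positivity))
    fun N => ?_
  rw [le_div_iff₀ (by linarith)]
  -- Summation by parts: boundary terms minus the weighted increments, bounded uniformly in `N`.
  have h1 : (∑ k ∈ Finset.range N, u k * R ^ k) * (R - 1)
      = (u N * R ^ N - u 0) - ∑ k ∈ Finset.range N, (u (k + 1) - u k) * R ^ (k + 1) := by
    have h2 := Finset.sum_range_sub (fun k => u k * R ^ k) N
    simp only [pow_zero, mul_one] at h2
    rw [← h2, ← Finset.sum_sub_distrib, Finset.sum_mul]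
    refine Finset.sum_congr rfl fun k _ => ?_
    ring
  have h3 : -∑ k ∈ Finset.range N, (u (k + 1) - u k) * R ^ (k + 1) ≤ C := by
    rw [← Finset.sum_neg_distrib]
    refine le_trans (Finset.sum_le_sum fun k _ => ?_) (hpart (Finset.range N))
    rw [← neg_mul]
    gcongr
    exact neg_le_abs _
  rw [h1]
  linarith [hbound N, hu0 0]

/-- Near `s = 0` the product equals `(1 - s^b) ψ_U(s^b)`, a series in `s^b` with the increments as
coefficients; power series coefficients are unique. -/
lemma hasAbsSeries_uniqueness (hb : 1 ≤ b) (hβ : 0 < β) (hβ1 : β < 1) (hρ1 : 1 < ρ) {c : ℕ → ℂ}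
    (hc : HasAbsSeries ρ
      (fun s => unsuccessfulProb b β 0 * ∏ ℓ ∈ Finset.range b, (1 - zetaRoot b ℓ s β)) c) :
    c = Function.extend (fun k => b * k) (fun k => (probIncrement b β k : ℂ)) 0 := by
  have hinj : Function.Injective fun k => b * k := mul_right_injective₀ (by omega)
  refine eq_of_hasSum_pow (f := fun s => unsuccessfulProb b β 0 *
    ∏ ℓ ∈ Finset.range b, (1 - zetaRoot b ℓ s β)) ?_ ?_
  · filter_upwards [Metric.ball_mem_nhds (0 : ℂ) (zero_lt_one' ℝ)] with s hs
    exact hc.2 s ((by simpa using hs : ‖s‖ < 1).le.trans hρ1.le)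
  · filter_upwards [Metric.ball_mem_nhds (0 : ℂ) (zero_lt_one' ℝ)] with s hs
    have hs' : ‖s‖ < 1 := by simpa using hs
    have ht : ‖s ^ b‖ ≤ 1 := by
      rw [norm_pow]
      exact pow_le_one₀ (norm_nonneg s) hs'.le
    have h1 := hasSum_probIncrement (summable_pow_mul_unsuccessfulProb (b := b) (β := β) ht).hasSum
    have h2 : (1 - s ^ b) * ∑' k, (s ^ b) ^ k * (unsuccessfulProb b β k : ℂ)
        = unsuccessfulProb b β 0 * ∏ ℓ ∈ Finset.range b, (1 - zetaRoot b ℓ s β) := by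
      -- At `s = 0` all the roots coincide, so the kernel identity is checked by hand.
      rcases eq_or_ne s 0 with rfl | hs0
      · have hz : ∀ ℓ, zetaRoot b ℓ 0 β = 0 := fun ℓ => by simp [zetaRoot, treeFun]
        rw [zero_pow (by omega), tsum_eq_single 0 fun k hk => by simp [hk]]
        simp [hz]
      · exact unsuccessfulGF_eq_of_norm_lt hb hβ hβ1 hs' hs0
    rw [h2] at h1
    rw [← hinj.hasSum_iff]
    · convert! h1 using 1
      funext k
      simp only [Function.comp_apply]
      rw [hinj.extend_apply, pow_mul]
    · intro n hn
      rw [Function.extend_apply' _ _ _ (by simpa using hn)]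
      simp

/-- The generating function of `U_β` and its closed form, on the closed disc of radius `ρ ^ b`. -/
lemma unsuccessfulGF_extension (hb : 1 ≤ b) (hβ : 0 < β) (hβ1 : β < 1) (hρ1 : 1 < ρ)
    (hρ : β * Real.exp (-β) * ρ ≤ Real.exp (-1)) :
    (Summable fun k => unsuccessfulProb b β k * (ρ ^ b) ^ k) ∧
    ∀ s : ℂ, ‖s‖ ≤ ρ →
      (1 - s ^ b) * ∑' k, (s ^ b) ^ k * (unsuccessfulProb b β k : ℂ)
        = tZero b β * ∏ ℓ ∈ Finset.range b, (1 - zetaRoot b ℓ s β) := by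
  have hρ0 : 0 ≤ ρ := by linarith
  have hinj : Function.Injective fun k => b * k := mul_right_injective₀ (by omega)
  obtain ⟨d, hd⟩ := HasAbsSeries.finsetProd hρ0 (Finset.range b)
    (fun ℓ s => 1 - zetaRoot b ℓ s β) fun ℓ _ => by
      obtain ⟨e, he⟩ := exists_hasAbsSeries_zetaRoot hb hβ hρ0 hρ ℓ
      exact ⟨_, (HasAbsSeries.const 1).sub hρ0 he⟩
  obtain ⟨c, hc⟩ := (HasAbsSeries.const (unsuccessfulProb b β 0 : ℂ)).mul hρ0 hd
  have hceq := hasAbsSeries_uniqueness hb hβ hβ1 hρ1 hc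
  have hcb : ∀ k, c (b * k) = probIncrement b β k := fun k => by
    rw [hceq, hinj.extend_apply]
  -- Absolute convergence of the product series at radius `ρ`, read along multiples of `b`. It
  -- includes the circle `|s| = ρ`, so no analytic continuation is needed.
  have hsum : Summable fun k => |probIncrement b β k| * (ρ ^ b) ^ k := by
    refine (hc.1.comp_injective hinj).congr fun k => ?_
    simp only [Function.comp_apply]
    rw [hcb, pow_mul, Complex.norm_real, Real.norm_eq_abs]
  have hR : 1 < ρ ^ b := one_lt_pow₀ hρ1 (by omega)
  have hu : Summable fun k => unsuccessfulProb b β k * (ρ ^ b) ^ k :=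
    summable_mul_pow_of_increments unsuccessfulProb_nonneg
      hasSum_measure_unsuccessfulZero.summable.tendsto_atTop_zero hR
      ((summable_nat_add_iff 1).mpr hsum)
  refine ⟨hu, fun s hs => ?_⟩
  have hs1 : Summable fun k => (s ^ b) ^ k * (unsuccessfulProb b β k : ℂ) := by
    refine Summable.of_norm_bounded hu fun k => ?_
    rw [norm_mul, norm_pow, norm_pow, Complex.norm_real,
      Real.norm_of_nonneg (unsuccessfulProb_nonneg k), mul_comm]
    have := unsuccessfulProb_nonneg (b := b) (β := β) k
    gcongr
  have h1 := hasSum_probIncrement hs1.hasSum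
  have h2 := hc.2 s hs
  rw [hceq, ← hinj.hasSum_iff] at h2
  · rw [← unsuccessfulProb_zero_eq hb hβ hβ1]
    refine h1.unique ?_
    convert! h2 using 1
    funext k
    simp only [Function.comp_apply]
    rw [hinj.extend_apply, pow_mul]
  · intro n hn
    rw [Function.extend_apply' _ _ _ (by simpa using hn)]
    simp

end extension

/-! ### The radius `R` and bounds uniform in the load -/

section radius

variable {b : ℕ} {α β : ℝ}

lemma one_lt_exp_div (hα0 : 0 < α) (hα1 : α < 1) : 1 < Real.exp (α - 1) / α := by
  rw [one_lt_div hα0]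
  have := Real.add_one_lt_exp (x := α - 1) (by linarith)
  linarith

/-- Equality holds at `β = α`, which is how `R` is chosen; smaller `β` follow since `x e^{-x}`
increases on `[0, 1]`. -/
lemma mul_exp_neg_mul_le (hβ : 0 ≤ β) (hβα : β ≤ α) (hα0 : 0 < α) (hα1 : α < 1) :
    β * Real.exp (-β) * (Real.exp (α - 1) / α) ≤ Real.exp (-1) := by
  have h1 : β * Real.exp (-β) ≤ α * Real.exp (-α) :=
    strictMonoOn_mul_exp_neg.monotoneOn ⟨hβ, by linarith⟩ ⟨hα0.le, hα1.le⟩ hβα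
  have h2 : 0 < Real.exp (α - 1) / α := by positivity
  calc _ ≤ α * Real.exp (-α) * (Real.exp (α - 1) / α) := by gcongr
    _ = Real.exp (-α) * Real.exp (α - 1) := by field_simp
    _ = Real.exp (-1) := by rw [← Real.exp_add]; ring_nf

lemma norm_cpow_le (hb : 1 ≤ b) (hα0 : 0 < α) {q : ℂ} (hq : ‖q‖ ≤ radius b α) :
    ‖q ^ (1 / (b : ℂ))‖ ≤ Real.exp (α - 1) / α := by
  have h : ‖q ^ (1 / (b : ℂ))‖ ^ b = ‖q‖ := by
    rw [← norm_pow, one_div, Complex.cpow_nat_inv_pow q (by omega)]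
  rw [radius, ← h] at hq
  exact le_of_pow_le_pow_left₀ (by omega) (by positivity) hq

lemma summable_unsuccessfulProb (hb : 1 ≤ b) (hβ : 0 < β) (hβα : β ≤ α) (hα1 : α < 1) :
    Summable fun k => unsuccessfulProb b β k * radius b α ^ k :=
  (unsuccessfulGF_extension hb hβ (hβα.trans_lt hα1)
    (one_lt_exp_div (hβ.trans_le hβα) hα1)
    (mul_exp_neg_mul_le hβ.le hβα (hβ.trans_le hβα) hα1)).1

lemma unsuccessfulGF_eq (hb : 1 ≤ b) (hβ : 0 < β) (hβα : β ≤ α) (hα1 : α < 1) {q : ℂ}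
    (hq : ‖q‖ ≤ radius b α) :
    (1 - q) * ∑' k, q ^ k * (unsuccessfulProb b β k : ℂ)
      = tZero b β * ∏ ℓ ∈ Finset.range b, (1 - zeta b ℓ q β) := by
  have h := (unsuccessfulGF_extension hb hβ (hβα.trans_lt hα1)
    (one_lt_exp_div (hβ.trans_le hβα) hα1)
    (mul_exp_neg_mul_le hβ.le hβα (hβ.trans_le hβα) hα1)).2 _
    (norm_cpow_le hb (hβ.trans_le hβα) hq)
  have hpow : (q ^ (1 / (b : ℂ))) ^ b = q := by
    rw [one_div, Complex.cpow_nat_inv_pow q (by omega)]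
  rw [hpow] at h
  exact h

lemma one_lt_radius (hb : 1 ≤ b) (hα0 : 0 < α) (hα1 : α < 1) : 1 < radius b α :=
  one_lt_pow₀ (one_lt_exp_div hα0 hα1) (by omega)

/-- A bound for `E R ^ U_β` that is uniform in `0 < β ≤ α`. -/
lemma tsum_unsuccessfulProb_le (hb : 1 ≤ b) (hβ : 0 < β) (hβα : β ≤ α) (hα1 : α < 1) :
    ∑' k, unsuccessfulProb b β k * radius b α ^ k
      ≤ (1 + Real.exp α / α) ^ b / (radius b α - 1) := by
  have hα0 : 0 < α := hβ.trans_le hβα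
  have hR := one_lt_radius hb hα0 hα1
  set R := radius b α with hRdef
  have hq : ‖(R : ℂ)‖ ≤ radius b α := by
    rw [Complex.norm_real, Real.norm_of_nonneg (by linarith)]
  -- At `q = R > 1` the series is nonnegative and `1 - q ≠ 0`, so the norm of the closed form
  -- controls it; only `|1 - ζ_ℓ|` remains to be bounded.
  have h := congrArg norm (unsuccessfulGF_eq hb hβ hβα hα1 hq)
  have hsum : ∑' k, (R : ℂ) ^ k * (unsuccessfulProb b β k : ℂ)
      = ((∑' k, unsuccessfulProb b β k * R ^ k : ℝ) : ℂ) := by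
    rw [Complex.ofReal_tsum]
    refine tsum_congr fun k => ?_
    push_cast
    ring
  have hnn : 0 ≤ ∑' k, unsuccessfulProb b β k * R ^ k :=
    tsum_nonneg fun k => mul_nonneg (unsuccessfulProb_nonneg k) (pow_nonneg (by linarith) k)
  have h1R : ‖(1 : ℂ) - R‖ = R - 1 := by
    rw [norm_sub_rev, ← Complex.ofReal_one, ← Complex.ofReal_sub, Complex.norm_real,
      Real.norm_of_nonneg (by linarith)]
  rw [hsum, norm_mul, h1R, Complex.norm_real, Real.norm_of_nonneg hnn, norm_mul,
    ← unsuccessfulProb_zero_eq hb hβ (hβα.trans_lt hα1), Complex.norm_real,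
    Real.norm_of_nonneg (unsuccessfulProb_nonneg 0), norm_prod] at h
  have hζ : ∀ ℓ, ‖1 - zeta b ℓ R β‖ ≤ 1 + Real.exp α / α := by
    intro ℓ
    refine (norm_sub_le _ _).trans ?_
    rw [norm_one]
    gcongr
    rw [zeta_eq_zetaRoot, zetaRoot, norm_div, Complex.norm_real, Real.norm_of_nonneg hβ.le]
    have hs := norm_cpow_le hb hα0 hq
    set s := (R : ℂ) ^ (1 / (b : ℂ))
    have harg : ‖rootOfUnity b ^ ℓ * β * Real.exp (-β) * s‖
        ≤ β * Real.exp (-β) * (Real.exp (α - 1) / α) := by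
      rw [norm_zetaRoot_arg hb hβ]
      gcongr
    have harg2 := harg.trans (mul_exp_neg_mul_le hβ.le hβα hα0 hα1)
    rw [div_le_iff₀ hβ]
    -- The linear bound for `T` supplies the factor `β` that cancels the denominator of `ζ_ℓ`.
    refine (norm_treeFun_le harg2).trans ((treeReal_le (norm_nonneg _) harg2).trans ?_)
    calc Real.exp 1 * ‖rootOfUnity b ^ ℓ * β * Real.exp (-β) * s‖
        ≤ Real.exp 1 * (β * Real.exp (-β) * (Real.exp (α - 1) / α)) := by gcongr
      _ = (Real.exp 1 * Real.exp (α - 1)) / α * β * Real.exp (-β) := by ring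
      _ = Real.exp α / α * β * Real.exp (-β) := by rw [← Real.exp_add]; ring_nf
      _ ≤ Real.exp α / α * β * 1 := by
          gcongr
          exact Real.exp_le_one_iff.mpr (by linarith)
      _ = _ := by ring
  rw [le_div_iff₀ (by linarith), mul_comm, h]
  refine (mul_le_of_le_one_left (by positivity) measureReal_le_one).trans ?_
  refine (Finset.prod_le_prod (fun _ _ => norm_nonneg _) fun ℓ _ => hζ ℓ).trans_eq ?_
  simp

end radius

/-! ### Uniform measures -/

lemma integral_uniformOn_univ {Ω E : Type*} [Fintype Ω] [Nonempty Ω] [MeasurableSpace Ω]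
    [MeasurableSingletonClass Ω] [NormedAddCommGroup E] [NormedSpace ℝ E] [CompleteSpace E]
    (f : Ω → E) :
    ∫ ω, f ω ∂(uniformOn (Set.univ : Set Ω)) = (Fintype.card Ω : ℝ)⁻¹ • ∑ ω, f ω := by
  have : IsProbabilityMeasure (uniformOn (Set.univ : Set Ω)) :=
    isProbabilityMeasure_uniformOn Set.finite_univ Set.univ_nonempty
  rw [integral_fintype Integrable.of_finite, Finset.smul_sum]
  refine Finset.sum_congr rfl fun ω _ => ?_
  rw [measureReal_def, uniformOn_univ, Measure.count_singleton]
  simp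

lemma measureReal_uniformOn_univ {Ω : Type*} [Fintype Ω] [Nonempty Ω] [MeasurableSpace Ω]
    [MeasurableSingletonClass Ω] (s : Set Ω) :
    (uniformOn (Set.univ : Set Ω)).real s
      = (Fintype.card Ω : ℝ)⁻¹ * ∑ ω, s.indicator (fun _ => (1 : ℝ)) ω := by
  rw [← integral_indicator_one s.toFinite.measurableSet, integral_uniformOn_univ, smul_eq_mul]
  rfl

/-- The uniform distribution of the hash addresses of `t` keys. -/
def addressMeasure (m t : ℕ) : Measure (Fin t → ZMod m) := uniformOn Set.univ

instance (m t : ℕ) [NeZero m] : IsProbabilityMeasure (addressMeasure m t) :=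
  isProbabilityMeasure_uniformOn Set.finite_univ Set.univ_nonempty

/-! ### Chernoff bounds and runs of full buckets in the cyclic table -/

section chernoff

variable {b m t : ℕ}

/-- Cut the window at `i - m`: each part has length at most `m` and meets a residue class at most
once. Lengths up to `2m` occur because concatenated windows can wrap around the table. -/
lemma card_residue_le_two {i : ℤ} {L : ℕ} (hL : L ≤ m + m) (a : ZMod m) :
    ((Finset.Ioc (i - L) i).filter fun k : ℤ => (k : ZMod m) = a).card ≤ 2 := by
  rw [← Finset.card_range 2]
  refine Finset.card_le_card_of_injOn (fun k : ℤ => if k ≤ i - m then 0 else 1)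
    (fun k _ => ?_) fun k hk k' hk' h => ?_
  · simp only [Finset.coe_range, Set.mem_Iio]
    split_ifs <;> omega
  · simp only [Finset.coe_filter, Finset.mem_Ioc, Set.mem_ofPred_eq] at hk hk'
    have hmod : ((k : ℤ) : ZMod m) = ((k' : ℤ) : ZMod m) := hk.2.trans hk'.2.symm
    rw [ZMod.intCast_eq_intCast_iff_dvd_sub] at hmod
    have habs : |k' - k| < (m : ℤ) := by
      rw [abs_lt]
      simp only at h
      split_ifs at h <;> omega
    have := Int.eq_zero_of_abs_lt_dvd hmod habs
    omega

lemma sum_periodicCount (g : Fin t → ZMod m) (S : Finset ℤ) :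
    ∑ k ∈ S, periodicCount g k
      = ∑ j, (S.filter fun k : ℤ => (k : ZMod m) = g j).card := by
  simp only [periodicCount, addressCount, Finset.card_filter]
  rw [Finset.sum_comm]
  simp only [eq_comm]

lemma exp_mul_le_of_le_two {s : ℝ} {w : ℕ} (hw : w ≤ 2) :
    Real.exp (s * w) ≤ 1 + w * ((Real.exp (2 * s) - 1) / 2) := by
  interval_cases w
  · simp
  · have : Real.exp (2 * s) = Real.exp s * Real.exp s := by rw [← Real.exp_add]; ring_nf
    rw [this]
    push_cast
    rw [mul_one]
    nlinarith [sq_nonneg (Real.exp s - 1)]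
  · push_cast
    rw [mul_comm s]
    linarith

/-- Each key contributes its multiplicity `w ≤ 2` in the window, and `e^{sw}` lies below its chord
on `[0, 2]`. Hence one key has exponential moment at most `exp (L c / m)`, and independence raises
this to the power `t`. -/
lemma addressMeasure_window_le [NeZero m] {s a : ℝ} (hs : 0 ≤ s) (ht : (t : ℝ) ≤ a * (b * m))
    (i : ℤ) {L : ℕ}
    (hL : L ≤ m + m) :
    (addressMeasure m t).real {g | b * L ≤ ∑ k ∈ Finset.Ioc (i - L) i, periodicCount g k}
      ≤ Real.exp (-(b * (s - a * ((Real.exp (2 * s) - 1) / 2)))) ^ L := by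
  classical
  set w : ZMod m → ℕ := fun a => ((Finset.Ioc (i - L) i).filter fun k : ℤ => (k : ZMod m) = a).card
    with hw
  set c := (Real.exp (2 * s) - 1) / 2 with hc
  have hc0 : 0 ≤ c := by
    have := Real.one_le_exp (x := 2 * s) (by linarith)
    rw [hc]; linarith
  have hm : (0 : ℝ) < m := by exact_mod_cast Nat.pos_of_neZero m
  have hsumw : ∑ a, w a = L := by
    have := Finset.card_eq_sum_card_fiberwise (f := fun k : ℤ => (k : ZMod m))
      (s := Finset.Ioc (i - L) i) (t := Finset.univ) (by simp)
    simpa [hw] using this.symm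
  have hsum : ∑ a, Real.exp (s * w a) ≤ m * Real.exp (L / m * c) := by
    calc ∑ a, Real.exp (s * w a) ≤ ∑ a, (1 + (w a : ℝ) * c) :=
          Finset.sum_le_sum fun a _ => exp_mul_le_of_le_two (card_residue_le_two hL a)
      _ = m + L * c := by
          rw [Finset.sum_add_distrib, ← Finset.sum_mul, ← hsumw]
          simp [ZMod.card]
      _ = m * (L / m * c + 1) := by field_simp; ring
      _ ≤ m * Real.exp (L / m * c) := by
          gcongr
          exact Real.add_one_le_exp _
  rw [addressMeasure, measureReal_uniformOn_univ, Fintype.card_pi_const, ZMod.card, Nat.cast_pow,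
    inv_mul_le_iff₀ (pow_pos hm t)]
  have hpt : ∀ g : Fin t → ZMod m,
      {g : Fin t → ZMod m | b * L ≤ ∑ k ∈ Finset.Ioc (i - L) i, periodicCount g k}.indicator
        (fun _ => (1 : ℝ)) g
      ≤ Real.exp (-(s * (b * L))) * ∏ j, Real.exp (s * w (g j)) := by
    intro g
    rw [← Real.exp_sum, ← Real.exp_add]
    by_cases h : b * L ≤ ∑ k ∈ Finset.Ioc (i - L) i, periodicCount g k
    · rw [Set.indicator_of_mem (by exact h), Real.one_le_exp_iff, ← Finset.mul_sum]
      rw [sum_periodicCount] at h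
      have h' : (b : ℝ) * L ≤ ∑ j, (w (g j) : ℝ) := by exact_mod_cast h
      nlinarith
    · rw [Set.indicator_of_notMem (by exact h)]
      exact (Real.exp_pos _).le
  refine (Finset.sum_le_sum fun g _ => hpt g).trans ?_
  rw [← Finset.mul_sum, ← Fintype.sum_pow fun a => Real.exp (s * w a)]
  calc Real.exp (-(s * (b * L))) * (∑ a, Real.exp (s * w a)) ^ t
      ≤ Real.exp (-(s * (b * L))) * (m * Real.exp (L / m * c)) ^ t := by
        gcongr
    _ = m ^ t * (Real.exp (-(s * (b * L)) + t * (L / m * c))) := by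
        rw [mul_pow, Real.exp_add, Real.exp_nat_mul]
        ring
    _ ≤ m ^ t * Real.exp (L * (-(b * (s - a * c)))) := by
        gcongr
        have : (t : ℝ) * (L / m * c) ≤ a * (b * m) * (L / m * c) := by gcongr
        have h2 : a * (b * m) * (L / m * c) = a * b * L * c := by field_simp
        linarith
    _ = _ := by rw [← Real.exp_nat_mul]

/-- A geometric bound for the windows in the cyclic table, uniform in `m` and `t ≤ a * b * m`. -/
lemma exists_addressMeasure_window_le (hb : 1 ≤ b) {a : ℝ} (ha0 : 0 ≤ a) (ha1 : a < 1) :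
    ∃ ρ : ℝ, 0 < ρ ∧ ρ < 1 ∧ ∀ (m t : ℕ) [NeZero m], (t : ℝ) ≤ a * (b * m) →
      ∀ (i : ℤ) (L : ℕ), L ≤ m + m →
      (addressMeasure m t).real {g | b * L ≤ ∑ k ∈ Finset.Ioc (i - L) i, periodicCount g k}
        ≤ ρ ^ L := by
  obtain ⟨s, hs, hc⟩ := exists_chernoff_exponent ha0 ha1
  refine ⟨Real.exp (-(b * (s - a * ((Real.exp (2 * s) - 1) / 2)))), Real.exp_pos _, ?_,
    fun m t _ ht i L hL => addressMeasure_window_le hs.le ht i hL⟩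
  rw [Real.exp_lt_one_iff]
  have : (0 : ℝ) < b := by exact_mod_cast hb
  nlinarith [mul_pos this hc]

/-- The probability that the buckets `0, …, k - 1` are full in a cyclic table with `t` keys. -/
def cyclicRunProb (b m t k : ℕ) : ℝ :=
  (addressMeasure m t).real {g | periodicCount g ∈ fullRun b k}

lemma cyclicRunProb_nonneg (k : ℕ) : 0 ≤ cyclicRunProb b m t k := measureReal_nonneg

lemma cyclicRunProb_le_one [NeZero m] (k : ℕ) : cyclicRunProb b m t k ≤ 1 := measureReal_le_one

lemma sum_Icc_pow_le {ρ : ℝ} (hρ0 : 0 < ρ) (hρ1 : ρ < 1) (k l : ℕ) :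
    ∑ L ∈ Finset.Icc k l, ρ ^ L ≤ ρ ^ k * (1 - ρ)⁻¹ := by
  rw [← tsum_geometric_of_lt_one hρ0.le hρ1, ← tsum_mul_left]
  simp_rw [← pow_add]
  have hs : Summable fun n => ρ ^ (k + n) := by
    simp_rw [pow_add]
    exact (summable_geometric_of_lt_one hρ0.le hρ1).mul_left _
  refine le_trans (le_of_eq ?_) (hs.sum_le_tsum (Finset.range (l + 1 - k)) fun _ _ => by positivity)
  rw [← Finset.sum_Ico_eq_sum_range]
  rfl

lemma cyclicRunProb_le [NeZero m] {ρ : ℝ} (hρ0 : 0 < ρ) (hρ1 : ρ < 1) (ht : t < b * m)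
    (h : ∀ (i : ℤ) (L : ℕ), L ≤ m + m →
      (addressMeasure m t).real {g | b * L ≤ ∑ k ∈ Finset.Ioc (i - L) i, periodicCount g k}
        ≤ ρ ^ L) (k : ℕ) :
    cyclicRunProb b m t k ≤ ρ ^ k * (1 - ρ)⁻¹ := by
  have h1ρ : 0 < (1 - ρ)⁻¹ := by rw [inv_pos]; linarith
  -- A run longer than `m` is impossible because some bucket is not full. For `k ≤ m` the
  -- concatenated window has length at most `k + m ≤ 2m`, as the Chernoff bound requires.
  rcases Nat.lt_or_ge m k with hk | hk
  · have : {g : Fin t → ZMod m | periodicCount g ∈ fullRun b k} = ∅ := by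
      ext g
      simp only [Set.mem_ofPred_eq, Set.mem_empty_iff_false, iff_false]
      intro hg
      have h1 := (le_probe_occupancy_iff g ht k).mpr hg
      have h2 := probe_occupancy_lt g ht
      omega
    rw [cyclicRunProb, this, measureReal_empty]
    positivity
  · have hsub : {g : Fin t → ZMod m | periodicCount g ∈ fullRun b k} ⊆
        ⋃ L ∈ Finset.Icc k (k + m), {g | b * L ≤
          ∑ j ∈ Finset.Ioc ((k : ℤ) - 1 - L) ((k : ℤ) - 1), periodicCount g j} := by
      intro g hg
      obtain ⟨L, h1, h2, h3⟩ := exists_long_window (M := m) (k := k)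
        fun l hl => Full.exists_le ht (hg l hl)
      exact Set.mem_biUnion (Finset.mem_coe.mpr (Finset.mem_Icc.mpr ⟨h1, h2⟩)) h3
    refine (measureReal_mono hsub (measure_ne_top _ _)).trans
      ((measureReal_biUnion_finset_le _ _).trans ?_)
    refine (Finset.sum_le_sum fun L hL => h _ L ?_).trans (sum_Icc_pow_le hρ0 hρ1 k (k + m))
    have := (Finset.mem_Icc.mp hL).2
    omega

/-- The event that the buckets `0, …, k - 1` are seen to be full from windows of length at most
`N`. -/
def truncRun (b k N : ℕ) : Set (ℤ → ℕ) :=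
  {x | ∀ l < k, ∃ L : ℕ, 1 ≤ L ∧ L ≤ N ∧ b * L ≤ ∑ j ∈ Finset.Ioc ((l : ℤ) - L) l, x j}

lemma truncRun_subset (k N : ℕ) : truncRun b k N ⊆ fullRun b k := fun _ hx l hl =>
  let ⟨L, h1, _, h3⟩ := hx l hl
  ⟨L, h1, h3⟩

lemma truncRun_mono (k : ℕ) : Monotone (truncRun b k) := fun _ _ hN _ hx l hl =>
  let ⟨L, h1, h2, h3⟩ := hx l hl
  ⟨L, h1, h2.trans hN, h3⟩

lemma iUnion_truncRun (k : ℕ) : ⋃ N, truncRun b k N = fullRun b k := by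
  refine Set.Subset.antisymm (Set.iUnion_subset fun N => truncRun_subset k N) fun x hx => ?_
  have hx' : ∀ l : ℕ, ∃ L : ℕ, l < k → 1 ≤ L ∧ b * L ≤ ∑ j ∈ Finset.Ioc ((l : ℤ) - L) l, x j := by
    intro l
    by_cases hl : l < k
    · obtain ⟨L, hL⟩ := hx l hl
      exact ⟨L, fun _ => hL⟩
    · exact ⟨0, fun h => absurd h hl⟩
  choose F hF using hx'
  exact Set.mem_iUnion.mpr ⟨∑ l ∈ Finset.range k, F l, fun l hl => ⟨F l, (hF l hl).1,
    Finset.single_le_sum (fun _ _ => Nat.zero_le _) (Finset.mem_range.mpr hl), (hF l hl).2⟩⟩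

/-- If truncation at `N` misses a run, one of its `k` buckets ends a full window of length between
`N + 1` and `m`. The resulting error does not depend on `m` or `t`. -/
lemma cyclicRunProb_sub_le [NeZero m] {ρ : ℝ} (hρ0 : 0 < ρ) (hρ1 : ρ < 1) (ht : t < b * m)
    (h : ∀ (i : ℤ) (L : ℕ), L ≤ m + m →
      (addressMeasure m t).real {g | b * L ≤ ∑ k ∈ Finset.Ioc (i - L) i, periodicCount g k}
        ≤ ρ ^ L) (k N : ℕ) :
    cyclicRunProb b m t k ≤ (addressMeasure m t).real {g | periodicCount g ∈ truncRun b k N}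
      + k * (ρ ^ (N + 1) * (1 - ρ)⁻¹) := by
  have hsub : {g : Fin t → ZMod m | periodicCount g ∈ fullRun b k} ⊆
      {g | periodicCount g ∈ truncRun b k N} ∪
      ⋃ l ∈ Finset.range k, ⋃ L ∈ Finset.Icc (N + 1) m, {g | b * L ≤
          ∑ j ∈ Finset.Ioc ((l : ℤ) - L) l, periodicCount g j} := by
    intro g hg
    by_cases hN : periodicCount g ∈ truncRun b k N
    · exact Or.inl hN
    right
    simp only [truncRun, Set.mem_ofPred_eq, not_forall] at hN
    obtain ⟨l, hl, hN⟩ := hN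
    obtain ⟨L, h1, h2, h3⟩ := Full.exists_le ht (hg l hl)
    have h4 : N + 1 ≤ L := by
      by_contra hlt
      exact hN ⟨L, h1, by omega, h3⟩
    exact Set.mem_biUnion (Finset.mem_coe.mpr (Finset.mem_range.mpr hl))
      (Set.mem_biUnion (Finset.mem_coe.mpr (Finset.mem_Icc.mpr ⟨h4, h2⟩)) h3)
  refine (measureReal_mono hsub (measure_ne_top _ _)).trans ((measureReal_union_le _ _).trans ?_)
  gcongr
  refine (measureReal_biUnion_finset_le _ _).trans ?_
  refine (Finset.sum_le_card_nsmul _ _ (ρ ^ (N + 1) * (1 - ρ)⁻¹) fun l _ => ?_).trans_eq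
    (by simp)
  refine (measureReal_biUnion_finset_le _ _).trans ?_
  refine (Finset.sum_le_sum fun L hL => h _ L ?_).trans (sum_Icc_pow_le hρ0 hρ1 (N + 1) m)
  have := (Finset.mem_Icc.mp hL).2
  omega

end chernoff

/-! ### The law of the numbers of keys in a window -/

lemma addressCount_cons {m t : ℕ} (a : ZMod m) (g : Fin t → ZMod m) (c : ZMod m) :
    addressCount (Fin.cons a g : Fin (t + 1) → ZMod m) c
      = (if a = c then 1 else 0) + addressCount g c := by
  simp only [addressCount, Finset.card_filter]
  simp only [Fin.sum_univ_succ, Fin.cons_zero, Fin.cons_succ]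

section multinomial

variable {m : ℕ} {ι : Type*} [Fintype ι] [DecidableEq ι]

/-- The number of hash address vectors for which bucket `v i` is the address of `x i` keys. -/
def windowCard (v : ι → ZMod m) [NeZero m] (t : ℕ) (x : ι → ℕ) : ℕ :=
  ∑ g : Fin t → ZMod m, if ∀ i, addressCount g (v i) = x i then 1 else 0

/-- Condition on the first key: its address avoids all the buckets `v i`, or it is one of them and
lowers the required count there by one. -/
lemma windowCard_succ [NeZero m] {v : ι → ZMod m} (hv : Function.Injective v) (t : ℕ) (x : ι → ℕ) :
    windowCard v (t + 1) x = (m - Fintype.card ι) * windowCard v t x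
      + ∑ i, if x i = 0 then 0 else windowCard v t (Function.update x i (x i - 1)) := by
  have h1 : windowCard v (t + 1) x = ∑ a : ZMod m, ∑ g : Fin t → ZMod m,
      if ∀ i, (if a = v i then 1 else 0) + addressCount g (v i) = x i then 1 else 0 := by
    rw [windowCard, ← (Fin.consEquiv fun _ => ZMod m).sum_comp, Fintype.sum_prod_type]
    refine Finset.sum_congr rfl fun a _ => Finset.sum_congr rfl fun g _ => ?_
    change (if ∀ i, addressCount (Fin.cons a g : Fin (t + 1) → ZMod m) (v i) = x i
      then 1 else 0) = _
    simp only [addressCount_cons]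
  rw [h1, ← Finset.sum_add_sum_compl (Finset.univ.image v), add_comm]
  congr 1
  · have h2 : ∀ a ∈ (Finset.univ.image v)ᶜ, (∑ g : Fin t → ZMod m,
        if ∀ i, (if a = v i then 1 else 0) + addressCount g (v i) = x i then 1 else 0)
        = windowCard v t x := by
      intro a ha
      have hne : ∀ i, a ≠ v i := by
        rintro i rfl
        simp at ha
      simp only [hne, if_false, zero_add]
      rfl
    rw [Finset.sum_congr rfl h2, Finset.sum_const, Finset.card_compl,
      Finset.card_image_of_injective _ hv, ZMod.card, Finset.card_univ, smul_eq_mul]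
  · rw [Finset.sum_image fun i _ j _ h => hv h]
    refine Finset.sum_congr rfl fun i _ => ?_
    simp only [hv.eq_iff]
    split_ifs with hx
    · refine Finset.sum_eq_zero fun g _ => if_neg fun h => ?_
      have := h i
      simp [hx] at this
    · rw [windowCard]
      refine Finset.sum_congr rfl fun g _ => ?_
      congr 1
      refine propext (forall_congr' fun j => ?_)
      by_cases hij : i = j
      · subst hij
        simp only [if_true, Function.update_self]
        omega
      · rw [if_neg hij, zero_add, Function.update_of_ne (Ne.symm hij)]

lemma descFactorial_succ_eq (t s : ℕ) :
    (t + 1).descFactorial (s + 1) = t.descFactorial (s + 1) + (s + 1) * t.descFactorial s := by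
  rw [Nat.succ_descFactorial_succ, Nat.descFactorial_succ, ← add_mul]
  rcases Nat.lt_or_ge t s with h | h
  · rw [Nat.descFactorial_of_lt h]
    simp
  · congr 1
    omega

/-- The multinomial count, multiplied by the factorials to stay in `ℕ`. When there are fewer than `∑
i, x i` keys, `descFactorial` vanishes and the truncated exponent is harmless. -/
lemma windowCard_mul_factorial [NeZero m] {v : ι → ZMod m} (hv : Function.Injective v) (t : ℕ)
    (x : ι → ℕ) :
    windowCard v t x * ∏ i, (x i).factorial
      = t.descFactorial (∑ i, x i) * (m - Fintype.card ι) ^ (t - ∑ i, x i) := by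
  induction t generalizing x with
  | zero =>
    by_cases hx : ∀ i, x i = 0
    · have : x = 0 := funext hx
      subst this
      simp [windowCard, addressCount]
    · have h0 : windowCard v 0 x = 0 := by
        refine Finset.sum_eq_zero fun g _ => if_neg fun h => hx fun i => ?_
        rw [← h i]
        simp [addressCount]
      have hs : 0 < ∑ i, x i := by
        push Not at hx
        obtain ⟨i, hi⟩ := hx
        exact (Nat.pos_of_ne_zero hi).trans_le
          (Finset.single_le_sum (fun _ _ => Nat.zero_le _) (Finset.mem_univ i))
      rw [h0, Nat.descFactorial_of_lt hs]
      simp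
  | succ t ih =>
    set K := m - Fintype.card ι
    rw [windowCard_succ hv, add_mul, Finset.sum_mul, mul_assoc, ih]
    have hterm : ∀ i, (if x i = 0 then 0 else windowCard v t (Function.update x i (x i - 1)))
          * ∏ j, (x j).factorial
        = x i * (t.descFactorial (∑ j, x j - 1) * K ^ (t - (∑ j, x j - 1))) := by
      intro i
      split_ifs with hx
      · simp [hx]
      · have hsum : ∑ j, Function.update x i (x i - 1) j = ∑ j, x j - 1 := by
          have h1 := Finset.sum_update_of_mem (Finset.mem_univ i) x (x i - 1)
          have h2 := Finset.add_sum_erase Finset.univ x (Finset.mem_univ i)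
          rw [← Finset.erase_eq] at h1
          omega
        have hprod : ∏ j, (x j).factorial
            = x i * ∏ j, (Function.update x i (x i - 1) j).factorial := by
          rw [← Finset.mul_prod_erase Finset.univ _ (Finset.mem_univ i),
            ← Finset.mul_prod_erase Finset.univ
              (fun j => (Function.update x i (x i - 1) j).factorial) (Finset.mem_univ i),
            ← mul_assoc, Function.update_self, Nat.mul_factorial_pred hx]
          congr 1
          refine Finset.prod_congr rfl fun j hj => ?_
          rw [Function.update_of_ne (Finset.ne_of_mem_erase hj)]
        rw [hprod, mul_left_comm, ih, hsum]
    rw [Finset.sum_congr rfl fun i _ => hterm i, ← Finset.sum_mul]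
    generalize ∑ j, x j = s
    cases s with
    | zero =>
      simp only [zero_mul, add_zero, Nat.descFactorial_zero, one_mul,
        Nat.sub_zero, pow_succ']
      rfl
    | succ s =>
      rw [descFactorial_succ_eq, Nat.add_sub_cancel, add_mul]
      rcases Nat.lt_or_ge t (s + 1) with h | h
      · rw [Nat.descFactorial_of_lt h, Nat.add_sub_add_right]
        ring
      · obtain ⟨r, rfl⟩ := Nat.exists_eq_add_of_le h
        rw [show s + 1 + r - (s + 1) = r by omega, show s + 1 + r - s = r + 1 by omega,
          show s + 1 + r + 1 - (s + 1) = r + 1 by omega]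
        ring

lemma measureReal_window_eq [NeZero m] {v : ι → ZMod m} (hv : Function.Injective v) (t : ℕ)
    (x : ι → ℕ) :
    (addressMeasure m t).real {g | ∀ i, addressCount g (v i) = x i}
      = t.descFactorial (∑ i, x i) * ((m - Fintype.card ι : ℕ) : ℝ) ^ (t - ∑ i, x i) / m ^ t
        / ∏ i, ((x i).factorial : ℝ) := by
  have hprod : ∏ i, ((x i).factorial : ℝ) ≠ 0 :=
    Finset.prod_ne_zero_iff.mpr fun i _ => by exact_mod_cast Nat.factorial_ne_zero _
  have hm : (m : ℝ) ≠ 0 := by exact_mod_cast NeZero.ne m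
  have h := windowCard_mul_factorial hv t x
  have h' : (windowCard v t x : ℝ) * ∏ i, ((x i).factorial : ℝ)
      = t.descFactorial (∑ i, x i) * ((m - Fintype.card ι : ℕ) : ℝ) ^ (t - ∑ i, x i) := by
    exact_mod_cast h
  rw [addressMeasure, measureReal_uniformOn_univ, Fintype.card_pi_const, ZMod.card, Nat.cast_pow,
    ← h']
  have hcard : ∑ g : Fin t → ZMod m,
      {g : Fin t → ZMod m | ∀ i, addressCount g (v i) = x i}.indicator (fun _ => (1 : ℝ)) g
      = windowCard v t x := by
    rw [windowCard]
    push_cast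
    refine Finset.sum_congr rfl fun g _ => ?_
    simp only [Set.indicator_apply, Set.mem_ofPred_eq]
  rw [hcard]
  field_simp

end multinomial

/-! ### Asymptotics of the multinomial weights -/

section limits

variable {m t : ℕ → ℕ} {lam : ℝ}

lemma tendsto_descFactorial_div (hm : Tendsto m atTop atTop)
    (ht : Tendsto (fun n => (t n : ℝ) / m n) atTop (𝓝 lam)) (s : ℕ) :
    Tendsto (fun n => ((t n).descFactorial s : ℝ) / (m n : ℝ) ^ s) atTop (𝓝 (lam ^ s)) := by
  induction s with
  | zero => simp
  | succ s ih =>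
    have hm' : Tendsto (fun n => (m n : ℝ)) atTop atTop := tendsto_natCast_atTop_atTop.comp hm
    have h0 : Tendsto (fun n => ((t n - s : ℕ) : ℝ) / m n) atTop (𝓝 lam) := by
      have hs : Tendsto (fun n => (t n : ℝ) / m n - s / m n) atTop (𝓝 lam) := by
        simpa using ht.sub (hm'.const_div_atTop (s : ℝ))
      refine tendsto_of_tendsto_of_tendsto_of_le_of_le hs ht (fun n => ?_) fun n => ?_
      · change (t n : ℝ) / m n - s / m n ≤ ((t n - s : ℕ) : ℝ) / m n
        rw [← sub_div]
        gcongr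
        rw [sub_le_iff_le_add]
        exact_mod_cast (by omega : t n ≤ t n - s + s)
      · change ((t n - s : ℕ) : ℝ) / m n ≤ (t n : ℝ) / m n
        gcongr
        omega
    rw [pow_succ']
    refine (h0.mul ih).congr fun n => ?_
    rw [Nat.descFactorial_succ, Nat.cast_mul, pow_succ', mul_div_mul_comm]

lemma tendsto_one_sub_div_pow (hm : Tendsto m atTop atTop)
    (ht : Tendsto (fun n => (t n : ℝ) / m n) atTop (𝓝 lam)) (w : ℝ) :
    Tendsto (fun n => (1 - w / (m n : ℝ)) ^ t n) atTop (𝓝 (Real.exp (-(lam * w)))) := by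
  have hm' : Tendsto (fun n => (m n : ℝ)) atTop atTop := tendsto_natCast_atTop_atTop.comp hm
  have h1 := (Real.tendsto_mul_log_one_add_div_atTop (-w)).comp hm'
  have h2 := (Real.continuous_exp.tendsto _).comp (ht.mul h1)
  rw [mul_neg] at h2
  refine h2.congr' ?_
  filter_upwards [hm'.eventually_gt_atTop (max w 0)] with n hn
  have hn0 : (0 : ℝ) < m n := (le_max_right w 0).trans_lt hn
  have hnw : w < m n := (le_max_left w 0).trans_lt hn
  have hpos : 0 < 1 - w / m n := by
    rw [sub_pos, div_lt_one hn0]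
    exact hnw
  simp only [Function.comp_apply]
  rw [← Real.rpow_natCast, Real.rpow_def_of_pos hpos, neg_div, ← sub_eq_add_neg]
  congr 1
  field_simp

lemma tendsto_multinomial_weight [∀ n, NeZero (m n)] (hm : Tendsto m atTop atTop)
    (ht : Tendsto (fun n => (t n : ℝ) / m n) atTop (𝓝 lam)) (s w : ℕ) :
    Tendsto (fun n => ((t n).descFactorial s : ℝ) * ((m n - w : ℕ) : ℝ) ^ (t n - s)
        / (m n : ℝ) ^ t n) atTop (𝓝 (lam ^ s * Real.exp (-(lam * w)))) := by
  have hm' : Tendsto (fun n => (m n : ℝ)) atTop atTop := tendsto_natCast_atTop_atTop.comp hm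
  have h1 : Tendsto (fun n => (1 - (w : ℝ) / m n) ^ s) atTop (𝓝 1) := by
    have : Tendsto (fun n => (1 - (w : ℝ) / m n)) atTop (𝓝 (1 - 0)) :=
      tendsto_const_nhds.sub (hm'.const_div_atTop (w : ℝ))
    simpa using this.pow s
  have h2 := ((tendsto_descFactorial_div hm ht s).mul (tendsto_one_sub_div_pow hm ht w)).div h1
    one_ne_zero
  rw [div_one] at h2
  refine h2.congr' ?_
  filter_upwards [hm.eventually_gt_atTop w] with n hn
  simp only [Pi.div_apply]
  have hn0 : (0 : ℝ) < m n := by exact_mod_cast (Nat.zero_le w).trans_lt hn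
  have hnw : (0 : ℝ) < m n - w := by
    rw [sub_pos]
    exact_mod_cast hn
  rcases Nat.lt_or_ge (t n) s with hts | hts
  · simp [Nat.descFactorial_of_lt hts]
  · obtain ⟨r, hr⟩ := Nat.exists_eq_add_of_le hts
    rw [Nat.cast_sub hn.le, hr, Nat.add_sub_cancel_left,
      show (1 : ℝ) - w / m n = (m n - w) / m n by field_simp]
    simp only [div_pow, pow_add]
    field_simp

end limits

/-! ### Convergence of discrete laws -/

section scheffe

variable {ι : Type*} [MeasurableSpace ι] [Countable ι] [MeasurableSingletonClass ι]

lemma hasSum_measureReal_mem {Ω : Type*} [MeasurableSpace Ω] (μ : Measure Ω) [IsFiniteMeasure μ]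
    {X : Ω → ι} (hX : Measurable X) (A : Set ι) :
    HasSum (fun y => μ.real {ω | X ω = y} * A.indicator 1 y) (μ.real {ω | X ω ∈ A}) := by
  have hA : MeasurableSet A := A.to_countable.measurableSet
  have h1 := hasSum_integral_comp μ hX (f := A.indicator (1 : ι → ℝ))
    (((integrable_const (1 : ℝ)).indicator (hX hA)).congr (ae_of_all _ fun ω => rfl))
  convert! h1 using 1
  change μ.real (X ⁻¹' A) = _
  rw [← integral_indicator_one (hX hA)]
  rfl

lemma hasSum_measureReal_eq {Ω : Type*} [MeasurableSpace Ω] (μ : Measure Ω)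
    [IsProbabilityMeasure μ] {X : Ω → ι} (hX : Measurable X) :
    HasSum (fun y => μ.real {ω | X ω = y}) 1 := by
  simpa using hasSum_measureReal_mem μ hX Set.univ

/-- **Scheffé's lemma** for discrete random variables: if the point probabilities converge, then the
probabilities of all events converge. -/
lemma tendsto_measureReal_of_forall_singleton {Ω' : Type*} {Ω : ℕ → Type*}
    [∀ n, MeasurableSpace (Ω n)] [MeasurableSpace Ω']
    {μ : ∀ n, Measure (Ω n)} [∀ n, IsProbabilityMeasure (μ n)] {μ' : Measure Ω'}
    [IsProbabilityMeasure μ'] {X : ∀ n, Ω n → ι} {X' : Ω' → ι} (hX : ∀ n, Measurable (X n))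
    (hX' : Measurable X')
    (h : ∀ y, Tendsto (fun n => (μ n).real {ω | X n ω = y}) atTop (𝓝 (μ'.real {ω | X' ω = y})))
    (A : Set ι) :
    Tendsto (fun n => (μ n).real {ω | X n ω ∈ A}) atTop (𝓝 (μ'.real {ω | X' ω ∈ A})) := by
  set p : ℕ → ι → ℝ := fun n y => (μ n).real {ω | X n ω = y} with hp_def
  set q : ι → ℝ := fun y => μ'.real {ω | X' ω = y} with hq_def
  have hp : ∀ n, HasSum (p n) 1 := fun n => hasSum_measureReal_eq (μ n) (hX n)
  have hq : HasSum q 1 := hasSum_measureReal_eq μ' hX'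
  -- Only the positive part of `q - p n` has an obvious dominating function, namely `q`. As both
  -- masses are `1`, the total variation sum is twice its sum.
  have hneg : Tendsto (fun n => ∑' y, max (q y - p n y) 0) atTop (𝓝 (∑' _ : ι, (0 : ℝ))) := by
    refine tendsto_tsum_of_dominated_convergence (bound := q) hq.summable (fun y => ?_)
      (Eventually.of_forall fun n y => ?_)
    · have := ((tendsto_const_nhds (x := q y)).sub (h y)).max (tendsto_const_nhds (x := (0 : ℝ)))
      rwa [show max (q y - μ'.real {ω | X' ω = y}) 0 = 0 by simp [hq_def]] at this
    · rw [Real.norm_of_nonneg (le_max_right _ _)]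
      exact max_le (sub_le_self _ measureReal_nonneg) measureReal_nonneg
  rw [tsum_zero] at hneg
  have hsummax : ∀ n, Summable fun y => max (q y - p n y) 0 := fun n =>
    Summable.of_nonneg_of_le (fun _ => le_max_right _ _)
      (fun y => max_le (sub_le_self _ measureReal_nonneg) measureReal_nonneg) hq.summable
  have habs : ∀ n, HasSum (fun y => |p n y - q y|) (2 * ∑' y, max (q y - p n y) 0) := by
    intro n
    have h1 := ((hp n).sub hq).add ((hsummax n).hasSum.mul_left 2)
    convert! h1 using 1
    · funext y
      rcases le_total (p n y) (q y) with hle | hle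
      · rw [abs_of_nonpos (by linarith), max_eq_left (by linarith)]
        ring
      · rw [abs_of_nonneg (by linarith), max_eq_right (by linarith)]
        ring
    · ring
  rw [tendsto_iff_dist_tendsto_zero]
  refine squeeze_zero (fun _ => dist_nonneg) (fun n => ?_) (by simpa using hneg.const_mul 2)
  have h1 := (hasSum_measureReal_mem (μ n) (hX n) A).sub (hasSum_measureReal_mem μ' hX' A)
  have hle : ∀ y, ‖p n y * A.indicator 1 y - q y * A.indicator 1 y‖ ≤ |p n y - q y| := by
    intro y
    rw [← sub_mul, norm_mul, Real.norm_eq_abs]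
    refine mul_le_of_le_one_right (abs_nonneg _) ?_
    by_cases hy : y ∈ A <;> simp [hy]
  rw [Real.dist_eq, ← h1.tsum_eq, ← (habs n).tsum_eq]
  have hs := Summable.of_nonneg_of_le (fun _ => norm_nonneg _) hle (habs n).summable
  exact (norm_tsum_le_tsum_norm hs).trans (hs.tsum_le_tsum hle (habs n).summable)

end scheffe

/-! ### Convergence of the cyclic table to the infinite Poisson model -/

section convergence

variable {b : ℕ}

lemma measureReal_poissonTable_window {β : ℝ} (hβ : 0 ≤ β) (W : Finset ℤ) (y : W → ℕ) :
    (poissonTable b β).real {x | W.restrict x = y}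
      = (b * β) ^ (∑ i, y i) * Real.exp (-(b * β * Fintype.card W))
        / ∏ i, ((y i).factorial : ℝ) := by
  have h0 : (0 : ℝ) ≤ b * β := by positivity
  have hset : {x : ℤ → ℕ | W.restrict x = y} = (W.restrict : (ℤ → ℕ) → W → ℕ) ⁻¹' {y} := rfl
  rw [hset, measureReal_def, poissonTable,
    ← Measure.map_apply (by fun_prop) (measurableSet_singleton y),
    Measure.infinitePi_map_restrict, Measure.pi_singleton, ENNReal.toReal_prod]
  simp only [← measureReal_def, poissonMeasure_real_singleton, Real.coe_toNNReal _ h0]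
  rw [Finset.prod_div_distrib, Finset.prod_mul_distrib, Finset.prod_pow_eq_pow_sum,
    Finset.prod_const, ← Real.exp_nat_mul, Finset.card_univ, mul_comm (Real.exp _)]
  congr 3
  ring

lemma injective_intCast_window {m N k : ℕ} (h : N + k ≤ m) :
    Function.Injective fun i : Finset.Ioc (-(N : ℤ)) k => ((i : ℤ) : ZMod m) := by
  rintro ⟨i, hi⟩ ⟨j, hj⟩ hij
  rw [Finset.mem_Ioc] at hi hj
  have hdvd := (ZMod.intCast_eq_intCast_iff_dvd_sub i j m).mp hij
  have := Int.eq_zero_of_abs_lt_dvd hdvd (by rw [abs_lt]; omega)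
  exact Subtype.ext (by simp only; omega)

/-- The point probabilities converge by the explicit multinomial formula once `m ≥ N + k`, when the
window embeds into `ℤ / m`; Scheffé's lemma passes to arbitrary events. -/
lemma tendsto_measureReal_window {m t : ℕ → ℕ} [∀ n, NeZero (m n)] {β : ℝ} (hβ : 0 ≤ β)
    (hm : Tendsto m atTop atTop) (ht : Tendsto (fun n => (t n : ℝ) / m n) atTop (𝓝 (b * β)))
    (N k : ℕ) (A : Set (Finset.Ioc (-(N : ℤ)) k → ℕ)) :
    Tendsto (fun n => (addressMeasure (m n) (t n)).real
        {g | (Finset.Ioc (-(N : ℤ)) k).restrict (periodicCount g) ∈ A}) atTop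
      (𝓝 ((poissonTable b β).real {x | (Finset.Ioc (-(N : ℤ)) k).restrict x ∈ A})) := by
  refine tendsto_measureReal_of_forall_singleton (ι := Finset.Ioc (-(N : ℤ)) k → ℕ)
    (X := fun n (g : Fin (t n) → ZMod (m n)) =>
      (Finset.Ioc (-(N : ℤ)) k).restrict (periodicCount g))
    (X' := fun x : ℤ → ℕ => (Finset.Ioc (-(N : ℤ)) k).restrict x)
    (fun n => measurable_of_countable _) (by fun_prop) (fun y => ?_) A
  rw [measureReal_poissonTable_window hβ]
  refine ((tendsto_multinomial_weight hm ht (∑ i, y i)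
    (Fintype.card (Finset.Ioc (-(N : ℤ)) k))).div_const _).congr' ?_
  filter_upwards [hm.eventually_ge_atTop (N + k)] with n hn
  rw [← measureReal_window_eq (injective_intCast_window hn)]
  congr 1
  ext g
  exact funext_iff.symm

lemma truncRun_iff_of_eqOn {N k : ℕ} {x y : ℤ → ℕ}
    (h : ∀ i ∈ Finset.Ioc (-(N : ℤ)) k, x i = y i) (hx : x ∈ truncRun b k N) :
    y ∈ truncRun b k N := by
  intro l hl
  obtain ⟨L, h1, h2, h3⟩ := hx l hl
  refine ⟨L, h1, h2, h3.trans_eq (Finset.sum_congr rfl fun i hi => h i ?_)⟩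
  rw [Finset.mem_Ioc] at hi ⊢
  omega

lemma tendsto_measureReal_truncRun {m t : ℕ → ℕ} [∀ n, NeZero (m n)] {β : ℝ} (hβ : 0 ≤ β)
    (hm : Tendsto m atTop atTop) (ht : Tendsto (fun n => (t n : ℝ) / m n) atTop (𝓝 (b * β)))
    (N k : ℕ) :
    Tendsto (fun n => (addressMeasure (m n) (t n)).real {g | periodicCount g ∈ truncRun b k N})
      atTop (𝓝 ((poissonTable b β).real (truncRun b k N))) := by
  set W := Finset.Ioc (-(N : ℤ)) k
  have hA : ∀ x : ℤ → ℕ, W.restrict x ∈ W.restrict '' truncRun b k N ↔ x ∈ truncRun b k N := by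
    refine fun x => ⟨?_, fun hx => ⟨x, hx, rfl⟩⟩
    rintro ⟨y, hy, hyx⟩
    exact truncRun_iff_of_eqOn (fun i hi => congrFun hyx ⟨i, hi⟩) hy
  have h := tendsto_measureReal_window hβ hm ht N k (W.restrict '' truncRun b k N)
  simp only [W, hA] at h
  exact h

/-- The probability that the buckets `0, …, k - 1` are full converges. -/
theorem tendsto_cyclicRunProb (hb : 1 ≤ b) {m t : ℕ → ℕ} [∀ n, NeZero (m n)] {β : ℝ} (hβ : 0 < β)
    (hβ1 : β < 1) (hm : Tendsto m atTop atTop)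
    (ht : Tendsto (fun n => (t n : ℝ) / (b * m n)) atTop (𝓝 β)) (k : ℕ) :
    Tendsto (fun n => cyclicRunProb b (m n) (t n) k) atTop
      (𝓝 ((poissonTable b β).real (fullRun b k))) := by
  have hb0 : (0 : ℝ) < b := by exact_mod_cast hb
  have ht' : Tendsto (fun n => (t n : ℝ) / m n) atTop (𝓝 (b * β)) := by
    refine (ht.const_mul (b : ℝ)).congr fun n => ?_
    field_simp
  obtain ⟨a, hβa, ha1⟩ := exists_between hβ1
  obtain ⟨ρ, hρ0, hρ1, hρ⟩ := exists_addressMeasure_window_le hb (hβ.trans hβa).le ha1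
  have hev : ∀ᶠ n in atTop, (t n : ℝ) ≤ a * (b * m n) := by
    filter_upwards [ht.eventually_le_const hβa] with n hn
    have : (0 : ℝ) < m n := by exact_mod_cast NeZero.pos (m n)
    rwa [div_le_iff₀ (by positivity)] at hn
  have hlt : ∀ n, (t n : ℝ) ≤ a * (b * m n) → t n < b * m n := by
    intro n hn
    have : (0 : ℝ) < m n := by exact_mod_cast NeZero.pos (m n)
    have h2 : a * (b * m n) < 1 * (b * m n) := by gcongr
    rw [one_mul] at h2
    exact_mod_cast hn.trans_lt h2
  have htrunc : Tendsto (fun N => (poissonTable b β).real (truncRun b k N)) atTop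
      (𝓝 ((poissonTable b β).real (fullRun b k))) := by
    have h := tendsto_measure_iUnion_atTop (μ := poissonTable b β) (truncRun_mono (b := b) k)
    rw [iUnion_truncRun] at h
    exact (ENNReal.tendsto_toReal (measure_ne_top _ _)).comp h
  have herr : Tendsto (fun N : ℕ => (k : ℝ) * (ρ ^ (N + 1) * (1 - ρ)⁻¹)) atTop (𝓝 0) := by
    have := (((tendsto_pow_atTop_nhds_zero_of_lt_one hρ0.le hρ1).comp
      (tendsto_add_atTop_nat 1)).mul_const (1 - ρ)⁻¹).const_mul (k : ℝ)
    simpa using this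
  -- Lower bounds come from the truncated event, upper bounds from adding the error `herr`. In both
  -- cases `N` is fixed before the table grows.
  rw [tendsto_order]
  constructor
  · intro c hc
    obtain ⟨N, hN⟩ := (htrunc.eventually_const_lt hc).exists
    filter_upwards [(tendsto_measureReal_truncRun hβ.le hm ht' N k).eventually_const_lt hN]
      with n hn
    refine hn.trans_le (measureReal_mono (fun g hg => truncRun_subset k N hg) (measure_ne_top _ _))
  · intro c hc
    have h1 := htrunc.add herr
    rw [add_zero] at h1
    obtain ⟨N, hN⟩ := (h1.eventually_lt_const hc).exists
    filter_upwards [((tendsto_measureReal_truncRun hβ.le hm ht' N k).add_const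
      ((k : ℝ) * (ρ ^ (N + 1) * (1 - ρ)⁻¹))).eventually_lt_const hN, hev] with n hn hn'
    exact (cyclicRunProb_sub_le hρ0 hρ1 (hlt n hn') (hρ (m n) (t n) hn') k N).trans_lt hn

end convergence

/-! ### The law of the displacement in the exact model -/

section displacement

variable {b m : ℕ}

lemma sum_castAdd {X : Type*} [Fintype X] (s r : ℕ) (F : (Fin s → X) → ℝ) :
    ∑ g : Fin (s + r) → X, F (fun i => g (Fin.castAdd r i))
      = (Fintype.card X : ℝ) ^ r * ∑ g, F g := by
  rw [← (Fin.appendEquiv s r).sum_comp, Fintype.sum_prod_type]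
  simp only [Fin.appendEquiv, Equiv.coe_fn_mk, Fin.append_left]
  simp [Finset.mul_sum]

/-- Rotate the table so that the last key has address `0`. The earlier addresses remain uniform, and
the last address contributes a factor `m`. -/
lemma sum_displacement_last [NeZero m] (j : ℕ) (f : ℕ → ℝ) :
    ∑ g : Fin (j + 1) → ZMod m, f (displacement b g (Fin.last j))
      = m * ∑ g : Fin j → ZMod m, f (probe b (occupancy b g j) 0) := by
  rw [← (Fin.snocEquiv fun _ => ZMod m).sum_comp, Fintype.sum_prod_type]
  have h1 : ∀ a : ZMod m, ∑ g : Fin j → ZMod m,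
      f (displacement b (Fin.snocEquiv (fun _ => ZMod m) (a, g)) (Fin.last j))
      = ∑ g : Fin j → ZMod m, f (probe b (occupancy b g j) 0) := by
    intro a
    rw [← Equiv.sum_comp (Equiv.addRight (fun _ : Fin j => a))]
    refine Finset.sum_congr rfl fun g _ => ?_
    congr 1
    have h2 : occupancy b (Fin.snocEquiv (fun _ => ZMod m) (a, g + fun _ => a)) j
        = occupancy b (fun i => g i + a) j :=
      occupancy_congr _ _ j (by omega) le_rfl fun i hi => by
        simp only [Fin.snocEquiv, Equiv.coe_fn_mk]
        exact Fin.snoc_castSucc (α := fun _ => ZMod m) a (g + fun _ => a) ⟨i, hi⟩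
    have h3 : Fin.snocEquiv (fun _ => ZMod m) (a, g + fun _ => a) (Fin.last j) = a := by
      simp [Fin.snocEquiv]
    have h4 : occupancy b (fun i => g i + a) j = fun i => occupancy b g j (i - a) :=
      funext fun i => occupancy_translate g a j i
    have h5 := probe_translate (b := b) (occupancy b g j) 0 a
    rw [zero_add] at h5
    rw [displacement, Equiv.coe_addRight, h3, Fin.val_last, h2, h4, h5]
  simp only [h1]
  simp

lemma displacement_castAdd {s r : ℕ} (g : Fin (s + r) → ZMod m) (j : Fin s) :
    displacement b g (Fin.castAdd r j) = displacement b (fun i => g (Fin.castAdd r i)) j := by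
  rw [displacement, displacement, Fin.val_castAdd,
    occupancy_congr g (fun i => g (Fin.castAdd r i)) j (by omega) j.2.le fun i hi => rfl]

/-- Keys inserted after key `j` do not affect its displacement: each contributes only a factor `m`,
as does the address of key `j` itself. -/
lemma sum_displacement [NeZero m] {n : ℕ} (j : Fin n) (f : ℕ → ℝ) :
    ∑ g : Fin n → ZMod m, f (displacement b g j)
      = (m : ℝ) ^ (n - j) * ∑ g : Fin j → ZMod m, f (probe b (occupancy b g j) 0) := by
  obtain ⟨j, hj⟩ := j
  obtain ⟨r, rfl⟩ := Nat.exists_eq_add_of_le (Nat.succ_le_of_lt hj)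
  have h1 : ∀ g : Fin (j.succ + r) → ZMod m, displacement b g ⟨j, hj⟩
      = displacement b (fun i => g (Fin.castAdd r i)) (Fin.last j) :=
    fun g => displacement_castAdd g (Fin.last j)
  simp only [h1]
  have h2 := sum_castAdd (X := ZMod m) (j + 1) r fun g => f (displacement b g (Fin.last j))
  rw [sum_displacement_last, ZMod.card] at h2
  refine h2.trans ?_
  rw [show j.succ + r - j = r + 1 by omega, pow_succ, mul_assoc]

/-- The displacement of the `t`-th key is at least `k` iff the `k` buckets following its address
are full. -/
theorem measureReal_le_exactDisplacement [NeZero m] {n : ℕ} [NeZero n] (hn : n ≤ b * m) (k : ℕ) :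
    (exactMeasure m n).real {p | k ≤ exactDisplacement b m n p}
      = (n : ℝ)⁻¹ * ∑ t ∈ Finset.range n, cyclicRunProb b m t k := by
  have hm : (m : ℝ) ≠ 0 := by exact_mod_cast NeZero.ne m
  rw [exactMeasure, measureReal_uniformOn_univ, Fintype.card_prod, Fintype.card_pi_const, ZMod.card,
    Fintype.card_fin, Fintype.sum_prod_type_right, Finset.sum_range, Nat.cast_mul, mul_inv,
    mul_comm _ (n : ℝ)⁻¹, mul_assoc, Finset.mul_sum]
  congr 1
  refine Finset.sum_congr rfl fun j _ => ?_
  have h1 := sum_displacement (b := b) (m := m) j (Set.indicator (Set.Ici k) fun _ => 1)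
  have h2 : ∀ g : Fin n → ZMod m,
      {p : (Fin n → ZMod m) × Fin n | k ≤ exactDisplacement b m n p}.indicator (fun _ => (1 : ℝ))
        (g, j) = Set.indicator (Set.Ici k) (fun _ => 1) (displacement b g j) := fun g => rfl
  simp only [h2]
  rw [h1, cyclicRunProb, addressMeasure, measureReal_uniformOn_univ, Fintype.card_pi_const,
    ZMod.card, ← mul_assoc]
  congr 1
  · have := Nat.sub_add_cancel j.2.le
    push_cast
    rw [inv_mul_eq_div, div_eq_iff (by positivity), inv_mul_eq_div, eq_div_iff (by positivity),
      ← pow_add, this]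
  · refine Finset.sum_congr rfl fun g _ => ?_
    have h3 := le_probe_occupancy_iff (b := b) g (j.2.trans_le hn) k
    classical
    simp only [Set.indicator_apply]
    exact if_congr h3 rfl rfl

end displacement

/-! ### The limit of the law of the displacement -/

section limit_law

variable {b : ℕ}

lemma unsuccessfulProb_eq_sub (hb : 1 ≤ b) {β : ℝ} (hβ : 0 ≤ β) (hβ1 : β < 1) (k : ℕ) :
    unsuccessfulProb b β k = (poissonTable b β).real (fullRun b k)
      - (poissonTable b β).real (fullRun b (k + 1)) := by
  have h1 : unsuccessfulProb b β k
      = (poissonTable b β).real (fullRun b k \ fullRun b (k + 1)) := by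
    refine measureReal_congr ?_
    filter_upwards [ae_bddOverflow hb hβ hβ1, ae_exists_not_full hb hβ hβ1] with x hx hx'
    refine propext ?_
    change unsuccessfulZero b x = k ↔ x ∈ fullRun b k ∧ x ∉ fullRun b (k + 1)
    rw [← le_unsuccessfulZero_iff hx hx', ← le_unsuccessfulZero_iff hx hx']
    omega
  have hsub : fullRun b (k + 1) ⊆ fullRun b k := fun x hx l hl => hx l (by omega)
  rw [h1, measureReal_sdiff hsub (measurableSet_fullRun b _)]

/-- The averages of a function on the first `n` natural numbers as an integral. -/
lemma average_eq_integral (n : ℕ) [NeZero n] (φ : ℕ → ℝ) :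
    (n : ℝ)⁻¹ * ∑ t ∈ Finset.range n, φ t = ∫ u in (0 : ℝ)..1, φ ⌊n * u⌋₊ := by
  have hn : (n : ℝ) ≠ 0 := by exact_mod_cast NeZero.ne n
  have hae : ∀ t : ℕ, ∀ᵐ x : ℝ, x ∈ Set.uIoc (t : ℝ) (t + 1 : ℕ) → φ t = φ ⌊x⌋₊ := by
    intro t
    filter_upwards [Measure.ae_ne volume ((t + 1 : ℕ) : ℝ)] with x hx1 hx
    rw [Set.uIoc_of_le (by simp)] at hx
    have : ⌊x⌋₊ = t := (Nat.floor_eq_iff ((Nat.cast_nonneg t).trans hx.1.le)).mpr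
      ⟨hx.1.le, by exact_mod_cast lt_of_le_of_ne hx.2 hx1⟩
    rw [this]
  have hint : ∀ t : ℕ, ∫ x in (t : ℝ)..(t + 1 : ℕ), φ ⌊x⌋₊ = φ t := by
    intro t
    rw [← intervalIntegral.integral_congr_ae (hae t)]
    simp
  have h := intervalIntegral.sum_integral_adjacent_intervals (f := fun x : ℝ => φ ⌊x⌋₊)
    (μ := volume) (a := fun t : ℕ => (t : ℝ)) (n := n) fun t _ =>
      (intervalIntegrable_const (c := φ t)).congr_ae
        ((ae_restrict_iff' measurableSet_uIoc).mpr (hae t))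
  simp only [hint] at h
  rw [h, intervalIntegral.integral_comp_mul_left (fun x => φ ⌊x⌋₊) hn]
  simp

section limits

variable {α : ℝ} {m n : ℕ → ℕ} [∀ i, NeZero (m i)]

lemma tendsto_cyclicRunProb_floor (hb : 1 ≤ b) (hm : Tendsto m atTop atTop)
    (hlim : Tendsto (fun i => (n i : ℝ) / (b * m i)) atTop (𝓝 α)) {u : ℝ} (hu : 0 ≤ u)
    (h0 : 0 < α * u) (h1 : α * u < 1) (k : ℕ) :
    Tendsto (fun i => cyclicRunProb b (m i) ⌊n i * u⌋₊ k) atTop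
      (𝓝 ((poissonTable b (α * u)).real (fullRun b k))) := by
  refine tendsto_cyclicRunProb hb h0 h1 hm ?_ k
  have hbm : Tendsto (fun i => (b * m i : ℝ)) atTop atTop :=
    (tendsto_natCast_atTop_atTop.comp hm).const_mul_atTop (by exact_mod_cast hb)
  have hlow : Tendsto (fun i => (n i : ℝ) / (b * m i) * u - 1 / (b * m i)) atTop (𝓝 (α * u)) := by
    simpa using (hlim.mul_const u).sub (hbm.const_div_atTop 1)
  refine tendsto_of_tendsto_of_tendsto_of_le_of_le hlow (hlim.mul_const u) (fun i => ?_) fun i => ?_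
  · change (n i : ℝ) / (b * m i) * u - 1 / (b * m i) ≤ (⌊n i * u⌋₊ : ℝ) / (b * m i)
    rw [div_mul_eq_mul_div, ← sub_div]
    gcongr
    exact (Nat.sub_one_lt_floor _).le
  · change (⌊n i * u⌋₊ : ℝ) / (b * m i) ≤ (n i : ℝ) / (b * m i) * u
    rw [div_mul_eq_mul_div]
    gcongr
    exact Nat.floor_le (by positivity)

lemma aestronglyMeasurable_cyclicRunProb_floor (m n k : ℕ) (μ : Measure ℝ) :
    AEStronglyMeasurable (fun u : ℝ => cyclicRunProb b m ⌊n * u⌋₊ k) μ :=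
  ((measurable_of_countable fun t => cyclicRunProb b m t k).comp
    (Nat.measurable_floor.comp (measurable_const_mul (n : ℝ)))).aestronglyMeasurable

/-- Measurability in the load is obtained from the exact model: the function is a pointwise limit of
cyclic run probabilities, which are step functions of `β`. -/
lemma aestronglyMeasurable_fullRun (hb : 1 ≤ b) (hα1 : α < 1) (k : ℕ) :
    AEStronglyMeasurable (fun β => (poissonTable b β).real (fullRun b k))
      (volume.restrict (Set.Ioc 0 α)) := by
  refine aestronglyMeasurable_of_tendsto_ae atTop (f := fun i β => cyclicRunProb b (i + 1)
    ⌊((b * (i + 1) : ℕ) : ℝ) * β⌋₊ k)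
    (fun i => aestronglyMeasurable_cyclicRunProb_floor (i + 1) (b * (i + 1)) k _) ?_
  refine (ae_restrict_iff' measurableSet_Ioc).mpr (ae_of_all _ fun β hβ => ?_)
  have hb0 : (b : ℝ) ≠ 0 := by positivity
  -- Ratio `1` is used so that `u = β`: the table with `i + 1` buckets holds `⌊b (i + 1) β⌋` keys.
  have h := tendsto_cyclicRunProb_floor hb (α := 1) (m := fun i => i + 1)
    (n := fun i => b * (i + 1)) (tendsto_add_atTop_nat 1) (u := β) ?_ hβ.1.le
    (by linarith [hβ.1]) (by linarith [hβ.2]) k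
  · simpa using h
  · refine tendsto_const_nhds.congr fun i => ?_
    push_cast
    rw [div_self (by positivity)]

lemma intervalIntegrable_fullRun (hb : 1 ≤ b) (hα0 : 0 < α) (hα1 : α < 1) (k : ℕ) :
    IntervalIntegrable (fun β => (poissonTable b β).real (fullRun b k)) volume 0 α := by
  rw [intervalIntegrable_iff_integrableOn_Ioc_of_le hα0.le]
  refine Integrable.of_bound (aestronglyMeasurable_fullRun hb hα1 k) 1 (ae_of_all _ fun β => ?_)
  rw [Real.norm_of_nonneg measureReal_nonneg]
  exact measureReal_le_one

/-- Write the average as an integral over `u ∈ [0, 1]`. Key number `⌊n u⌋` meets a load tending to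
`α u`, so dominated convergence applies, followed by `β = α u`. -/
lemma tendsto_average_cyclicRunProb [∀ i, NeZero (n i)] (hb : 1 ≤ b) (hα0 : 0 < α) (hα1 : α < 1)
    (hm : Tendsto m atTop atTop)
    (hlim : Tendsto (fun i => (n i : ℝ) / (b * m i)) atTop (𝓝 α)) (k : ℕ) :
    Tendsto (fun i => (n i : ℝ)⁻¹ * ∑ t ∈ Finset.range (n i), cyclicRunProb b (m i) t k) atTop
      (𝓝 (1 / α * ∫ β in (0 : ℝ)..α, (poissonTable b β).real (fullRun b k))) := by
  have h1 : (1 / α * ∫ β in (0 : ℝ)..α, (poissonTable b β).real (fullRun b k))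
      = ∫ u in (0 : ℝ)..1, (poissonTable b (α * u)).real (fullRun b k) := by
    rw [intervalIntegral.integral_comp_mul_left
      (fun β => (poissonTable b β).real (fullRun b k)) hα0.ne']
    simp
  simp only [average_eq_integral, h1]
  refine intervalIntegral.tendsto_integral_filter_of_dominated_convergence (fun _ => 1)
    (Eventually.of_forall fun i => aestronglyMeasurable_cyclicRunProb_floor _ _ _ _)
    (Eventually.of_forall fun i => ae_of_all _ fun u _ => ?_) intervalIntegrable_const
    (ae_of_all _ fun u hu => ?_)
  · rw [Real.norm_of_nonneg (cyclicRunProb_nonneg _)]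
    exact cyclicRunProb_le_one _
  · rw [Set.uIoc_of_le zero_le_one] at hu
    exact tendsto_cyclicRunProb_floor hb hm hlim hu.1.le (mul_pos hα0 hu.1)
      ((mul_le_of_le_one_right hα0.le hu.2).trans_lt hα1) k

/-- The probability that the FCFS displacement in the infinite Poisson model is `k`. -/
def fcfsProb (b : ℕ) (α : ℝ) (k : ℕ) : ℝ :=
  1 / α * ∫ β in (0 : ℝ)..α, unsuccessfulProb b β k

lemma fcfsProb_nonneg (hα0 : 0 < α) (k : ℕ) : 0 ≤ fcfsProb b α k :=
  mul_nonneg (by positivity)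
    (intervalIntegral.integral_nonneg hα0.le fun β _ => unsuccessfulProb_nonneg k)

lemma fcfsProb_eq_sub (hb : 1 ≤ b) (hα0 : 0 < α) (hα1 : α < 1) (k : ℕ) :
    fcfsProb b α k = 1 / α * (∫ β in (0 : ℝ)..α, (poissonTable b β).real (fullRun b k))
      - 1 / α * ∫ β in (0 : ℝ)..α, (poissonTable b β).real (fullRun b (k + 1)) := by
  rw [fcfsProb, ← mul_sub, ← intervalIntegral.integral_sub
    (intervalIntegrable_fullRun hb hα0 hα1 k) (intervalIntegrable_fullRun hb hα0 hα1 (k + 1))]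
  congr 1
  refine intervalIntegral.integral_congr fun β hβ => ?_
  rw [Set.uIcc_of_le hα0.le] at hβ
  exact unsuccessfulProb_eq_sub hb hβ.1 (hβ.2.trans_lt hα1) k

lemma measureReal_exactDisplacement_eq_sub (m n k : ℕ) [NeZero m] [NeZero n] :
    (exactMeasure m n).real {p | exactDisplacement b m n p = k}
      = (exactMeasure m n).real {p | k ≤ exactDisplacement b m n p}
        - (exactMeasure m n).real {p | k + 1 ≤ exactDisplacement b m n p} := by
  have hsub : {p | k + 1 ≤ exactDisplacement b m n p} ⊆ {p | k ≤ exactDisplacement b m n p} :=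
    fun p hp => (Nat.le_succ k).trans hp
  rw [← measureReal_sdiff hsub (Set.toFinite _).measurableSet]
  congr 1
  ext p
  simp only [Set.mem_ofPred_eq, Set.mem_sdiff]
  omega

lemma eventually_le_mul (hb : 1 ≤ b) {a : ℝ} (ha : α < a)
    (hlim : Tendsto (fun i => (n i : ℝ) / (b * m i)) atTop (𝓝 α)) :
    ∀ᶠ i in atTop, (n i : ℝ) ≤ a * (b * m i) := by
  filter_upwards [hlim.eventually_le_const ha] with i hi
  have : (0 : ℝ) < m i := by exact_mod_cast NeZero.pos (m i)
  rwa [div_le_iff₀ (by positivity)] at hi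

lemma le_of_le_mul {a : ℝ} (ha : a ≤ 1) {m n : ℕ} (h : (n : ℝ) ≤ a * (b * m)) : n ≤ b * m := by
  have : (n : ℝ) ≤ b * m := h.trans (mul_le_of_le_one_left (by positivity) ha)
  exact_mod_cast this

theorem tendsto_measureReal_exactDisplacement [∀ i, NeZero (n i)] (hb : 1 ≤ b) (hα0 : 0 < α)
    (hα1 : α < 1) (hm : Tendsto m atTop atTop)
    (hlim : Tendsto (fun i => (n i : ℝ) / (b * m i)) atTop (𝓝 α)) (k : ℕ) :
    Tendsto (fun i => (exactMeasure (m i) (n i)).real {p | exactDisplacement b (m i) (n i) p = k})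
      atTop (𝓝 (fcfsProb b α k)) := by
  rw [fcfsProb_eq_sub hb hα0 hα1]
  refine ((tendsto_average_cyclicRunProb hb hα0 hα1 hm hlim k).sub
    (tendsto_average_cyclicRunProb hb hα0 hα1 hm hlim (k + 1))).congr' ?_
  filter_upwards [eventually_le_mul hb hα1 hlim] with i hi
  have hle := le_of_le_mul le_rfl hi
  rw [measureReal_exactDisplacement_eq_sub, measureReal_le_exactDisplacement hle,
    measureReal_le_exactDisplacement hle]

/-- A geometric bound for the law of the displacement, uniform in the size of the table. -/
theorem exists_measureReal_exactDisplacement_le (hb : 1 ≤ b) {a : ℝ} (ha0 : 0 ≤ a) (ha1 : a < 1) :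
    ∃ ρ : ℝ, 0 < ρ ∧ ρ < 1 ∧ ∀ (m n : ℕ) [NeZero m] [NeZero n], (n : ℝ) ≤ a * (b * m) → ∀ k,
      (exactMeasure m n).real {p | exactDisplacement b m n p = k} ≤ ρ ^ k * (1 - ρ)⁻¹ := by
  obtain ⟨ρ, hρ0, hρ1, hρ⟩ := exists_addressMeasure_window_le hb ha0 ha1
  refine ⟨ρ, hρ0, hρ1, fun m n _ _ hn k => ?_⟩
  have hle : n ≤ b * m := le_of_le_mul ha1.le hn
  have hn0 : (0 : ℝ) < n := by exact_mod_cast NeZero.pos n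
  refine (measureReal_mono (fun p hp => ?_) (measure_ne_top _ _)).trans
    ((measureReal_le_exactDisplacement hle k).trans_le ?_)
  · exact (show exactDisplacement b m n p = k from hp).ge
  rw [inv_mul_le_iff₀ hn0]
  refine (Finset.sum_le_card_nsmul _ _ (ρ ^ k * (1 - ρ)⁻¹) fun t ht => ?_).trans_eq (by simp)
  rw [Finset.mem_range] at ht
  refine cyclicRunProb_le hρ0 hρ1 (ht.trans_le hle) (fun i L hL => hρ m t ?_ i L hL) k
  exact le_trans (by exact_mod_cast ht.le) hn

end limits

end limit_law

/-! ### The generating function of the FCFS displacement -/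

section generating

variable {b : ℕ} {α β : ℝ} {q : ℂ}

lemma summable_norm_unsuccessfulProb (hb : 1 ≤ b) (hβ : 0 < β) (hβα : β ≤ α) (hα1 : α < 1)
    (hq : ‖q‖ ≤ radius b α) : Summable fun k => unsuccessfulProb b β k * ‖q ^ k‖ := by
  refine Summable.of_nonneg_of_le (fun k => mul_nonneg (unsuccessfulProb_nonneg k) (norm_nonneg _))
    (fun k => ?_) (summable_unsuccessfulProb hb hβ hβα hα1)
  rw [norm_pow]
  gcongr
  exact unsuccessfulProb_nonneg k

lemma integrable_pow_unsuccessfulZero (hb : 1 ≤ b) (hβ : 0 < β) (hβα : β ≤ α) (hα1 : α < 1)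
    (hq : ‖q‖ ≤ radius b α) :
    Integrable (fun x => q ^ unsuccessfulZero b x) (poissonTable b β) :=
  (integrable_comp_iff _ (measurable_unsuccessfulZero b) (f := fun k => q ^ k)).mpr
    (summable_norm_unsuccessfulProb hb hβ hβα hα1 hq)

lemma hasSum_pgf_unsuccessfulZero (hb : 1 ≤ b) (hβ : 0 < β) (hβα : β ≤ α) (hα1 : α < 1)
    (hq : ‖q‖ ≤ radius b α) :
    HasSum (fun k => (unsuccessfulProb b β k : ℂ) * q ^ k)
      (pgf (poissonTable b β) (unsuccessfulZero b) q) :=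
  hasSum_integral_comp _ (measurable_unsuccessfulZero b) (f := fun k => q ^ k)
    (integrable_pow_unsuccessfulZero hb hβ hβα hα1 hq)

lemma one_sub_mul_pgf_unsuccessfulZero (hb : 1 ≤ b) (hβ : 0 < β) (hβα : β ≤ α) (hα1 : α < 1)
    (hq : ‖q‖ ≤ radius b α) (hq1 : q ≠ 1) :
    pgf (poissonTable b β) (unsuccessfulZero b) q
      = tZero b β / (1 - q) * ∏ ℓ ∈ Finset.range b, (1 - zeta b ℓ q β) := by
  have h := unsuccessfulGF_eq hb hβ hβα hα1 hq
  have h1 : ∑' k, q ^ k * (unsuccessfulProb b β k : ℂ)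
      = pgf (poissonTable b β) (unsuccessfulZero b) q := by
    rw [← (hasSum_pgf_unsuccessfulZero hb hβ hβα hα1 hq).tsum_eq]
    simp only [mul_comm]
  rw [h1] at h
  rw [div_mul_eq_mul_div, eq_div_iff (sub_ne_zero.mpr hq1.symm), ← h, mul_comm]

lemma aestronglyMeasurable_unsuccessfulProb (hb : 1 ≤ b) (hα1 : α < 1) (k : ℕ) :
    AEStronglyMeasurable (fun β => unsuccessfulProb b β k) (volume.restrict (Set.Ioc 0 α)) := by
  refine ((aestronglyMeasurable_fullRun hb hα1 k).sub
    (aestronglyMeasurable_fullRun hb hα1 (k + 1))).congr ?_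
  refine (ae_restrict_iff' measurableSet_Ioc).mpr (ae_of_all _ fun β hβ => ?_)
  exact (unsuccessfulProb_eq_sub hb hβ.1.le (hβ.2.trans_lt hα1) k).symm

lemma aestronglyMeasurable_hasSum {E : Type*} [NormedAddCommGroup E] {F : ℕ → ℝ → E} {f : ℝ → E}
    (hF : ∀ k, AEStronglyMeasurable (F k) (volume.restrict (Set.Ioc 0 α)))
    (h : ∀ β ∈ Set.Ioc 0 α, HasSum (fun k => F k β) (f β)) :
    AEStronglyMeasurable f (volume.restrict (Set.Ioc 0 α)) := by
  refine aestronglyMeasurable_of_tendsto_ae atTop (f := fun N β => ∑ k ∈ Finset.range N, F k β)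
    (fun N => Finset.aestronglyMeasurable_fun_sum _ fun k _ => hF k) ?_
  exact (ae_restrict_iff' measurableSet_Ioc).mpr
    (ae_of_all _ fun β hβ => (h β hβ).tendsto_sum_nat)

lemma norm_pgf_unsuccessfulZero_le (hb : 1 ≤ b) (hβ : 0 < β) (hβα : β ≤ α) (hα1 : α < 1)
    (hq : ‖q‖ ≤ radius b α) :
    ‖pgf (poissonTable b β) (unsuccessfulZero b) q‖
      ≤ (1 + Real.exp α / α) ^ b / (radius b α - 1) := by
  refine le_trans ?_ (tsum_unsuccessfulProb_le hb hβ hβα hα1)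
  rw [← (hasSum_pgf_unsuccessfulZero hb hβ hβα hα1 hq).tsum_eq]
  refine tsum_of_norm_bounded (summable_unsuccessfulProb hb hβ hβα hα1).hasSum fun k => ?_
  rw [norm_mul, norm_pow, Complex.norm_real, Real.norm_of_nonneg (unsuccessfulProb_nonneg k)]
  gcongr
  exact unsuccessfulProb_nonneg k

lemma intervalIntegrable_pgf_unsuccessfulZero (hb : 1 ≤ b) (hα0 : 0 < α) (hα1 : α < 1)
    (hq : ‖q‖ ≤ radius b α) :
    IntervalIntegrable (fun β : ℝ => pgf (poissonTable b β) (unsuccessfulZero b) q)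
      volume 0 α := by
  rw [intervalIntegrable_iff_integrableOn_Ioc_of_le hα0.le]
  refine Integrable.of_bound (aestronglyMeasurable_hasSum
    (F := fun k β => (unsuccessfulProb b β k : ℂ) * q ^ k) (fun k => ?_) fun β hβ =>
      hasSum_pgf_unsuccessfulZero hb hβ.1 hβ.2 hα1 hq)
    ((1 + Real.exp α / α) ^ b / (radius b α - 1))
    ((ae_restrict_iff' measurableSet_Ioc).mpr (ae_of_all _ fun β hβ =>
      norm_pgf_unsuccessfulZero_le hb hβ.1 hβ.2 hα1 hq))
  exact (Complex.continuous_ofReal.comp_aestronglyMeasurable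
    (aestronglyMeasurable_unsuccessfulProb hb hα1 k)).mul_const _

lemma intervalIntegrable_tsum_unsuccessfulProb (hb : 1 ≤ b) (hα0 : 0 < α) (hα1 : α < 1) :
    IntervalIntegrable (fun β : ℝ => ∑' k, unsuccessfulProb b β k * radius b α ^ k)
      volume 0 α := by
  rw [intervalIntegrable_iff_integrableOn_Ioc_of_le hα0.le]
  have hR := one_lt_radius hb hα0 hα1
  refine Integrable.of_bound (aestronglyMeasurable_hasSum
    (F := fun k β => unsuccessfulProb b β k * radius b α ^ k) (fun k => ?_) fun β hβ =>
      (summable_unsuccessfulProb hb hβ.1 hβ.2 hα1).hasSum)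
    ((1 + Real.exp α / α) ^ b / (radius b α - 1))
    ((ae_restrict_iff' measurableSet_Ioc).mpr (ae_of_all _ fun β hβ => ?_))
  · exact (aestronglyMeasurable_unsuccessfulProb hb hα1 k).mul_const _
  · rw [Real.norm_of_nonneg (tsum_nonneg fun k =>
      mul_nonneg (unsuccessfulProb_nonneg k) (by positivity))]
    exact tsum_unsuccessfulProb_le hb hβ.1 hβ.2 hα1

/-- Interchange of sum and integral. The dominating terms `P(U_β = k) R^k` have a sum bounded
uniformly in `β`, hence integrable. -/
lemma hasSum_fcfsProb_mul_pow (hb : 1 ≤ b) (hα0 : 0 < α) (hα1 : α < 1) (hq : ‖q‖ ≤ radius b α) :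
    HasSum (fun k => (fcfsProb b α k : ℂ) * q ^ k)
      (1 / (α : ℂ) * ∫ β in (0 : ℝ)..α, pgf (poissonTable b β) (unsuccessfulZero b) q) := by
  have h : HasSum (fun k => ∫ β in (0 : ℝ)..α, (unsuccessfulProb b β k : ℂ) * q ^ k)
      (∫ β in (0 : ℝ)..α, pgf (poissonTable b β) (unsuccessfulZero b) q) := by
    refine intervalIntegral.hasSum_integral_of_dominated_convergence
      (fun k β => unsuccessfulProb b β k * radius b α ^ k) (fun k => ?_)
      (fun k => ae_of_all _ fun β _ => ?_) (ae_of_all _ fun β hβ => ?_)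
      (intervalIntegrable_tsum_unsuccessfulProb hb hα0 hα1) (ae_of_all _ fun β hβ => ?_)
    · rw [Set.uIoc_of_le hα0.le]
      exact (Complex.continuous_ofReal.comp_aestronglyMeasurable
        (aestronglyMeasurable_unsuccessfulProb hb hα1 k)).mul_const _
    · rw [norm_mul, norm_pow, Complex.norm_real, Real.norm_of_nonneg (unsuccessfulProb_nonneg k)]
      gcongr
      exact unsuccessfulProb_nonneg k
    · rw [Set.uIoc_of_le hα0.le] at hβ
      exact summable_unsuccessfulProb hb hβ.1 hβ.2 hα1
    · rw [Set.uIoc_of_le hα0.le] at hβ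
      exact hasSum_pgf_unsuccessfulZero hb hβ.1 hβ.2 hα1 hq
  convert! h.mul_left (1 / (α : ℂ)) using 1
  funext k
  rw [intervalIntegral.integral_mul_const, intervalIntegral.integral_ofReal, fcfsProb]
  push_cast
  ring

lemma summable_fcfsProb_mul_radius_pow (hb : 1 ≤ b) (hα0 : 0 < α) (hα1 : α < 1) :
    Summable fun k => fcfsProb b α k * radius b α ^ k := by
  have hR := one_lt_radius hb hα0 hα1
  have h := (hasSum_fcfsProb_mul_pow hb hα0 hα1 (q := (radius b α : ℂ)) (by
    rw [Complex.norm_real, Real.norm_of_nonneg (by linarith)])).summable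
  exact_mod_cast h

lemma hasSum_fcfsProb (hb : 1 ≤ b) (hα0 : 0 < α) (hα1 : α < 1) :
    HasSum (fcfsProb b α) 1 := by
  have hR := one_lt_radius hb hα0 hα1
  have h := hasSum_fcfsProb_mul_pow hb hα0 hα1 (q := 1) (by simpa using hR.le)
  have hα : (α : ℂ) ≠ 0 := by exact_mod_cast hα0.ne'
  simp only [pgf, one_pow, mul_one, integral_const, probReal_univ, one_smul,
    intervalIntegral.integral_const, sub_zero, Complex.real_smul, one_div] at h
  rw [inv_mul_cancel₀ hα] at h
  exact Complex.hasSum_ofReal.mp (by simpa using h)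

lemma isProbabilityMeasure_fcfsLaw (hb : 1 ≤ b) (hα0 : 0 < α) (hα1 : α < 1) :
    IsProbabilityMeasure (fcfsLaw b α) :=
  (hasSum_fcfsProb hb hα0 hα1).isProbabilityMeasure_sum_dirac (fcfsProb_nonneg hα0)

lemma measureReal_fcfsLaw (hα0 : 0 < α) (k : ℕ) :
    (fcfsLaw b α).real {j | j = k} = fcfsProb b α k := by
  have h : fcfsLaw b α
      = Measure.sum fun k : ℕ => ENNReal.ofReal (fcfsProb b α k) • Measure.dirac k := rfl
  have h1 : fcfsLaw b α {k} = ENNReal.ofReal (fcfsProb b α k) := by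
    rw [h, Measure.sum_smul_dirac_singleton]
  change (fcfsLaw b α).real {k} = _
  rw [measureReal_def, h1, ENNReal.toReal_ofReal (fcfsProb_nonneg hα0 k)]

lemma integrable_pow_fcfsLaw (hb : 1 ≤ b) (hα0 : 0 < α) (hα1 : α < 1) (hq : ‖q‖ ≤ radius b α) :
    Integrable (fun k : ℕ => q ^ k) (fcfsLaw b α) := by
  have := isProbabilityMeasure_fcfsLaw hb hα0 hα1
  refine (integrable_comp_iff (fcfsLaw b α) measurable_id (f := fun k => q ^ k)).mpr ?_
  refine Summable.of_nonneg_of_le (fun k => mul_nonneg measureReal_nonneg (norm_nonneg _))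
    (fun k => ?_) (summable_fcfsProb_mul_radius_pow hb hα0 hα1)
  rw [norm_pow]
  simp only [id_eq, measureReal_fcfsLaw hα0]
  gcongr
  exact fcfsProb_nonneg hα0 k

theorem pgf_fcfsLaw (hb : 1 ≤ b) (hα0 : 0 < α) (hα1 : α < 1) (hq : ‖q‖ ≤ radius b α) :
    pgf (fcfsLaw b α) id q
      = 1 / (α : ℂ) * ∫ β in (0 : ℝ)..α, pgf (poissonTable b β) (unsuccessfulZero b) q := by
  have := isProbabilityMeasure_fcfsLaw hb hα0 hα1
  have h := hasSum_integral_comp (fcfsLaw b α) measurable_id (f := fun k => q ^ k)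
    (integrable_pow_fcfsLaw hb hα0 hα1 hq)
  simp only [id_eq, measureReal_fcfsLaw hα0, Complex.real_smul] at h
  exact h.unique (hasSum_fcfsProb_mul_pow hb hα0 hα1 hq)

lemma tZero_div_mul_eq (β : ℝ) (q P : ℂ) :
    tZero b β / (1 - q) * P
      = (b : ℂ) * (1 - β) * P / ((1 - q) * ∏ ℓ ∈ Finset.Icc 1 (b - 1), (1 - zeta b ℓ 1 β)) := by
  rw [tZero, div_div, div_mul_eq_mul_div, mul_comm (1 - q)]

end generating

/-! ### Convergence of expectations -/

section expectation

/-- One weighted `ℓ¹` distance between the laws controls the expectations of all functions of growth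
at most `C s^k` simultaneously. -/
lemma norm_integral_sub_le {Ω Ω' E : Type*} [MeasurableSpace Ω] [MeasurableSpace Ω']
    [NormedAddCommGroup E] [NormedSpace ℝ E] [CompleteSpace E] (μ : Measure Ω) (μ' : Measure Ω')
    [IsFiniteMeasure μ] [IsFiniteMeasure μ'] {X : Ω → ℕ} {X' : Ω' → ℕ} (hX : Measurable X)
    (hX' : Measurable X') {s C : ℝ} (hs : 0 ≤ s) {f : ℕ → E} (hf : ∀ k, ‖f k‖ ≤ C * s ^ k)
    (h : Summable fun k => μ.real {ω | X ω = k} * s ^ k)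
    (h' : Summable fun k => μ'.real {ω | X' ω = k} * s ^ k) :
    ‖∫ ω, f (X ω) ∂μ - ∫ ω, f (X' ω) ∂μ'‖
      ≤ C * ∑' k, |μ.real {ω | X ω = k} - μ'.real {ω | X' ω = k}| * s ^ k := by
  have hint : ∀ p : ℕ → ℝ, (∀ k, 0 ≤ p k) → (Summable fun k => p k * s ^ k) →
      Summable fun k => p k * ‖f k‖ := by
    intro p hp hsum
    refine Summable.of_nonneg_of_le (fun k => mul_nonneg (hp k) (norm_nonneg _)) (fun k => ?_)
      (hsum.mul_left C)
    rw [mul_left_comm]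
    exact mul_le_mul_of_nonneg_left (hf k) (hp k)
  have h1 := hasSum_integral_comp μ hX ((integrable_comp_iff μ hX).mpr
    (hint _ (fun _ => measureReal_nonneg) h))
  have h2 := hasSum_integral_comp μ' hX' ((integrable_comp_iff μ' hX').mpr
    (hint _ (fun _ => measureReal_nonneg) h'))
  have h3 : Summable fun k => |μ.real {ω | X ω = k} - μ'.real {ω | X' ω = k}| * s ^ k := by
    refine (h.sub h').abs.congr fun k => ?_
    rw [← sub_mul, abs_mul, abs_of_nonneg (pow_nonneg hs k)]
  rw [← (h1.sub h2).tsum_eq]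
  refine tsum_of_norm_bounded (h3.hasSum.mul_left C) fun k => ?_
  rw [← sub_smul, norm_smul, Real.norm_eq_abs, mul_left_comm]
  exact mul_le_mul_of_nonneg_left (hf k) (abs_nonneg _)

lemma exists_natCast_pow_le (r : ℕ) {s : ℝ} (hs : 1 < s) :
    ∃ C : ℝ, ∀ k : ℕ, ‖(k : ℝ) ^ r‖ ≤ C * s ^ k := by
  obtain ⟨C, hC⟩ := (tendsto_pow_const_div_const_pow_of_one_lt r hs).bddAbove_range
  refine ⟨C, fun k => ?_⟩
  have h : (k : ℝ) ^ r / s ^ k ≤ C := hC ⟨k, rfl⟩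
  rw [Real.norm_of_nonneg (by positivity)]
  rwa [div_le_iff₀ (by positivity)] at h

end expectation

/-! ### Convergence of the exact model -/

section exact

variable {b : ℕ} {α : ℝ} {m n : ℕ → ℕ} [∀ i, NeZero (m i)] [∀ i, NeZero (n i)]

lemma measurable_exactDisplacement (b m n : ℕ) [NeZero m] : Measurable (exactDisplacement b m n) :=
  measurable_of_countable _

lemma summable_exactDisplacement (b m n : ℕ) [NeZero m] [NeZero n] (s : ℝ) :
    Summable fun k => (exactMeasure m n).real {p | exactDisplacement b m n p = k} * s ^ k := by
  have h := (integrable_comp_iff (exactMeasure m n) (measurable_exactDisplacement b m n)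
    (f := fun k => s ^ k)).mp Integrable.of_finite
  refine h.of_norm_bounded fun k => ?_
  rw [norm_mul, Real.norm_of_nonneg measureReal_nonneg]

/-- The weighted distance between the laws of the displacement in the exact model and in the
infinite Poisson model. -/
def lawDist (b : ℕ) (α s : ℝ) (m n : ℕ) : ℝ :=
  ∑' k, |(exactMeasure m n).real {p | exactDisplacement b m n p = k} - fcfsProb b α k| * s ^ k

/-- Dominated convergence over `k`: the exact laws have uniform geometric tails and the limit law
has finite `R`-exponential moment. The weight `s` is fixed before the sequences `m` and `n`. -/
lemma exists_tendsto_lawDist (hb : 1 ≤ b) (hα0 : 0 < α) (hα1 : α < 1) :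
    ∃ s : ℝ, 1 < s ∧ s ≤ radius b α ∧
      ∀ (m n : ℕ → ℕ) [∀ i, NeZero (m i)] [∀ i, NeZero (n i)], Tendsto m atTop atTop →
        Tendsto (fun i => (n i : ℝ) / (b * m i)) atTop (𝓝 α) →
        Tendsto (fun i => lawDist b α s (m i) (n i)) atTop (𝓝 0) := by
  obtain ⟨a, hαa, ha1⟩ := exists_between hα1
  obtain ⟨ρ, hρ0, hρ1, hρ⟩ := exists_measureReal_exactDisplacement_le hb (hα0.trans hαa).le ha1
  -- `s < R` makes the limit law summable with weights `s^k`; `s < 1/ρ` does the same for the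
  -- geometric bound of the exact laws.
  obtain ⟨s, hs1, hs⟩ := exists_between
    (lt_min (one_lt_radius hb hα0 hα1) ((one_lt_inv₀ hρ0).mpr hρ1))
  have hsR : s ≤ radius b α := hs.le.trans (min_le_left _ _)
  have hsρ : ρ * s < 1 := by
    rw [← mul_inv_cancel₀ hρ0.ne']
    exact mul_lt_mul_of_pos_left (hs.trans_le (min_le_right _ _)) hρ0
  have hs0 : 0 < s := by linarith
  refine ⟨s, hs1, hsR, fun m n _ _ hm hlim => ?_⟩
  have hsum1 : Summable fun k => fcfsProb b α k * s ^ k := by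
    refine Summable.of_nonneg_of_le
      (fun k => mul_nonneg (fcfsProb_nonneg hα0 k) (by positivity)) (fun k => ?_)
      (summable_fcfsProb_mul_radius_pow hb hα0 hα1)
    gcongr
    exact fcfsProb_nonneg hα0 k
  have hsum2 : Summable fun k => ρ ^ k * (1 - ρ)⁻¹ * s ^ k := by
    refine ((summable_geometric_of_lt_one (by positivity) hsρ).mul_right (1 - ρ)⁻¹).congr
      fun k => ?_
    rw [mul_pow]
    ring
  rw [← tsum_zero (α := ℝ) (β := ℕ)]
  refine tendsto_tsum_of_dominated_convergence (hsum2.add hsum1) (fun k => ?_) ?_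
  · have h := ((tendsto_measureReal_exactDisplacement hb hα0 hα1 hm hlim k).sub_const
      (fcfsProb b α k)).abs.mul_const (s ^ k)
    simpa using h
  · filter_upwards [eventually_le_mul hb hαa hlim] with i hi k
    rw [norm_mul, Real.norm_of_nonneg (abs_nonneg _), Real.norm_of_nonneg (by positivity),
      ← add_mul]
    gcongr
    refine (abs_sub _ _).trans ?_
    rw [abs_of_nonneg measureReal_nonneg, abs_of_nonneg (fcfsProb_nonneg hα0 k)]
    gcongr
    exact hρ (m i) (n i) hi k

lemma norm_integral_exactDisplacement_sub_le {E : Type*} [NormedAddCommGroup E] [NormedSpace ℝ E]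
    [CompleteSpace E] (hb : 1 ≤ b) (hα0 : 0 < α) (hα1 : α < 1) {s C : ℝ} (hs1 : 1 < s)
    (hsR : s ≤ radius b α) (m n : ℕ) [NeZero m] [NeZero n] {f : ℕ → E}
    (hf : ∀ k, ‖f k‖ ≤ C * s ^ k) :
    ‖∫ p, f (exactDisplacement b m n p) ∂exactMeasure m n - ∫ k, f k ∂fcfsLaw b α‖
      ≤ C * lawDist b α s m n := by
  have := isProbabilityMeasure_fcfsLaw hb hα0 hα1
  have hs0 : 0 < s := by linarith
  have hsum : Summable fun k => (fcfsLaw b α).real {j | id j = k} * s ^ k := by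
    simp only [id_eq, measureReal_fcfsLaw hα0]
    refine Summable.of_nonneg_of_le
      (fun k => mul_nonneg (fcfsProb_nonneg hα0 k) (by positivity)) (fun k => ?_)
      (summable_fcfsProb_mul_radius_pow hb hα0 hα1)
    gcongr
    exact fcfsProb_nonneg hα0 k
  have h := norm_integral_sub_le (exactMeasure m n) (fcfsLaw b α)
    (measurable_exactDisplacement b m n) measurable_id hs0.le hf
    (summable_exactDisplacement b m n s) hsum
  simp only [id_eq, measureReal_fcfsLaw hα0] at h
  exact h

lemma tendsto_integral_exactDisplacement {E : Type*} [NormedAddCommGroup E] [NormedSpace ℝ E]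
    [CompleteSpace E] (hb : 1 ≤ b) (hα0 : 0 < α) (hα1 : α < 1) {s C : ℝ} (hs1 : 1 < s)
    (hsR : s ≤ radius b α) (hdist : Tendsto (fun i => lawDist b α s (m i) (n i)) atTop (𝓝 0))
    {f : ℕ → E} (hf : ∀ k, ‖f k‖ ≤ C * s ^ k) :
    Tendsto (fun i => ∫ p, f (exactDisplacement b (m i) (n i) p) ∂exactMeasure (m i) (n i)) atTop
      (𝓝 (∫ k, f k ∂fcfsLaw b α)) := by
  rw [tendsto_iff_norm_sub_tendsto_zero]
  refine squeeze_zero (fun _ => norm_nonneg _) (fun i =>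
    norm_integral_exactDisplacement_sub_le hb hα0 hα1 hs1 hsR (m i) (n i) hf) ?_
  simpa using hdist.const_mul C

theorem tendstoInDistribution_exactDisplacement (hb : 1 ≤ b) (hα0 : 0 < α) (hα1 : α < 1)
    [IsProbabilityMeasure (fcfsLaw b α)] {s : ℝ} (hs1 : 1 < s) (hsR : s ≤ radius b α)
    (hdist : Tendsto (fun i => lawDist b α s (m i) (n i)) atTop (𝓝 0)) :
    TendstoInDistribution (fun i => exactDisplacement b (m i) (n i)) atTop (id : ℕ → ℕ)
      (fun i => exactMeasure (m i) (n i)) (fcfsLaw b α) where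
  forall_aemeasurable i := (measurable_exactDisplacement b (m i) (n i)).aemeasurable
  aemeasurable_limit := aemeasurable_id
  tendsto := by
    refine ProbabilityMeasure.tendsto_iff_forall_integral_tendsto.mpr fun f => ?_
    have hf : ∀ k, ‖f k‖ ≤ ‖f‖ * s ^ k := fun k => (f.norm_coe_le_norm k).trans
      (le_mul_of_one_le_right (norm_nonneg _) (one_le_pow₀ hs1.le))
    have h := tendsto_integral_exactDisplacement (m := m) (n := n) hb hα0 hα1 hs1 hsR hdist hf
    simp only [ProbabilityMeasure.coe_mk, Measure.map_id]
    refine h.congr fun i => ?_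
    rw [integral_map (measurable_exactDisplacement b (m i) (n i)).aemeasurable
      f.continuous.aestronglyMeasurable]

theorem tendstoUniformlyOn_pgf_exactDisplacement (hb : 1 ≤ b) (hα0 : 0 < α) (hα1 : α < 1)
    {s : ℝ} (hs1 : 1 < s) (hsR : s ≤ radius b α)
    (hdist : Tendsto (fun i => lawDist b α s (m i) (n i)) atTop (𝓝 0)) :
    TendstoUniformlyOn
      (fun i q => pgf (exactMeasure (m i) (n i)) (exactDisplacement b (m i) (n i)) q)
      (fun q => pgf (fcfsLaw b α) id q) atTop (Metric.closedBall 0 s) := by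
  rw [Metric.tendstoUniformlyOn_iff]
  intro ε hε
  filter_upwards [hdist.eventually_lt_const hε] with i hi q hq
  rw [mem_closedBall_zero_iff] at hq
  -- The constant `C = 1` serves every `q` with `|q| ≤ s`, hence uniformity.
  have h := norm_integral_exactDisplacement_sub_le hb hα0 hα1 hs1 hsR (m i) (n i) (C := 1)
    (f := fun k => q ^ k) fun k => by
      rw [norm_pow, one_mul]
      gcongr
  rw [dist_comm, dist_eq_norm]
  exact (h.trans_eq (one_mul _)).trans_lt hi

lemma integrable_natCast_pow_fcfsLaw (hb : 1 ≤ b) (hα0 : 0 < α) (hα1 : α < 1) (r : ℕ) :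
    Integrable (fun k : ℕ => (k : ℝ) ^ r) (fcfsLaw b α) := by
  have hR := one_lt_radius hb hα0 hα1
  obtain ⟨C, hC⟩ := exists_natCast_pow_le r hR
  have hq : ‖(radius b α : ℂ)‖ = radius b α := by
    rw [Complex.norm_real, Real.norm_of_nonneg (by linarith)]
  refine ((integrable_pow_fcfsLaw hb hα0 hα1 hq.le).norm.const_mul C).mono'
    (measurable_of_countable _).aestronglyMeasurable (ae_of_all _ fun k => ?_)
  have hk : ‖(radius b α : ℂ) ^ k‖ = radius b α ^ k := by rw [norm_pow, hq]
  rw [hk]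
  exact hC k

end exact

end

end LinearProbing

theorem mainTheorem5 (b : ℕ) (hb : 1 ≤ b) (α : ℝ) (hα0 : 0 < α) (hα1 : α < 1) :
    ∃ _ : IsProbabilityMeasure (fcfsLaw b α),
      -- the probability generating function in the infinite Poisson model
      (∀ q : ℂ, ‖q‖ ≤ radius b α →
        Integrable (fun k : ℕ => q ^ k) (fcfsLaw b α) ∧
        (∀ β ∈ Set.Ioc 0 α,
          Integrable (fun x => q ^ unsuccessfulZero b x) (poissonTable b β)) ∧
        IntervalIntegrable (fun β : ℝ => pgf (poissonTable b β) (unsuccessfulZero b) q)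
          volume 0 α ∧
        pgf (fcfsLaw b α) id q
          = 1 / (α : ℂ) * ∫ β in (0 : ℝ)..α, pgf (poissonTable b β) (unsuccessfulZero b) q ∧
        (q ≠ 1 →
          IntervalIntegrable (fun β : ℝ =>
            tZero b β / (1 - q) * ∏ ℓ ∈ Finset.range b, (1 - zeta b ℓ q β)) volume 0 α ∧
          pgf (fcfsLaw b α) id q
            = 1 / (α : ℂ) * ∫ β in (0 : ℝ)..α,
                tZero b β / (1 - q) * ∏ ℓ ∈ Finset.range b, (1 - zeta b ℓ q β) ∧
          pgf (fcfsLaw b α) id q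
            = 1 / (α : ℂ) * ∫ β in (0 : ℝ)..α,
                (b : ℂ) * (1 - β) * (∏ ℓ ∈ Finset.range b, (1 - zeta b ℓ q β)) /
                  ((1 - q) * ∏ ℓ ∈ Finset.Icc 1 (b - 1), (1 - zeta b ℓ 1 β)))) ∧
      -- all moments of the limit are finite
      (∀ r : ℕ, Integrable (fun k : ℕ => (k : ℝ) ^ r) (fcfsLaw b α)) ∧
      -- convergence of the exact model
      ∃ δ : ℝ, 0 < δ ∧
        (∀ q : ℂ, ‖q‖ ≤ 1 + δ → Integrable (fun k : ℕ => q ^ k) (fcfsLaw b α)) ∧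
        ∀ (m n : ℕ → ℕ) [∀ i, NeZero (m i)] [∀ i, NeZero (n i)],
          Tendsto m atTop atTop → Tendsto n atTop atTop →
          Tendsto (fun i => (n i : ℝ) / ((b : ℝ) * (m i : ℝ))) atTop (𝓝 α) →
            TendstoInDistribution (fun i => exactDisplacement b (m i) (n i)) atTop
              (id : ℕ → ℕ) (fun i => exactMeasure (m i) (n i)) (fcfsLaw b α) ∧
            (∀ r : ℕ, Tendsto
              (fun i => ∫ p, (exactDisplacement b (m i) (n i) p : ℝ) ^ r
                ∂exactMeasure (m i) (n i))
              atTop (𝓝 (∫ k, (k : ℝ) ^ r ∂fcfsLaw b α))) ∧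
            TendstoUniformlyOn
              (fun i q => pgf (exactMeasure (m i) (n i)) (exactDisplacement b (m i) (n i)) q)
              (fun q => pgf (fcfsLaw b α) id q) atTop (Metric.closedBall 0 (1 + δ)) := by
  have hP := isProbabilityMeasure_fcfsLaw hb hα0 hα1
  obtain ⟨s, hs1, hsR, hs⟩ := exists_tendsto_lawDist hb hα0 hα1
  -- Here `δ = s - 1`, with `s` depending only on `b` and `α`.
  refine ⟨hP, fun q hq => ⟨integrable_pow_fcfsLaw hb hα0 hα1 hq,
    fun β hβ => integrable_pow_unsuccessfulZero hb hβ.1 hβ.2 hα1 hq,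
    intervalIntegrable_pgf_unsuccessfulZero hb hα0 hα1 hq, pgf_fcfsLaw hb hα0 hα1 hq,
    fun hq1 => ?_⟩, integrable_natCast_pow_fcfsLaw hb hα0 hα1, s - 1, by linarith, ?_⟩
  -- The closed form is needed only on `(0, α]`; the endpoint `β = 0`, where `ζ_ℓ` divides by zero,
  -- does not affect the integral.
  · have heq : Set.EqOn (fun β : ℝ => pgf (poissonTable b β) (unsuccessfulZero b) q)
        (fun β : ℝ => tZero b β / (1 - q) * ∏ ℓ ∈ Finset.range b, (1 - zeta b ℓ q β))
        (Set.uIoc 0 α) := by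
      rw [Set.uIoc_of_le hα0.le]
      exact fun β hβ => one_sub_mul_pgf_unsuccessfulZero hb hβ.1 hβ.2 hα1 hq hq1
    have h2 : pgf (fcfsLaw b α) id q
        = 1 / (α : ℂ) * ∫ β in (0 : ℝ)..α,
            tZero b β / (1 - q) * ∏ ℓ ∈ Finset.range b, (1 - zeta b ℓ q β) := by
      rw [pgf_fcfsLaw hb hα0 hα1 hq,
        intervalIntegral.integral_congr_ae (ae_of_all _ fun β hβ => heq hβ)]
    refine ⟨(intervalIntegrable_pgf_unsuccessfulZero hb hα0 hα1 hq).congr heq, h2, ?_⟩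
    rw [h2]
    simp only [tZero_div_mul_eq]
  · rw [add_sub_cancel]
    refine ⟨fun q hq => integrable_pow_fcfsLaw hb hα0 hα1 (hq.trans hsR), ?_⟩
    intro m n _ _ hm _ hlim
    have hdist := hs m n hm hlim
    refine ⟨tendstoInDistribution_exactDisplacement hb hα0 hα1 hs1 hsR hdist, fun r => ?_,
      tendstoUniformlyOn_pgf_exactDisplacement hb hα0 hα1 hs1 hsR hdist⟩
    obtain ⟨C, hC⟩ := exists_natCast_pow_le r hs1
    exact tendsto_integral_exactDisplacement hb hα0 hα1 hs1 hsR hdist hC
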